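/- **Theorem (multimode fidelity witness estimation).** *Setting.* Let $m\ge 1$, and let $a_i,a_i^\dagger$ be the annihilation and creation operators of $m$ bosonic modes with Fock basis $\{|n\rangle\}$. For $\beta,\xi\in\mathbb C^m$ put $\hat D(\beta)=\bigotimes_i\exp(\beta_ia_i^\dagger-\beta_i^*a_i)$ and $\hat S(\xi)=\bigotimes_i\exp\big(\tfrac12(\xi_i^*a_i^2-\xi_ia_i^{\dagger2})\big)$. Let $|C_i\rangle=\sum_{n<c_i}c_{i,n}|n\rangle$ ($1\le i\le m$, $c_i\ge1$) be normalised (core states), let $\hat U$ be a passive linear transformation with unitary matrix $U$, i.e. $\hat Ua_i^\dagger\hat U^\dagger=\sum_jU_{ji}a_j^\dagger$, and let $|\psi\rangle=\hat S(\xi)\hat D(\beta)\hat U\bigotimes_i|C_i\rangle$ be the target. Let $M,N\ge1$ and $p_i\ge1$ be integers and let $\eta_i\in(0,1)$. For a state $\rho$ of the $m$ modes write $F=\langle\psi^{\otimes M}|\rho^{\otimes M}|\psi^{\otimes M}\rangle$. *Functions.* Let $$\mathcal L_{k,l}(z)=\sum_{q=0}^{\min(k,l)}\frac{\sqrt{k!\,l!}\,(-1)^q}{q!(k-q)!(l-q)!}z^{l-q}z^{*\,k-q},\qquad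 f_{k,l}(z,\eta)=\eta^{-1-\frac{k+l}2}e^{(1-\frac1\eta)|z|^2}\mathcal L_{l,k}\Big(\frac z{\sqrt\eta}\Big),$$ $$g^{(p)}_{k,l}(z,\eta)=\sum_{j=0}^{p-1}(-1)^j\eta^j\sqrt{\tbinom{k+j}k\tbinom{l+j}l}\,f_{k+j,l+j}(z,\eta),\qquad g_{C_i}^{(p)}(z,\eta)=\sum_{0\le k,l<c_i}c_{i,k}^*c_{i,l}\,g^{(p)}_{k,l}(z,\eta).$$ *Protocol.* Measure $N$ copies of $\rho$ by unbalanced heterodyne detection: the samples $\gamma^{(1)},\dots,\gamma^{(N)}\in\mathbb C^m$ are independent with density $\gamma\mapsto\pi^{-m}\langle\gamma,\xi|\rho|\gamma,\xi\rangle$, where $|\gamma,\xi\rangle=\hat S(\xi)\hat D(\gamma)|0\rangle$. Compute $\alpha^{(k)}=U^\dagger(\gamma^{(k)}-\beta)$, let $F_i$ be the mean of $g_{C_i}^{(p_i)}(\cdot,\eta_i)$ over $\alpha_i^{(1)},\dots,\alpha_i^{(N)}$, and put $W=1-\sum_i(1-F_i^M)$. Let $\overline W$ be computed in the same way from the estimates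 $\min(1,\max(0,F_i))$ in place of $F_i$. *Guarantee.* For $\epsilon,\delta>0$, an estimate $X\in\{W,\overline W\}$ *satisfies the guarantee* $G(\epsilon,\delta)$ for $\rho$ if $$1-m(1-F)-\epsilon\le X\le F+\epsilon\quad\text{with probability at least }1-\delta,$$ and, when $\rho=|\psi\rangle\langle\psi|$, $X\ge1-\epsilon$ with probability at least $1-\delta$. *Constants.* For $|C\rangle=\sum_{n<c}c_n|n\rangle$ let $A=\big(\sum_{n<c}|c_n|\sqrt{\tbinom{n+p}n}\big)^2$, $$B(\eta)=\sum_{0\le k,l<c}|c_kc_l|\,\eta^{c-1-\frac{k+l}2}\tbinom{\max(k,l)+p}{p-1}\sqrt{2^{|l-k|}\tbinom{\max(k,l)}{\min(k,l)}},\qquad \eta_{C,p}(\epsilon)=\min\Big\{\Big[\tfrac{c\epsilon}{(c+p)A}\Big]^{\frac1p},\tfrac{p+1}{p(p+c)}\Big\},$$ $$K_{C,p}(\eta)=\max\Big\{\frac{2A^{\frac{2c}p}B(\eta)^2(c+p)^{2+\frac{2c}p}}{c^{\frac{2c}p}p^2},\frac{2p^{2c-2}B(\eta)^2(c+p)^{2c+2}}{(p+1)^{2c}}\Big\}.$$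 *Claims.* The sample law is a probability law, and: 1. (Explicit failure probability.) For every $\epsilon>0$, with $\eta_i=\eta_{C_i,p_i}\big(\tfrac\epsilon{Mm}\big)$ (for which the value $1$ is allowed here) and for every state $\rho$ and every $N\ge 1$, $\overline W$ satisfies $G(\epsilon,P_W)$, where $$P_W=2\sum_{i=1}^m\exp\Big[-\frac{N}{K_{C_i,p_i}(\eta_i)}\Big(\frac{\epsilon}{Mm}\Big)^{2+\frac{2c_i}{p_i}}\Big].$$ 2. (Number of samples.) Let $n_i$ be the number of $j$ with $c_j/p_j=c_i/p_i$. For all integers $\bar c,\bar p$ there is a constant $K>0$, depending only on $\bar c,\bar p$, such that whenever $c_i\le\bar c$ and $p_i\le\bar p$ for all $i$, for every target, every $M\ge1$ and every $\epsilon>0$ there are parameters $\eta_i\in(0,1)$ for which the following holds for all $\delta>0$ and all states $\rho$: if $$N\ge K\max_i\Big\{\Big(\frac{Mm}\epsilon\Big)^{2+\frac{2c_i}{p_i}}\log(2n_i)\log\frac2\delta\Big\},\qquad N\ge 1,$$ then $\overline W$ satisfies $G(\epsilon,\delta)$, and, if moreover $\epsilon\le m$, also $W$ satisfies $G(\epsilon,\delta)$.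 -/

import Mathlib

open scoped BigOperators ComplexConjugate InnerProductSpace
open MeasureTheory

namespace CVWitness

noncomputable section

/-! ### Fock space of `m` modes -/

/-- Occupation numbers of `m` modes. -/
abbrev Occ (m : ℕ) : Type := Fin m → ℕ

/-- The Hilbert space of `m` bosonic modes, in the Fock representation: `ℓ²(ℕ^m)`. -/
abbrev Fock (m : ℕ) : Type := lp (fun _ : Occ m => ℂ) 2

/-- Fock basis state `|n₁ … n_m⟩`. -/
def ket {m : ℕ} (n : Occ m) : Fock m := lp.single 2 n (1 : ℂ)

/-- Vacuum state. -/
def vac (m : ℕ) : Fock m := ket 0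

/-- The finite linear combinations of Fock states, the common invariant domain on which the
ladder operators are defined. -/
abbrev Fin0 (m : ℕ) : Type := Occ m →₀ ℂ

/-- Inclusion of the finite linear combinations of Fock states in the Hilbert space. -/
def incl (m : ℕ) : Fin0 m →ₗ[ℂ] Fock m := Finsupp.linearCombination ℂ (fun n => ket n)

/-- Creation operator of mode `i`: `|n⟩ ↦ √(n_i + 1) |n + e_i⟩`. -/
def creation {m : ℕ} (i : Fin m) : Fin0 m →ₗ[ℂ] Fin0 m :=
  Finsupp.linearCombination ℂ
    (fun n => Finsupp.single (n + Pi.single i 1) ((Real.sqrt ((n i : ℝ) + 1) : ℝ) : ℂ))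

/-- Annihilation operator of mode `i`: `|n⟩ ↦ √(n_i) |n - e_i⟩` (which is `0` if `n_i = 0`). -/
def annihilation {m : ℕ} (i : Fin m) : Fin0 m →ₗ[ℂ] Fin0 m :=
  Finsupp.linearCombination ℂ
    (fun n => Finsupp.single (n - Pi.single i 1) ((Real.sqrt (n i : ℝ) : ℝ) : ℂ))

/-! ### Gaussian unitaries -/

/-- `W = exp(A)` for a skew-symmetric operator `A` defined on the finite combinations of Fock
states: `W` is the time-one element of a strongly continuous one-parameter unitary group whose
generator extends `A`. When `A` is essentially skew-adjoint (all the generators below are, the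
finite combinations of Fock states being analytic vectors) there is exactly one such `W`. -/
def IsExp {m : ℕ} (A : Fin0 m →ₗ[ℂ] Fin0 m) (W : Fock m ≃ₗᵢ[ℂ] Fock m) : Prop :=
  ∃ V : ℝ → (Fock m ≃ₗᵢ[ℂ] Fock m),
    (∀ s t : ℝ, V (s + t) = V s * V t) ∧
    (∀ x : Fock m, Continuous fun t => V t x) ∧
    (∀ v : Fin0 m, HasDerivAt (fun t => V t (incl m v)) (incl m (A v)) 0) ∧
    V 1 = W

open Classical in
/-- The unitary operator `exp(A)`. -/
def opExp {m : ℕ} (A : Fin0 m →ₗ[ℂ] Fin0 m) : Fock m ≃ₗᵢ[ℂ] Fock m :=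
  if h : ∃ W, IsExp A W then h.choose else 1

/-- Displacement operator `D(β) = ⨂ᵢ exp(βᵢ aᵢ† - βᵢ* aᵢ) = exp(∑ᵢ (βᵢ aᵢ† - βᵢ* aᵢ))`. -/
def displacement {m : ℕ} (β : Fin m → ℂ) : Fock m ≃ₗᵢ[ℂ] Fock m :=
  opExp (∑ i, (β i • creation i - conj (β i) • annihilation i))

/-- Squeezing operator
`S(ξ) = ⨂ᵢ exp(½ (ξᵢ* aᵢ² - ξᵢ aᵢ†²)) = exp(∑ᵢ ½ (ξᵢ* aᵢ² - ξᵢ aᵢ†²))`. -/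
def squeezing {m : ℕ} (ξ : Fin m → ℂ) : Fock m ≃ₗᵢ[ℂ] Fock m :=
  opExp (∑ i, (1 / 2 : ℂ) • (conj (ξ i) • (annihilation i ∘ₗ annihilation i)
    - ξ i • (creation i ∘ₗ creation i)))

/-- `Uhat` is a passive linear transformation of `m` modes with matrix `U`:
`Û aᵢ† Û† = ∑ⱼ Uⱼᵢ aⱼ†` and `Û aᵢ Û† = ∑ⱼ Uⱼᵢ* aⱼ` (so that `Û|α⟩ = |Uα⟩` up to a phase). The two
relations are written as `Û aᵢ† = ∑ⱼ Uⱼᵢ aⱼ† Û` and `Û aᵢ = ∑ⱼ Uⱼᵢ* aⱼ Û`, between finite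
combinations `w`, `v` of Fock states. -/
structure IsPassive {m : ℕ} (U : Matrix (Fin m) (Fin m) ℂ) (Uhat : Fock m ≃ₗᵢ[ℂ] Fock m) :
    Prop where
  creation_rel : ∀ (i : Fin m) (v w : Fin0 m),
    ⟪incl m w, Uhat (incl m (creation i v))⟫_ℂ
      = ∑ j, U j i * ⟪incl m (annihilation j w), Uhat (incl m v)⟫_ℂ
  annihilation_rel : ∀ (i : Fin m) (v w : Fin0 m),
    ⟪incl m w, Uhat (incl m (annihilation i v))⟫_ℂ
      = ∑ j, conj (U j i) * ⟪incl m (creation j w), Uhat (incl m v)⟫_ℂ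

/-! ### States and fidelities -/

/-- Density operators: positive operators of trace one. -/
structure IsDensity {m : ℕ} (ρ : Fock m →L[ℂ] Fock m) : Prop where
  pos : ρ.IsPositive
  trace_one : HasSum (fun n : Occ m => ⟪ket n, ρ (ket n)⟫_ℂ) 1

/-- Components of `|ψ⟩^{⊗M}` in the product Fock basis of `M` copies of the system. -/
def tensorPowVec {m : ℕ} (M : ℕ) (ψ : Fock m) (a : Fin M → Occ m) : ℂ :=
  ∏ r, ⟪ket (a r), ψ⟫_ℂ

/-- Matrix of `ρ^{⊗M}` in the product Fock basis of `M` copies of the system. -/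
def tensorPowMat {m : ℕ} (M : ℕ) (ρ : Fock m →L[ℂ] Fock m) (a b : Fin M → Occ m) : ℂ :=
  ∏ r, ⟪ket (a r), ρ (ket (b r))⟫_ℂ

/-- `F(|ψ⟩^{⊗M}, ρ^{⊗M}) = ⟨ψ^{⊗M}| ρ^{⊗M} |ψ^{⊗M}⟩`, the fidelity between `M` copies of the pure
state `ψ` and `M` copies of `ρ`. -/
def fidelity {m : ℕ} (M : ℕ) (ψ : Fock m) (ρ : Fock m →L[ℂ] Fock m) : ℝ :=
  (∑' ab : (Fin M → Occ m) × (Fin M → Occ m),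
    conj (tensorPowVec M ψ ab.1) * tensorPowMat M ρ ab.1 ab.2 * tensorPowVec M ψ ab.2).re

/-- The data of a target state `S(ξ) D(β) Û ⨂ᵢ |Cᵢ⟩` on `m` modes, with normalised core states
`|Cᵢ⟩ = ∑_{n < cᵢ} coef i n |n⟩`. -/
structure Target (m : ℕ) where
  c : Fin m → ℕ
  coef : Fin m → ℕ → ℂ
  normalized : ∀ i, ∑ n ∈ Finset.range (c i), ‖coef i n‖ ^ 2 = 1
  U : Matrix (Fin m) (Fin m) ℂ
  unitary_U : U ∈ Matrix.unitaryGroup (Fin m) ℂ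
  Uhat : Fock m ≃ₗᵢ[ℂ] Fock m
  passive : IsPassive U Uhat
  β : Fin m → ℂ
  ξ : Fin m → ℂ

/-- The product `⨂ᵢ |Cᵢ⟩` of the core states. -/
def Target.coreProduct {m : ℕ} (T : Target m) : Fock m :=
  ∑ n ∈ Fintype.piFinset (fun i => Finset.range (T.c i)), (∏ i, T.coef i (n i)) • ket n

/-- The target state `|ψ⟩ = S(ξ) D(β) Û ⨂ᵢ |Cᵢ⟩`. -/
def Target.state {m : ℕ} (T : Target m) : Fock m :=
  squeezing T.ξ (displacement T.β (T.Uhat T.coreProduct))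

/-! ### Heterodyne detection -/

/-- Squeezed coherent state `|γ, ξ⟩ = S(ξ) D(γ) |0⟩`. -/
def squeezedCoherent {m : ℕ} (γ ξ : Fin m → ℂ) : Fock m :=
  squeezing ξ (displacement γ (vac m))

/-- Law of the outcome `γ ∈ ℂ^m` of unbalanced heterodyne detection of all the modes of `ρ`, with
unbalancing parameters `ξ`: density `π^{-m} ⟨γ,ξ|ρ|γ,ξ⟩`. -/
def heterodyneLaw {m : ℕ} (ρ : Fock m →L[ℂ] Fock m) (ξ : Fin m → ℂ) : Measure (Fin m → ℂ) :=
  volume.withDensity fun γ => ENNReal.ofReal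
    ((Real.pi ^ m)⁻¹ * (⟪squeezedCoherent γ ξ, ρ (squeezedCoherent γ ξ)⟫_ℂ).re)

/-- Joint law of the samples when `N` copies of `ρ` are measured, one after the other. -/
def sampleLaw {m : ℕ} (N : ℕ) (ρ : Fock m →L[ℂ] Fock m) (ξ : Fin m → ℂ) :
    Measure (Fin N → Fin m → ℂ) :=
  Measure.pi fun _ => heterodyneLaw ρ ξ

/-! ### Classical post-processing -/

/-- Laguerre 2D polynomials
`𝓛_{k,l}(z) = ∑_q √(k!) √(l!) (-1)^q / (q! (k-q)! (l-q)!) z^{l-q} z*^{k-q}`. -/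
def lag (k l : ℕ) (z : ℂ) : ℂ :=
  ∑ q ∈ Finset.range (min k l + 1),
    ((Real.sqrt (k.factorial : ℝ) * Real.sqrt (l.factorial : ℝ) * (-1) ^ q
      / ((q.factorial : ℝ) * ((k - q).factorial : ℝ) * ((l - q).factorial : ℝ)) : ℝ) : ℂ)
      * z ^ (l - q) * (conj z) ^ (k - q)

/-- `f_{k,l}(z,η) = η^{-(1+(k+l)/2)} e^{(1-1/η)|z|²} 𝓛_{l,k}(z/√η)`. -/
def fEst (k l : ℕ) (z : ℂ) (η : ℝ) : ℂ :=
  ((1 / η ^ (1 + ((k : ℝ) + (l : ℝ)) / 2) * Real.exp ((1 - 1 / η) * ‖z‖ ^ 2) : ℝ) : ℂ)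
    * lag l k (z / ((Real.sqrt η : ℝ) : ℂ))

/-- `g_{k,l}^{(p)}(z,η) = ∑_{j<p} (-1)^j η^j f_{k+j,l+j}(z,η) √(binom(k+j,k) binom(l+j,l))`. -/
def gEst (p k l : ℕ) (z : ℂ) (η : ℝ) : ℂ :=
  ∑ j ∈ Finset.range p,
    (((-1) ^ j * η ^ j * Real.sqrt (((k + j).choose k : ℝ) * ((l + j).choose l : ℝ)) : ℝ) : ℂ)
      * fEst (k + j) (l + j) z η

/-- `g_C^{(p)}(z,η) = ∑_{k,l<c} c_k* c_l g_{k,l}^{(p)}(z,η)`; the sum is real, since exchanging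
`k` and `l` conjugates the summand. -/
def gCore (p c : ℕ) (coef : ℕ → ℂ) (z : ℂ) (η : ℝ) : ℝ :=
  (∑ k ∈ Finset.range c, ∑ l ∈ Finset.range c, conj (coef k) * coef l * gEst p k l z η).re

/-- `α = U† (γ - β)`. -/
def postProcess {m : ℕ} (T : Target m) (γ : Fin m → ℂ) : Fin m → ℂ :=
  T.U.conjTranspose.mulVec (γ - T.β)

/-- `F_{C_i}`: the mean of `g_{C_i}^{(p_i)}(·, η_i)` over the `i`-th post-processed samples. -/
def meanEstimate {m N : ℕ} (T : Target m) (p : Fin m → ℕ) (η : Fin m → ℝ)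
    (γ : Fin N → Fin m → ℂ) (i : Fin m) : ℝ :=
  (1 / (N : ℝ)) * ∑ k, gCore (p i) (T.c i) (T.coef i) (postProcess T (γ k) i) (η i)

/-- The witness estimate `W = 1 - ∑ᵢ (1 - F_{C_i}^M)`, computed from the means themselves. -/
def witness {m N : ℕ} (T : Target m) (p : Fin m → ℕ) (η : Fin m → ℝ) (M : ℕ)
    (γ : Fin N → Fin m → ℂ) : ℝ :=
  1 - ∑ i, (1 - meanEstimate T p η γ i ^ M)

/-- The witness estimate computed from the means after these fidelity estimates have been
truncated to `[0,1]`. -/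
def truncWitness {m N : ℕ} (T : Target m) (p : Fin m → ℕ) (η : Fin m → ℝ) (M : ℕ)
    (γ : Fin N → Fin m → ℂ) : ℝ :=
  1 - ∑ i, (1 - (max 0 (min 1 (meanEstimate T p η γ i))) ^ M)

/-! ### Constants -/

/-- `A_C^{(p)} = (∑_{n<c} |c_n| √binom(n+p,n))²`. -/
def constA (p c : ℕ) (coef : ℕ → ℂ) : ℝ :=
  (∑ n ∈ Finset.range c, ‖coef n‖ * Real.sqrt ((n + p).choose n : ℝ)) ^ 2

/-- `B_C^{(p)}(η) = ∑_{k,l<c} |c_k c_l| η^{c-1-(k+l)/2} binom(max(k,l)+p, p-1)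
√(2^{|l-k|} binom(max(k,l), min(k,l)))`. -/
def constB (p c : ℕ) (coef : ℕ → ℂ) (η : ℝ) : ℝ :=
  ∑ k ∈ Finset.range c, ∑ l ∈ Finset.range c,
    ‖coef k * coef l‖ * η ^ ((c : ℝ) - 1 - ((k : ℝ) + (l : ℝ)) / 2)
      * ((max k l + p).choose (p - 1) : ℝ)
      * Real.sqrt (2 ^ (max k l - min k l) * ((max k l).choose (min k l) : ℝ))

/-- `η_{C,p}` for precision `ε`:
`min { [c ε / ((c+p) A_C^{(p)})]^{1/p}, (p+1) / (p (p+c)) }`. -/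
def etaOpt (p c : ℕ) (coef : ℕ → ℂ) (ε : ℝ) : ℝ :=
  min (((c : ℝ) * ε / (((c : ℝ) + p) * constA p c coef)) ^ (1 / (p : ℝ)))
    (((p : ℝ) + 1) / ((p : ℝ) * ((p : ℝ) + c)))

/-- `K_{C,p}(η)`, the larger of `2 A^{2c/p} B(η)² (c+p)^{2+2c/p} / (c^{2c/p} p²)` and
`2 p^{2c-2} B(η)² (c+p)^{2c+2} / (p+1)^{2c}`. -/
def constK (p c : ℕ) (coef : ℕ → ℂ) (η : ℝ) : ℝ :=
  max
    (2 * constA p c coef ^ (2 * (c : ℝ) / p) * constB p c coef η ^ 2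
        * ((c : ℝ) + p) ^ (2 + 2 * (c : ℝ) / p) / ((c : ℝ) ^ (2 * (c : ℝ) / p) * (p : ℝ) ^ 2))
    (2 * (p : ℝ) ^ (2 * c - 2) * constB p c coef η ^ 2 * ((c : ℝ) + p) ^ (2 * c + 2)
        / ((p : ℝ) + 1) ^ (2 * c))

/-- `P_W = 2 ∑ᵢ exp(- N ε^{2+2cᵢ/pᵢ} / ((Mm)^{2+2cᵢ/pᵢ} K_{Cᵢ,pᵢ}(ηᵢ)))`. -/
def failureProb {m : ℕ} (T : Target m) (p : Fin m → ℕ) (η : Fin m → ℝ) (M N : ℕ) (ε : ℝ) : ℝ :=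
  2 * ∑ i, Real.exp (-((N : ℝ) * ε ^ (2 + 2 * (T.c i : ℝ) / p i)
    / (((M : ℝ) * m) ^ (2 + 2 * (T.c i : ℝ) / p i) * constK (p i) (T.c i) (T.coef i) (η i))))

/-- `nᵢ`: the number of modes `j` with `cⱼ / pⱼ = cᵢ / pᵢ`. -/
def ratioCount {m : ℕ} (c p : Fin m → ℕ) (i : Fin m) : ℕ :=
  (Finset.univ.filter fun j => (c j : ℚ) / (p j : ℚ) = (c i : ℚ) / (p i : ℚ)).card

/-- The guarantee that an estimate `W` of the fidelity witness has to satisfy, for the state `ρ`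
with precision `ε` and failure probability at most `δ`, the `N` samples being drawn by unbalanced
heterodyne detection: (soundness) the two-sided bound, with `F = F(ψ^{⊗M}, ρ^{⊗M})`, and
(completeness) `W ≥ 1 - ε` when the tested state is the target state. -/
def Guarantee {m : ℕ} (T : Target m) (M N : ℕ) (ρ : Fock m →L[ℂ] Fock m) (ε δ : ℝ)
    (W : (Fin N → Fin m → ℂ) → ℝ) : Prop :=
  1 - δ ≤ (sampleLaw N ρ T.ξ).real
      {γ | 1 - (m : ℝ) * (1 - fidelity M T.state ρ) - ε ≤ W γ ∧
        W γ ≤ fidelity M T.state ρ + ε} ∧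
  (ρ = InnerProductSpace.rankOne ℂ T.state T.state →
    1 - δ ≤ (sampleLaw N ρ T.ξ).real {γ | 1 - ε ≤ W γ})

end

end CVWitness

/-!
The law of the samples. A density operator is a mixture `∑ |uₙ⟩⟨uₙ|` with `∑ ‖uₙ‖² = 1`
(`IsDensity.exists_mixture`), and heterodyne detection resolves the identity: the amplitudes
`π^{-m/2} ⟨α|a⟩` of the Fock states are orthonormal in `L²(ℂ^m)`, so that the outcome density of a
vector `u` has total mass `‖u‖²` (`integral_norm_hetAmp_sq`). This makes the sample law a probability
law. Moreover `S(ξ) D(γ)|0⟩` is, up to a phase, the image of the coherent state of `U†(γ - β)` under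
`S(ξ) D(β) Û` (`exists_phase_squeezedCoherent`). Hence the post-processed outcome is distributed as
an ordinary heterodyne outcome of the state pulled back by this unitary, which maps the product of
the core states to the target. Of the squeezing only its unitarity matters. For the displacements,
`exp` has to be identified: the Weyl unitaries are constructed from their action on exponential
vectors (`isExp_weyl`), and every unitary group with the same generator on the finite combinations
of Fock states agrees with them, because the exponential vectors lie in the domain of its closed
generator (`eq_weyl_of_isExp`).

The estimator of one mode. Gaussian moments give the Fock matrix elements of the operator measured
by `g_{k,l}^{(p)}`: besides the element `(k,l)`, only those with an index shift of at least `p`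
survive, and for `η ≤ (p+1)/(p(p+c))` the largest of these is the one of shift `p`. The mean of
`g_C^{(p)}` therefore differs from the fidelity of the mode with `|C⟩` by at most `A η^p`
(`norm_integral_gCoreC_sub_le`). The Laguerre polynomials are matrix elements of displacement
operators, so that unitarity bounds them, and `|g_C^{(p)}| ≤ B(η) / η^c` (`norm_gCoreC_le`).
Hoeffding's inequality and a union bound over the modes turn this into a bound on the probability
that some estimate is off (`real_sampleLaw_deviation_le`).

The witness. The projections `Pᵢ` onto the core states of single modes commute, and their product
is the projection onto the product of the core states; therefore `1 - ∑ (1 - Fᵢ) ≤ F₁ ≤ Fᵢ` for the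
mode fidelities `Fᵢ` and the one-copy fidelity `F₁` (`exists_mode_fidelity`). The inequality
`a^M + b^M ≤ 1 + (a+b-1)^M` carries this over to `M` copies, whose fidelity is `F₁^M`
(`one_sub_sum_pow_le_pow`, `fidelity_eq_pow`): estimates that are close to the mode fidelities give
a witness between `1 - m (1 - F) - ε` and `F + ε` (`guarantee_of_close`). Completeness is the case
`F = 1` of soundness.

Parameters. The two terms in the maximum that defines `K_{C,p}` are the Hoeffding exponents for the
two terms in the minimum that defines `η_{C,p}` (`div_constK_le`). For the number of samples, `η`
proportional to `(ε/(Mm))^{1/p}` with a small uniform factor is enough; the failure probability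
`δ / (nᵢ Q)` granted to mode `i` sums to at most `δ`, because the modes with a common ratio `cᵢ/pᵢ`
contribute `1/Q` together and there are at most `Q` ratios (`sum_inv_ratioCount_le`).
-/

namespace CVWitness

noncomputable section

/-! ### Gaussian moments of one mode -/

/-- The `k`-th backward difference of a binomial coefficient is a binomial coefficient. -/
theorem alternating_sum_choose_mul_choose (k t s : ℕ) :
    ∑ q ∈ Finset.range (k + 1), (-1 : ℝ) ^ q * (k.choose q : ℝ) * ((t + k - q).choose s : ℝ)
      = if k ≤ s then (t.choose (s - k) : ℝ) else 0 := by
  induction k generalizing t with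
  | zero => simp
  | succ k ih =>
    have key : ∑ q ∈ Finset.range (k + 1 + 1),
        (-1 : ℝ) ^ q * ((k + 1).choose q : ℝ) * ((t + (k + 1) - q).choose s : ℝ)
        = (∑ q ∈ Finset.range (k + 1),
            (-1 : ℝ) ^ q * (k.choose q : ℝ) * ((t + 1 + k - q).choose s : ℝ))
          - ∑ q ∈ Finset.range (k + 1),
            (-1 : ℝ) ^ q * (k.choose q : ℝ) * ((t + k - q).choose s : ℝ) := by
      rw [Finset.sum_range_succ']
      have h2 : ∑ q ∈ Finset.range (k + 1),
          (-1 : ℝ) ^ q * (k.choose q : ℝ) * ((t + 1 + k - q).choose s : ℝ)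
          = (∑ q ∈ Finset.range (k + 1),
            (-1 : ℝ) ^ (q + 1) * (k.choose (q + 1) : ℝ) * ((t + k - q).choose s : ℝ))
            + ((t + 1 + k).choose s : ℝ) := by
        rw [Finset.sum_range_succ', Finset.sum_range_succ _ k]
        simp only [pow_zero, Nat.choose_zero_right, Nat.cast_one, mul_one, one_mul, Nat.sub_zero,
          Nat.choose_succ_self, Nat.cast_zero, mul_zero, zero_mul, add_zero]
        congr 1
        refine Finset.sum_congr rfl fun q _ => ?_
        rw [show t + 1 + k - (q + 1) = t + k - q by omega]
      rw [h2]
      have h3 : ∀ q, ((k + 1).choose (q + 1) : ℝ) = k.choose q + k.choose (q + 1) := fun q => by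
        rw [Nat.choose_succ_succ]; push_cast; ring
      simp only [h3, pow_zero, Nat.choose_zero_right, Nat.cast_one, mul_one, one_mul, Nat.sub_zero]
      rw [show t + (k + 1) = t + 1 + k by ring, add_sub_right_comm, ← Finset.sum_sub_distrib]
      congr 1
      refine Finset.sum_congr rfl fun q _ => ?_
      rw [show t + 1 + k - (q + 1) = t + k - q by omega]
      ring
    rw [key, ih, ih]
    rcases lt_trichotomy k s with h | h | h
    · rw [if_pos h.le, if_pos h.le, if_pos (by omega : k + 1 ≤ s)]
      obtain ⟨j, rfl⟩ : ∃ j, s = k + 1 + j := ⟨s - k - 1, by omega⟩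
      rw [show k + 1 + j - k = j + 1 by omega, show k + 1 + j - (k + 1) = j by omega,
        Nat.choose_succ_succ]
      push_cast; ring
    · subst h; simp
    · rw [if_neg (by omega), if_neg (by omega), if_neg (by omega)]; simp

/-- The Gaussian monomial `e^{-b|z|²} z^s z̄^t`. -/
def gaussMono (b : ℝ) (s t : ℕ) (z : ℂ) : ℂ :=
  (Real.exp (-b * ‖z‖ ^ 2) : ℂ) * z ^ s * conj z ^ t

theorem norm_gaussMono (b : ℝ) (s t : ℕ) (z : ℂ) :
    ‖gaussMono b s t z‖ = ‖z‖ ^ ((s + t : ℕ) : ℝ) * Real.exp (-b * ‖z‖ ^ (2 : ℝ)) := by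
  rw [Real.rpow_natCast, show (2 : ℝ) = ((2 : ℕ) : ℝ) by norm_num, Real.rpow_natCast]
  simp only [gaussMono, norm_mul, norm_pow, RCLike.norm_conj, Complex.norm_real, Real.norm_eq_abs,
    abs_of_pos (Real.exp_pos _)]
  ring

theorem continuous_gaussMono (b : ℝ) (s t : ℕ) : Continuous (gaussMono b s t) := by
  unfold gaussMono
  have : Continuous fun z : ℂ => conj z := Complex.continuous_conj
  fun_prop

theorem integrable_gaussMono {b : ℝ} (hb : 0 < b) (s t : ℕ) : Integrable (gaussMono b s t) := by
  rw [← integrable_norm_iff (continuous_gaussMono b s t).aestronglyMeasurable]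
  simp only [norm_gaussMono]
  have hq : (-2 : ℝ) < ((s + t : ℕ) : ℝ) := by
    have : (0 : ℝ) ≤ ((s + t : ℕ) : ℝ) := Nat.cast_nonneg _
    linarith
  refine not_imp_comm.1 integral_undef ?_
  rw [Complex.integral_rpow_mul_exp_neg_mul_rpow (by norm_num) hq hb]
  have : 0 < Real.Gamma ((((s + t : ℕ) : ℝ) + 2) / 2) := Real.Gamma_pos_of_pos (by linarith)
  positivity

theorem integral_gaussMono {b : ℝ} (hb : 0 < b) (s t : ℕ) :
    ∫ z, gaussMono b s t z
      = if s = t then ((Real.pi * s.factorial / b ^ (s + 1) : ℝ) : ℂ) else 0 := by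
  split_ifs with h
  · subst h
    have h1 : ∀ z, gaussMono b s s z
        = ((‖z‖ ^ ((2 * s : ℕ) : ℝ) * Real.exp (-b * ‖z‖ ^ (2 : ℝ)) : ℝ) : ℂ) := fun z => by
      rw [Real.rpow_natCast, show (2 : ℝ) = ((2 : ℕ) : ℝ) by norm_num, Real.rpow_natCast,
        gaussMono, mul_assoc, ← mul_pow, Complex.mul_conj, Complex.normSq_eq_norm_sq]
      push_cast
      rw [pow_mul]; ring
    have hq : (-2 : ℝ) < ((2 * s : ℕ) : ℝ) := by
      have : (0 : ℝ) ≤ ((2 * s : ℕ) : ℝ) := Nat.cast_nonneg _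
      linarith
    simp only [h1]
    rw [integral_complex_ofReal, Complex.integral_rpow_mul_exp_neg_mul_rpow (by norm_num) hq hb]
    congr 1
    rw [show (((2 * s : ℕ) : ℝ) + 2) / 2 = (s : ℝ) + 1 by push_cast; ring,
      Real.Gamma_nat_eq_factorial,
      show -(((2 * s : ℕ) : ℝ) + 2) / 2 = -((s + 1 : ℕ) : ℝ) by push_cast; ring,
      Real.rpow_neg hb.le, Real.rpow_natCast]
    ring
  · -- rotating the plane multiplies the integral by a phase different from `1`
    have hst : ((s : ℝ) - t) ≠ 0 := sub_ne_zero.2 (by exact_mod_cast h)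
    set θ : ℝ := Real.pi / ((s : ℝ) - t) with hθ
    set c : Circle := Circle.exp θ with hc
    have hmp : MeasurePreserving (rotation c) := (rotation c).measurePreserving
    have h1 := hmp.integral_comp (rotation c).toHomeomorph.measurableEmbedding (gaussMono b s t)
    have h2 : ∀ z, gaussMono b s t (rotation c z) = -gaussMono b s t z := fun z => by
      have hcc : (c : ℂ) ^ s * conj (c : ℂ) ^ t = -1 := by
        rw [hc, Circle.coe_exp, ← Complex.exp_conj, ← Complex.exp_nat_mul, ← Complex.exp_nat_mul,
          ← Complex.exp_add, ← Complex.exp_pi_mul_I]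
        congr 1
        simp only [map_mul, Complex.conj_ofReal, Complex.conj_I, hθ]
        have h3 : ((s : ℂ) - t) ≠ 0 := by exact_mod_cast hst
        push_cast
        field_simp
        ring
      simp only [gaussMono, rotation_apply, norm_mul, Circle.norm_coe, one_mul, map_mul, mul_pow]
      linear_combination (Real.exp (-b * ‖z‖ ^ 2) : ℂ) * z ^ s * conj z ^ t * hcc
    simp only [h2, integral_neg] at h1
    exact self_eq_neg.1 h1.symm

/-- Fock-basis matrix elements of the operator whose heterodyne symbol is `f_{k,l}`. -/
theorem integral_fEst_mul_gaussMono (k l s t : ℕ) {η : ℝ} (hη : 0 < η) :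
    Integrable (fun z => fEst k l z η * gaussMono 1 t s z) ∧
    ∫ z, fEst k l z η * gaussMono 1 t s z
      = if k ≤ s ∧ t = s - k + l then
          ((Real.pi * Real.sqrt (s.factorial * t.factorial) * (η ^ (s - k)
            * Real.sqrt ((s.choose k : ℝ) * (t.choose l : ℝ))) : ℝ) : ℂ) else 0 := by
  set r := Real.sqrt η with hr
  have hr0 : 0 < r := Real.sqrt_pos.2 hη
  have hr2 : η = r ^ 2 := (Real.sq_sqrt hη.le).symm
  have hpow : η ^ (1 + ((k : ℝ) + (l : ℝ)) / 2) = r ^ (2 + k + l) := by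
    rw [hr, Real.sqrt_eq_rpow, ← Real.rpow_natCast, ← Real.rpow_mul hη.le]
    congr 1; push_cast; ring
  have hrC : (r : ℂ) ≠ 0 := by exact_mod_cast hr0.ne'
  set w : ℕ → ℝ := fun q => Real.sqrt (l.factorial : ℝ) * Real.sqrt (k.factorial : ℝ) * (-1) ^ q
      / ((q.factorial : ℝ) * ((l - q).factorial : ℝ) * ((k - q).factorial : ℝ)) with hw
  have h1 : ∀ z, fEst k l z η * gaussMono 1 t s z
      = ∑ q ∈ Finset.range (min l k + 1),
          ((w q / (r ^ (2 + k + l) * r ^ (k - q + (l - q))) : ℝ) : ℂ)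
            * gaussMono (1 / η) (k - q + t) (l - q + s) z := fun z => by
    simp only [fEst, lag, Finset.mul_sum, Finset.sum_mul, hpow]
    refine Finset.sum_congr rfl fun q _ => ?_
    have he : (Real.exp (-(1 / η) * ‖z‖ ^ 2) : ℂ)
        = (Real.exp ((1 - 1 / η) * ‖z‖ ^ 2) : ℂ) * (Real.exp (-1 * ‖z‖ ^ 2) : ℂ) := by
      rw [← Complex.ofReal_mul, ← Real.exp_add]; congr 2; ring
    simp only [gaussMono]
    rw [he]
    simp only [map_div₀, Complex.conj_ofReal, div_pow, hw, ← hr]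
    push_cast
    field_simp
    simp only [pow_add]
    ring
  have hb : 0 < 1 / η := by positivity
  have hint : ∀ q, Integrable fun z => ((w q / (r ^ (2 + k + l) * r ^ (k - q + (l - q))) : ℝ) : ℂ)
            * gaussMono (1 / η) (k - q + t) (l - q + s) z :=
    fun q => (integrable_gaussMono hb _ _).const_mul _
  simp only [h1]
  refine ⟨integrable_finsetSum _ fun q _ => hint q, ?_⟩
  rw [integral_finsetSum _ fun q _ => hint q]
  simp only [integral_const_mul, integral_gaussMono hb]
  by_cases hkl : k + t = l + s
  swap
  · rw [if_neg (by omega)]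
    refine Finset.sum_eq_zero fun q hq => ?_
    rw [Finset.mem_range] at hq
    rw [if_neg (by omega), mul_zero]
  have h2 : ∀ q ∈ Finset.range (min l k + 1),
      ((w q / (r ^ (2 + k + l) * r ^ (k - q + (l - q))) : ℝ) : ℂ) *
        (if k - q + t = l - q + s then
          ((Real.pi * (k - q + t).factorial / (1 / η) ^ (k - q + t + 1) : ℝ) : ℂ) else 0)
      = ((Real.pi * (η ^ t / η ^ l) * (Real.sqrt (l.factorial : ℝ) * Real.sqrt (k.factorial : ℝ))
          * (s.factorial / k.factorial)
          * ((-1 : ℝ) ^ q * (k.choose q : ℝ) * ((t + k - q).choose s : ℝ)) : ℝ) : ℂ) := by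
    intro q hq
    rw [Finset.mem_range] at hq
    obtain ⟨k', rfl⟩ : ∃ k', k = q + k' := ⟨k - q, by omega⟩
    obtain ⟨l', rfl⟩ : ∃ l', l = q + l' := ⟨l - q, by omega⟩
    obtain rfl : s = k' + t - l' := by omega
    rw [if_pos (by omega), ← Complex.ofReal_mul]
    congr 1
    simp only [hw, Nat.add_sub_cancel_left]
    have e1 : ((q + k').choose q : ℝ) = (q + k').factorial / (q.factorial * k'.factorial) := by
      rw [Nat.cast_choose ℝ (by omega), Nat.add_sub_cancel_left]
    have e2 : ((t + (q + k') - q).choose (k' + t - l') : ℝ)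
        = (k' + t).factorial / ((k' + t - l').factorial * l'.factorial) := by
      rw [show t + (q + k') - q = k' + t by omega, Nat.cast_choose ℝ (by omega),
        show k' + t - (k' + t - l') = l' by omega]
    rw [e1, e2, hr2]
    have f0 : r ≠ 0 := hr0.ne'
    have f1 : ((q + k').factorial : ℝ) ≠ 0 := by positivity
    have f2 : ((k' + t - l').factorial : ℝ) ≠ 0 := by positivity
    simp only [one_div, inv_pow, div_inv_eq_mul]
    field_simp
    ring
  rw [Finset.sum_congr rfl h2, ← Complex.ofReal_sum, ← Finset.mul_sum]
  have h3 : ∑ q ∈ Finset.range (min l k + 1),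
      ((-1 : ℝ) ^ q * (k.choose q : ℝ) * ((t + k - q).choose s : ℝ))
      = ∑ q ∈ Finset.range (k + 1),
      ((-1 : ℝ) ^ q * (k.choose q : ℝ) * ((t + k - q).choose s : ℝ)) := by
    refine Finset.sum_subset (fun q hq => ?_) fun q hq hq' => ?_
    · simp only [Finset.mem_range] at hq ⊢; omega
    · simp only [Finset.mem_range] at hq hq'
      rw [Nat.choose_eq_zero_of_lt (by omega : t + k - q < s)]; simp
  rw [h3, alternating_sum_choose_mul_choose]
  by_cases hks : k ≤ s
  swap
  · rw [if_neg hks, if_neg (by tauto)]; simp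
  rw [if_pos hks, if_pos ⟨hks, by omega⟩]
  congr 1
  obtain ⟨J, rfl⟩ : ∃ J, s = k + J := ⟨s - k, by omega⟩
  obtain rfl : t = l + J := by omega
  rw [Nat.add_sub_cancel_left, show (l + J).choose J = (l + J).choose l from
    Nat.choose_symm_add.symm]
  have e1 : η ^ (l + J) / η ^ l = η ^ J := by rw [pow_add]; field_simp
  rw [e1]
  have e2 : Real.sqrt (l.factorial : ℝ) * Real.sqrt (k.factorial : ℝ)
      * ((k + J).factorial / k.factorial) * ((l + J).choose l : ℝ)
      = Real.sqrt ((k + J).factorial * (l + J).factorial)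
        * Real.sqrt (((k + J).choose k : ℝ) * ((l + J).choose l : ℝ)) := by
    rw [← Real.sqrt_mul (by positivity), ← Real.sqrt_mul (by positivity)]
    symm
    rw [Real.sqrt_eq_iff_eq_sq (by positivity) (by positivity), mul_pow, mul_pow,
      Real.sq_sqrt (by positivity), Nat.cast_choose ℝ (by omega : k ≤ k + J),
      Nat.cast_choose ℝ (by omega : l ≤ l + J), Nat.add_sub_cancel_left, Nat.add_sub_cancel_left]
    field_simp
  linear_combination (Real.pi * η ^ J) * e2

/-- Fock-basis matrix elements of the operator whose heterodyne symbol is `g_{k,l}^{(p)}`: apart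
from the wanted element `(k, l)`, only those with an index shift of at least `p` survive, because
the alternating binomial sum vanishes for shifts between `1` and `p - 1`. -/
theorem integral_gEst_mul_gaussMono (p k l s t : ℕ) {η : ℝ} (hη : 0 < η) :
    Integrable (fun z => gEst p k l z η * gaussMono 1 t s z) ∧
    ∫ z, gEst p k l z η * gaussMono 1 t s z
      = if k ≤ s ∧ t = s - k + l then
          ((Real.pi * Real.sqrt (s.factorial * t.factorial) * (η ^ (s - k)
            * Real.sqrt ((s.choose k : ℝ) * (t.choose l : ℝ))
            * ∑ j ∈ Finset.range p, (-1 : ℝ) ^ j * ((s - k).choose j : ℝ)) : ℝ) : ℂ) else 0 := by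
  simp only [gEst, Finset.sum_mul, mul_assoc]
  have hint := fun j => (integral_fEst_mul_gaussMono (k + j) (l + j) s t hη).1.const_mul
    (((-1) ^ j * η ^ j * Real.sqrt (((k + j).choose k : ℝ) * ((l + j).choose l : ℝ)) : ℝ) : ℂ)
  simp only [mul_assoc] at hint
  refine ⟨integrable_finsetSum _ fun j _ => hint j, ?_⟩
  rw [integral_finsetSum _ fun j _ => hint j]
  simp only [integral_const_mul, (integral_fEst_mul_gaussMono (k + _) (l + _) s t hη).2]
  split_ifs with h
  swap
  · refine Finset.sum_eq_zero fun j _ => ?_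
    rw [if_neg (by omega), mul_zero]
  simp only [Finset.mul_sum]
  rw [Complex.ofReal_sum]
  refine Finset.sum_congr rfl fun j _ => ?_
  obtain ⟨J, rfl⟩ : ∃ J, s = k + J := ⟨s - k, by omega⟩
  obtain rfl : t = l + J := by omega
  by_cases hj : j ≤ J
  swap
  · rw [if_neg (by omega), Nat.add_sub_cancel_left, Nat.choose_eq_zero_of_lt (by omega : J < j)]
    simp
  rw [if_pos (by omega), ← Complex.ofReal_mul]
  congr 1
  obtain ⟨i, rfl⟩ : ∃ i, J = j + i := ⟨J - j, by omega⟩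
  have hc : ∀ n : ℕ, ((n + j).choose n : ℝ) * ((n + (j + i)).choose (n + j) : ℝ)
      = ((n + (j + i)).choose n : ℝ) * ((j + i).choose j : ℝ) := fun n => by
    rw [mul_comm]
    have := Nat.choose_mul (n := n + (j + i)) (k := n + j) (s := n) (by omega)
    rw [Nat.add_sub_cancel_left, Nat.add_sub_cancel_left] at this
    exact_mod_cast this
  have hs : Real.sqrt (((k + j).choose k : ℝ) * ((l + j).choose l : ℝ))
      * Real.sqrt (((k + (j + i)).choose (k + j) : ℝ) * ((l + (j + i)).choose (l + j) : ℝ))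
      = Real.sqrt (((k + (j + i)).choose k : ℝ) * ((l + (j + i)).choose l : ℝ))
        * ((j + i).choose j : ℝ) := by
    rw [← Real.sqrt_mul (by positivity),
      show ((k + j).choose k : ℝ) * ((l + j).choose l : ℝ) *
        (((k + (j + i)).choose (k + j) : ℝ) * ((l + (j + i)).choose (l + j) : ℝ))
        = ((k + (j + i)).choose k : ℝ) * ((l + (j + i)).choose l : ℝ)
          * ((j + i).choose j : ℝ) ^ 2 by
        linear_combination (((l + j).choose l : ℝ) * ((l + (j + i)).choose (l + j) : ℝ)) * hc k
          + (((k + (j + i)).choose k : ℝ) * ((j + i).choose j : ℝ)) * hc l,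
      Real.sqrt_mul (by positivity), Real.sqrt_sq (by positivity)]
  rw [show k + (j + i) - (k + j) = i by omega, Nat.add_sub_cancel_left, pow_add]
  linear_combination ((-1 : ℝ) ^ j * η ^ j * η ^ i * Real.pi *
    Real.sqrt ((k + (j + i)).factorial * (l + (j + i)).factorial)) * hs

/-! ### Exponential vectors in Fock space -/

/-- A product of absolutely convergent series over finitely many independent indices. -/
theorem hasSum_prod_pi {κ : Type*} {M : ℕ} (f : Fin M → κ → ℂ)
    (hf : ∀ i, Summable fun k => ‖f i k‖) :
    (Summable fun x : Fin M → κ => ‖∏ i, f i (x i)‖) ∧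
    HasSum (fun x : Fin M → κ => ∏ i, f i (x i)) (∏ i, ∑' k, f i k) := by
  induction M with
  | zero => exact ⟨(hasSum_fintype _).summable, by
      simp⟩
  | succ M ih =>
    obtain ⟨h1, h2⟩ := ih (fun i => f i.succ) fun i => hf _
    have h3 := (hf 0).mul_norm h1
    have h4 := tsum_mul_tsum_of_summable_norm (hf 0) h1
    rw [h2.tsum_eq] at h4
    have e : ∀ x : κ × (Fin M → κ), ∏ i, f i ((Fin.consEquiv fun _ => κ) x i)
        = f 0 x.1 * ∏ i, f (Fin.succ i) (x.2 i) := fun x => by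
      rw [Fin.prod_univ_succ]; simp [Fin.consEquiv]
    constructor
    · rw [← (Fin.consEquiv fun _ => κ).summable_iff]
      simpa only [Function.comp_def, e] using h3
    · rw [← (Fin.consEquiv fun _ => κ).hasSum_iff, Fin.prod_univ_succ, h4]
      simpa only [Function.comp_def, e] using h3.of_norm.hasSum

theorem summable_norm_pow_div_sqrt_factorial (a : ℂ) :
    Summable fun n : ℕ => ‖a ^ n / (Real.sqrt n.factorial : ℂ)‖ := by
  have h1 : Summable fun n : ℕ => (2 * ‖a‖ ^ 2) ^ n / (n.factorial : ℝ) :=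
    Real.summable_pow_div_factorial _
  have h2 : Summable fun n : ℕ => ((1 : ℝ) / 2) ^ n := summable_geometric_two
  refine Summable.of_nonneg_of_le (fun _ => norm_nonneg _) (fun n => ?_) (h1.add h2)
  rw [norm_div, norm_pow, Complex.norm_real, Real.norm_of_nonneg (Real.sqrt_nonneg _)]
  have hx : (2 * ‖a‖ ^ 2) ^ n / (n.factorial : ℝ) * ((1 : ℝ) / 2) ^ n
      = (‖a‖ ^ n / Real.sqrt n.factorial) ^ 2 := by
    rw [div_pow (‖a‖ ^ n), Real.sq_sqrt (by positivity), mul_pow, ← pow_mul, ← pow_mul,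
      mul_comm n 2, div_pow, one_pow]
    field_simp
  have h3 : 0 ≤ ‖a‖ ^ n / Real.sqrt n.factorial := by positivity
  have h4 : 0 ≤ (2 * ‖a‖ ^ 2) ^ n / (n.factorial : ℝ) := by positivity
  have h5 : 0 ≤ ((1 : ℝ) / 2) ^ n := by positivity
  refine abs_le_of_sq_le_sq' ?_ (by positivity) |>.2
  nlinarith [mul_nonneg h4 h5]

variable {m : ℕ}

theorem inner_ket_left (n : Occ m) (u : Fock m) : ⟪ket n, u⟫_ℂ = u n := by
  rw [ket, lp.inner_single_left]; simp

theorem inner_ket_right (n : Occ m) (u : Fock m) : ⟪u, ket n⟫_ℂ = conj (u n) := by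
  rw [← inner_conj_symm, inner_ket_left]

theorem ket_apply (n k : Occ m) : (ket n : Fock m) k = if n = k then 1 else 0 := by
  rw [ket, lp.single_apply]
  by_cases h : n = k
  · subst h; simp
  · simp [h, Ne.symm h]

theorem norm_ket (n : Occ m) : ‖(ket n : Fock m)‖ = 1 := by
  rw [ket, lp.norm_single (by norm_num)]; simp

theorem hasSum_smul_ket (u : Fock m) : HasSum (fun n => u n • ket n) u := by
  have := lp.hasSum_single (by norm_num : (2 : ENNReal) ≠ ⊤) u
  refine this.congr_fun ?_
  intro n
  rw [ket, ← lp.single_smul]; simp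

theorem hasSum_norm_sq (u : Fock m) : HasSum (fun n => ‖u n‖ ^ 2) (‖u‖ ^ 2) := by
  have := lp.hasSum_norm (by norm_num : 0 < (2 : ENNReal).toReal) u
  simpa using this

@[simp] theorem incl_single (n : Occ m) (c : ℂ) : incl m (Finsupp.single n c) = c • ket n := by
  simp [incl]

theorem denseRange_incl : DenseRange (incl m) := by
  intro u
  refine mem_closure_of_tendsto (hasSum_smul_ket u) (Filter.Eventually.of_forall fun s => ?_)
  exact ⟨∑ n ∈ s, Finsupp.single n (u n), by simp⟩

/-- The Fock coefficients `∏ᵢ αᵢ^{nᵢ} / √(nᵢ!)` of the exponential vector of `α`. -/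
def expCoeff (α : Fin m → ℂ) (n : Occ m) : ℂ :=
  ∏ i, (α i ^ n i / (Real.sqrt (n i).factorial : ℂ))

theorem summable_norm_expCoeff (α : Fin m → ℂ) : Summable fun n => ‖expCoeff α n‖ := by
  have h := (hasSum_prod_pi (fun (i : Fin m) (k : ℕ) => α i ^ k / (Real.sqrt k.factorial : ℂ))
    fun i => summable_norm_pow_div_sqrt_factorial (α i)).1
  exact h

/-- The exponential vector (unnormalised coherent state) `∑ₙ ∏ᵢ αᵢ^{nᵢ} / √(nᵢ!) |n⟩`. -/
def expVec (α : Fin m → ℂ) : Fock m := ∑' n, expCoeff α n • ket n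

theorem hasSum_expVec (α : Fin m → ℂ) : HasSum (fun n => expCoeff α n • ket n) (expVec α) :=
  (Summable.of_norm (by simpa [norm_smul, norm_ket] using summable_norm_expCoeff α)).hasSum

theorem expVec_apply (α : Fin m → ℂ) (n : Occ m) : expVec α n = expCoeff α n := by
  rw [← inner_ket_left]
  have h := (hasSum_expVec α).mapL (innerSL ℂ (ket n))
  refine h.unique ?_
  have h2 : ∀ k, innerSL ℂ (ket n) (expCoeff α k • ket k) = if k = n then expCoeff α n else 0 := by
    intro k
    simp only [innerSL_apply_apply, inner_smul_right, inner_ket_left, ket_apply]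
    split_ifs with h <;> simp [h]
  simp only [h2]
  exact hasSum_ite_eq n _

theorem hasSum_inner_expVec (α : Fin m → ℂ) (u : Fock m) :
    HasSum (fun n => conj (expCoeff α n) * u n) ⟪expVec α, u⟫_ℂ := by
  have := lp.hasSum_inner (𝕜 := ℂ) (expVec α) u
  simpa [expVec_apply, mul_comm] using this

theorem inner_expVec_expVec (α β : Fin m → ℂ) :
    ⟪expVec α, expVec β⟫_ℂ = Complex.exp (∑ i, conj (α i) * β i) := by
  have h := hasSum_inner_expVec α (expVec β)
  have h1 : ∀ n : Occ m, conj (expCoeff α n) * expVec β n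
      = ∏ i, ((conj (α i) * β i) ^ n i / ((n i).factorial : ℂ)) := fun n => by
    rw [expVec_apply, expCoeff, expCoeff, map_prod, ← Finset.prod_mul_distrib]
    refine Finset.prod_congr rfl fun i _ => ?_
    have : ((Real.sqrt (n i).factorial : ℝ) : ℂ) * (Real.sqrt (n i).factorial : ℝ)
        = ((n i).factorial : ℂ) := by
      rw [← Complex.ofReal_mul, Real.mul_self_sqrt (by positivity), Complex.ofReal_natCast]
    rw [← this]
    simp only [map_div₀, map_pow, Complex.conj_ofReal]
    rw [mul_pow, div_mul_div_comm]
  simp only [h1] at h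
  have h2 : ∀ i : Fin m, HasSum (fun k : ℕ => (conj (α i) * β i) ^ k / (k.factorial : ℂ))
      (Complex.exp (conj (α i) * β i)) := fun i => by
    rw [Complex.exp_eq_exp_ℂ]; exact NormedSpace.expSeries_div_hasSum_exp _
  have h3 := (hasSum_prod_pi (fun (i : Fin m) (k : ℕ) =>
    (conj (α i) * β i) ^ k / (k.factorial : ℂ)) fun i =>
    NormedSpace.norm_expSeries_div_summable (conj (α i) * β i)).2
  rw [h.unique h3, Complex.exp_sum]
  exact Finset.prod_congr rfl fun i _ => (h2 i).tsum_eq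

theorem norm_expVec_sq (α : Fin m → ℂ) : ‖expVec α‖ ^ 2 = Real.exp (∑ i, ‖α i‖ ^ 2) := by
  have h := inner_self_eq_norm_sq (𝕜 := ℂ) (expVec α)
  rw [inner_expVec_expVec] at h
  have h2 : ∑ i, conj (α i) * α i = ((∑ i, ‖α i‖ ^ 2 : ℝ) : ℂ) := by
    push_cast
    exact Finset.sum_congr rfl fun i _ => by rw [Complex.conj_mul']
  rw [h2, ← Complex.ofReal_exp] at h
  exact h.symm

theorem continuous_expVec : Continuous (expVec (m := m)) := by
  rw [continuous_iff_continuousAt]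
  intro α
  rw [ContinuousAt, tendsto_iff_norm_sub_tendsto_zero]
  have h1 : ∀ β : Fin m → ℂ, ‖expVec β - expVec α‖ ^ 2 = Real.exp (∑ i, ‖β i‖ ^ 2)
      - 2 * (Complex.exp (∑ i, conj (β i) * α i)).re + Real.exp (∑ i, ‖α i‖ ^ 2) := fun β => by
    rw [@norm_sub_sq ℂ, norm_expVec_sq, norm_expVec_sq, inner_expVec_expVec]; rfl
  have h2 : Filter.Tendsto (fun β : Fin m → ℂ => ‖expVec β - expVec α‖ ^ 2) (nhds α)
      (nhds (‖expVec α - expVec α‖ ^ 2)) := by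
    simp only [h1]
    have hc : Continuous fun z : ℂ => conj z := Complex.continuous_conj
    have : Continuous fun β : Fin m → ℂ => Real.exp (∑ i, ‖β i‖ ^ 2)
      - 2 * (Complex.exp (∑ i, conj (β i) * α i)).re + Real.exp (∑ i, ‖α i‖ ^ 2) := by fun_prop
    exact this.tendsto α
  have h3 := h2.sqrt
  simpa [Real.sqrt_sq (norm_nonneg _)] using h3

theorem expVec_zero : expVec (0 : Fin m → ℂ) = vac m := by
  ext n
  rw [expVec_apply, vac, ket_apply, expCoeff]
  split_ifs with h
  · subst h; simp
  · obtain ⟨i, hi⟩ : ∃ i, n i ≠ 0 := by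
      by_contra! hc; exact h (funext fun i => (hc i).symm)
    exact Finset.prod_eq_zero (Finset.mem_univ i) (by simp [hi])

/-! ### Ladder operators on exponential vectors -/

theorem creation_single (i : Fin m) (n : Occ m) (c : ℂ) :
    creation i (Finsupp.single n c)
      = Finsupp.single (n + Pi.single i 1) (c * (Real.sqrt ((n i : ℝ) + 1) : ℂ)) := by
  simp [creation]

theorem annihilation_single (i : Fin m) (n : Occ m) (c : ℂ) :
    annihilation i (Finsupp.single n c)
      = Finsupp.single (n - Pi.single i 1) (c * (Real.sqrt (n i : ℝ) : ℂ)) := by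
  simp [annihilation]

theorem expCoeff_add_single (α : Fin m → ℂ) (i : Fin m) (n : Occ m) :
    expCoeff α (n + Pi.single i 1) * (Real.sqrt ((n i : ℝ) + 1) : ℂ) = α i * expCoeff α n := by
  rw [expCoeff, expCoeff, ← Finset.mul_prod_erase _ _ (Finset.mem_univ i),
    ← Finset.mul_prod_erase _ _ (Finset.mem_univ i)]
  have h1 : ∏ j ∈ Finset.univ.erase i, (α j ^ (n + Pi.single i 1 : Occ m) j
        / (Real.sqrt ((n + Pi.single i 1 : Occ m) j).factorial : ℂ))
      = ∏ j ∈ Finset.univ.erase i, (α j ^ n j / (Real.sqrt (n j).factorial : ℂ)) := by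
    refine Finset.prod_congr rfl fun j hj => ?_
    rw [Pi.add_apply, Pi.single_eq_of_ne (Finset.ne_of_mem_erase hj), add_zero]
  rw [h1, Pi.add_apply, Pi.single_eq_same, Nat.factorial_succ]
  push_cast
  rw [Real.sqrt_mul (by positivity)]
  have h2 : ((Real.sqrt ((n i : ℝ) + 1) : ℝ) : ℂ) ≠ 0 := by
    exact_mod_cast (Real.sqrt_pos.2 (by positivity)).ne'
  have h3 : ((Real.sqrt ((n i).factorial : ℝ) : ℝ) : ℂ) ≠ 0 := by
    exact_mod_cast (Real.sqrt_pos.2 (by positivity)).ne'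
  push_cast
  field_simp
  ring

/-- Doubling the argument of an exponential vector absorbs the factors `√nᵢ` and `√(nᵢ + 1)` of the
ladder operators. -/
theorem norm_mul_expCoeff_le (α : Fin m → ℂ) (i : Fin m) (n : Occ m) {x : ℝ}
    (hx : x ≤ (n i : ℝ) + 1) :
    ‖expCoeff α n * (Real.sqrt x : ℂ)‖ ≤ ‖expCoeff (fun j => 2 * α j) n‖ := by
  have h1 : expCoeff (fun j => 2 * α j) n = (∏ j, (2 : ℂ) ^ n j) * expCoeff α n := by
    rw [expCoeff, expCoeff, ← Finset.prod_mul_distrib]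
    exact Finset.prod_congr rfl fun j _ => by rw [mul_pow, mul_div_assoc]
  rw [h1, norm_mul, norm_mul, mul_comm, Complex.norm_real, Real.norm_of_nonneg (Real.sqrt_nonneg _)]
  refine mul_le_mul_of_nonneg_right ?_ (norm_nonneg _)
  rw [norm_prod]
  have h2 : (2 : ℝ) ^ n i ≤ ∏ j, ‖(2 : ℂ) ^ n j‖ := by
    have := Finset.single_le_prod' (f := fun j => (2 : NNReal) ^ n j) (s := Finset.univ)
      (fun j _ => one_le_pow₀ (by norm_num)) (Finset.mem_univ i)
    have h3 : ((2 ^ n i : NNReal) : ℝ) ≤ ((∏ j, 2 ^ n j : NNReal) : ℝ) := by exact_mod_cast this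
    simpa using h3
  refine le_trans ?_ h2
  have h4 : (n i : ℝ) + 1 ≤ 2 ^ n i := by exact_mod_cast Nat.lt_two_pow_self
  rw [Real.sqrt_le_left (by positivity)]
  have h5 : (1 : ℝ) ≤ 2 ^ n i := one_le_pow₀ (by norm_num)
  nlinarith

theorem summable_incl_creation (α : Fin m → ℂ) (i : Fin m) :
    Summable fun n => incl m (creation i (Finsupp.single n (expCoeff α n))) := by
  refine Summable.of_norm (Summable.of_nonneg_of_le (fun _ => norm_nonneg _) (fun n => ?_)
    (summable_norm_expCoeff fun j => 2 * α j))
  rw [creation_single, incl_single, norm_smul, norm_ket, mul_one]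
  exact norm_mul_expCoeff_le α i n le_rfl

/-- An exponential vector is an eigenvector of every annihilation operator. -/
theorem hasSum_incl_annihilation (α : Fin m → ℂ) (i : Fin m) :
    HasSum (fun n => incl m (annihilation i (Finsupp.single n (expCoeff α n))))
      (α i • expVec α) := by
  have hinj : Function.Injective fun n : Occ m => n + Pi.single i 1 := fun a b h => by simpa using h
  rw [← hinj.hasSum_iff]
  · have h := (hasSum_expVec α).const_smul (α i)
    refine h.congr_fun fun n => ?_
    simp only [Function.comp_apply]
    rw [annihilation_single, incl_single, add_tsub_cancel_right, smul_smul,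
      ← expCoeff_add_single]
    simp
  · intro n hn
    have h0 : n i = 0 := by
      by_contra hc
      refine hn ⟨n - Pi.single i 1, ?_⟩
      funext j
      by_cases hj : j = i
      · subst hj; simp; omega
      · simp [Pi.single_eq_of_ne hj]
    rw [annihilation_single, h0]
    simp

theorem inner_expVec_ket (α : Fin m → ℂ) (n : Occ m) :
    ⟪expVec α, ket n⟫_ℂ = conj (expCoeff α n) := by
  rw [inner_ket_right, expVec_apply]

theorem inner_expVec_incl_creation (α : Fin m → ℂ) (i : Fin m) (v : Fin0 m) :
    ⟪expVec α, incl m (creation i v)⟫_ℂ = conj (α i) * ⟪expVec α, incl m v⟫_ℂ := by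
  induction v using Finsupp.induction_linear with
  | zero => simp
  | add f g hf hg => simp only [map_add, inner_add_right, hf, hg, mul_add]
  | single n c =>
    rw [creation_single, incl_single, incl_single, inner_smul_right, inner_smul_right,
      inner_expVec_ket, inner_expVec_ket]
    have := congrArg conj (expCoeff_add_single α i n)
    simp only [map_mul, Complex.conj_ofReal] at this
    linear_combination c * this

theorem inner_expVec_incl_annihilation_single (α : Fin m → ℂ) (i : Fin m) (n : Occ m) (c : ℂ) :
    ⟪expVec α, incl m (annihilation i (Finsupp.single n c))⟫_ℂ
      = c * (Real.sqrt (n i : ℝ) : ℂ) * conj (expCoeff α (n - Pi.single i 1)) := by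
  rw [annihilation_single, incl_single, inner_smul_right, inner_expVec_ket]

/-! ### Heterodyne amplitudes -/

/-- The heterodyne amplitude `π^{-m/2} ⟨α|u⟩` of `u` at the coherent state `|α⟩`; its squared
modulus is the heterodyne outcome density of `u`. -/
def hetAmp (u : Fock m) (α : Fin m → ℂ) : ℂ :=
  ((Real.exp (-(∑ i, ‖α i‖ ^ 2) / 2) / Real.sqrt (Real.pi ^ m) : ℝ) : ℂ) * ⟪expVec α, u⟫_ℂ

theorem continuous_hetAmp (u : Fock m) : Continuous (hetAmp u) := by
  unfold hetAmp
  have h1 : Continuous fun α : Fin m → ℂ => ⟪expVec α, u⟫_ℂ :=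
    continuous_expVec.inner continuous_const
  have h2 : Continuous fun α : Fin m → ℂ =>
      Real.exp (-(∑ i, ‖α i‖ ^ 2) / 2) / Real.sqrt (Real.pi ^ m) := by fun_prop
  exact (Complex.continuous_ofReal.comp h2).mul h1

theorem hetAmp_ket_mul_conj (a b : Occ m) (α : Fin m → ℂ) :
    hetAmp (ket a) α * conj (hetAmp (ket b) α)
      = ∏ j, (((Real.pi * Real.sqrt ((a j).factorial * (b j).factorial) : ℝ) : ℂ)⁻¹
          * gaussMono 1 (b j) (a j) (α j)) := by
  have h1 : ∏ j, (((Real.pi * Real.sqrt ((a j).factorial * (b j).factorial) : ℝ) : ℂ)⁻¹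
          * gaussMono 1 (b j) (a j) (α j))
      = (∏ j : Fin m, ((Real.pi : ℝ) : ℂ)⁻¹) * (∏ j, (Real.exp (-1 * ‖α j‖ ^ 2) : ℂ))
        * ((∏ j, conj (α j ^ a j / (Real.sqrt (a j).factorial : ℂ)))
        * (∏ j, (α j ^ b j / (Real.sqrt (b j).factorial : ℂ)))) := by
    simp only [← Finset.prod_mul_distrib]
    refine Finset.prod_congr rfl fun j _ => ?_
    simp only [gaussMono, map_div₀, map_pow, Complex.conj_ofReal]
    rw [Real.sqrt_mul (by positivity)]
    push_cast
    field_simp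
  rw [h1, hetAmp, hetAmp, inner_expVec_ket, inner_expVec_ket]
  simp only [map_mul, Complex.conj_ofReal, Complex.conj_conj, expCoeff, map_prod]
  have h2 : ((Real.exp (-(∑ i, ‖α i‖ ^ 2) / 2) / Real.sqrt (Real.pi ^ m) : ℝ) : ℂ)
      * ((Real.exp (-(∑ i, ‖α i‖ ^ 2) / 2) / Real.sqrt (Real.pi ^ m) : ℝ) : ℂ)
      = (∏ j : Fin m, ((Real.pi : ℝ) : ℂ)⁻¹) * (∏ j, (Real.exp (-1 * ‖α j‖ ^ 2) : ℂ)) := by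
    rw [← Complex.ofReal_mul, div_mul_div_comm, ← Real.exp_add, Real.mul_self_sqrt (by positivity),
      ← Complex.ofReal_prod, ← Real.exp_sum, Finset.prod_const, Finset.card_univ, Fintype.card_fin,
      ← Complex.ofReal_inv, ← Complex.ofReal_pow, ← Complex.ofReal_mul]
    congr 1
    simp only [neg_mul, one_mul, Finset.sum_neg_distrib]
    rw [add_halves, inv_pow]
    ring
  rw [← h2]
  ring

/-- Fock-basis matrix elements of a heterodyne observable which is a product over the modes. -/
theorem integral_prod_mul_hetAmp_ket (G : Fin m → ℂ → ℂ) (a b : Occ m)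
    (hG : ∀ j, Integrable fun z => G j z * gaussMono 1 (b j) (a j) z) :
    Integrable (fun α : Fin m → ℂ =>
      (∏ j, G j (α j)) * (hetAmp (ket a) α * conj (hetAmp (ket b) α))) ∧
    ∫ α : Fin m → ℂ, (∏ j, G j (α j)) * (hetAmp (ket a) α * conj (hetAmp (ket b) α))
      = ∏ j, (((Real.pi * Real.sqrt ((a j).factorial * (b j).factorial) : ℝ) : ℂ)⁻¹
          * ∫ z, G j z * gaussMono 1 (b j) (a j) z) := by
  have h1 : ∀ α : Fin m → ℂ, (∏ j, G j (α j)) * (hetAmp (ket a) α * conj (hetAmp (ket b) α))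
      = ∏ j, (((Real.pi * Real.sqrt ((a j).factorial * (b j).factorial) : ℝ) : ℂ)⁻¹
          * (G j (α j) * gaussMono 1 (b j) (a j) (α j))) := fun α => by
    rw [hetAmp_ket_mul_conj, ← Finset.prod_mul_distrib]
    exact Finset.prod_congr rfl fun j _ => by ring
  simp only [h1]
  refine ⟨Integrable.fintype_prod (f := fun j z =>
    (((Real.pi * Real.sqrt ((a j).factorial * (b j).factorial) : ℝ) : ℂ)⁻¹
          * (G j z * gaussMono 1 (b j) (a j) z))) fun j => (hG j).const_mul _, ?_⟩
  rw [integral_fintype_prod_volume_eq_prod (fun j z =>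
    (((Real.pi * Real.sqrt ((a j).factorial * (b j).factorial) : ℝ) : ℂ)⁻¹
          * (G j z * gaussMono 1 (b j) (a j) z)))]
  simp only [integral_const_mul]

theorem inv_mul_integral_gaussMono (s t : ℕ) :
    ((Real.pi * Real.sqrt (s.factorial * t.factorial) : ℝ) : ℂ)⁻¹ * ∫ z, gaussMono 1 t s z
      = if s = t then 1 else 0 := by
  rw [integral_gaussMono one_pos]
  by_cases h : s = t
  · subst h
    have : ((Real.pi * s.factorial : ℝ) : ℂ) ≠ 0 := by
      exact_mod_cast (by positivity : Real.pi * s.factorial ≠ 0)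
    rw [if_pos rfl, if_pos rfl, Real.sqrt_mul_self (by positivity), one_pow, div_one,
      inv_mul_cancel₀ this]
  · rw [if_neg (Ne.symm h), if_neg h, mul_zero]

theorem integral_hetAmp_ket (a b : Occ m) :
    Integrable (fun α => hetAmp (ket a) α * conj (hetAmp (ket b) α)) ∧
    ∫ α, hetAmp (ket a) α * conj (hetAmp (ket b) α) = if a = b then 1 else 0 := by
  have h := integral_prod_mul_hetAmp_ket (fun _ _ => 1) a b fun j => by
    simpa using integrable_gaussMono one_pos _ _
  simp only [Finset.prod_const_one, one_mul, inv_mul_integral_gaussMono] at h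
  refine ⟨h.1, h.2.trans ?_⟩
  split_ifs with hab
  · subst hab; simp
  · obtain ⟨i, hi⟩ : ∃ i, a i ≠ b i := Function.ne_iff.1 hab
    exact Finset.prod_eq_zero (Finset.mem_univ i) (by simp [hi])

/-- Fock-basis matrix elements of an observable of the outcome of mode `i` alone. -/
theorem integral_mode_mul_hetAmp_ket (i : Fin m) (g : ℂ → ℂ) (a b : Occ m)
    (hg : Integrable fun z => g z * gaussMono 1 (b i) (a i) z) :
    Integrable (fun α => g (α i) * (hetAmp (ket a) α * conj (hetAmp (ket b) α))) ∧
    ∫ α, g (α i) * (hetAmp (ket a) α * conj (hetAmp (ket b) α))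
      = if b = Function.update a i (b i) then
          ((Real.pi * Real.sqrt ((a i).factorial * (b i).factorial) : ℝ) : ℂ)⁻¹
            * ∫ z, g z * gaussMono 1 (b i) (a i) z else 0 := by
  have hp : ∀ α : Fin m → ℂ, ∏ j, (if j = i then g else fun _ => 1) (α j) = g (α i) := fun α => by
    rw [Finset.prod_eq_single i] <;> simp +contextual
  have h := integral_prod_mul_hetAmp_ket (fun j => if j = i then g else fun _ => 1) a b fun j => by
    by_cases hj : j = i
    · subst hj; simpa using hg
    · simpa [hj] using integrable_gaussMono one_pos _ _
  simp only [hp] at h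
  refine ⟨h.1, h.2.trans ?_⟩
  split_ifs with hab
  · rw [Finset.prod_eq_single i]
    · simp
    · intro j _ hj
      have hj' : b j = a j := by rw [hab, Function.update_of_ne hj]
      simp only [if_neg hj, one_mul, inv_mul_integral_gaussMono]
      rw [if_pos hj'.symm]
    · simp
  · obtain ⟨j, hj⟩ : ∃ j, b j ≠ Function.update a i (b i) j := Function.ne_iff.1 hab
    have hji : j ≠ i := by rintro rfl; simp at hj
    rw [Function.update_of_ne hji] at hj
    refine Finset.prod_eq_zero (Finset.mem_univ j) ?_
    simp only [if_neg hji, one_mul, inv_mul_integral_gaussMono]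
    rw [if_neg (Ne.symm hj)]

theorem memLp_hetAmp_ket (a : Occ m) : MemLp (hetAmp (ket a)) 2 := by
  rw [memLp_two_iff_integrable_sq_norm (continuous_hetAmp _).aestronglyMeasurable]
  have h := (integral_hetAmp_ket a a).1.norm
  simpa [norm_mul, sq] using h

theorem orthonormal_hetAmp_ket :
    Orthonormal ℂ fun a : Occ m => (memLp_hetAmp_ket a).toLp := by
  rw [orthonormal_iff_ite]
  intro a b
  rw [L2.inner_def]
  have h1 : ∀ᵐ α : Fin m → ℂ, ⟪((memLp_hetAmp_ket a).toLp :
      Lp ℂ 2 (volume : Measure (Fin m → ℂ))) α, ((memLp_hetAmp_ket b).toLp :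
      Lp ℂ 2 (volume : Measure (Fin m → ℂ))) α⟫_ℂ
      = hetAmp (ket b) α * conj (hetAmp (ket a) α) := by
    filter_upwards [(memLp_hetAmp_ket a).coeFn_toLp, (memLp_hetAmp_ket b).coeFn_toLp] with α h1 h2
    rw [h1, h2, RCLike.inner_apply]
  rw [integral_congr_ae h1, (integral_hetAmp_ket b a).2]
  simp only [eq_comm]

theorem hasSum_hetAmp (u : Fock m) (α : Fin m → ℂ) :
    HasSum (fun n => u n * hetAmp (ket n) α) (hetAmp u α) := by
  have h := ((hasSum_smul_ket u).mapL (innerSL ℂ (expVec α))).mul_left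
    ((Real.exp (-(∑ i, ‖α i‖ ^ 2) / 2) / Real.sqrt (Real.pi ^ m) : ℝ) : ℂ)
  simp only [innerSL_apply_apply, inner_smul_right] at h
  refine h.congr_fun fun n => ?_
  rw [hetAmp]; ring

/-- The isometry of Fock space into `L²(ℂ^m)` extending `|a⟩ ↦ π^{-m/2} ⟨α|a⟩`. -/
def hetIsometry (m : ℕ) : Fock m →ₗᵢ[ℂ] Lp ℂ 2 (volume : Measure (Fin m → ℂ)) :=
  (orthonormal_hetAmp_ket (m := m)).orthogonalFamily.linearIsometry

theorem hetIsometry_ae_eq (u : Fock m) : hetIsometry m u =ᵐ[volume] hetAmp u := by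
  have h1 := (orthonormal_hetAmp_ket (m := m)).orthogonalFamily.hasSum_linearIsometry u
  have h2 : Filter.Tendsto (fun s : Finset (Occ m) => ∑ n ∈ s, u n • (memLp_hetAmp_ket n).toLp)
      Filter.atTop (nhds (hetIsometry m u)) := h1
  obtain ⟨ns, hns, h3⟩ := (tendstoInMeasure_of_tendsto_Lp h2).exists_seq_tendsto_ae'
  have h4 : ∀ᵐ α : Fin m → ℂ, ∀ k, (∑ n ∈ ns k, u n • (memLp_hetAmp_ket n).toLp :
      Lp ℂ 2 (volume : Measure (Fin m → ℂ))) α = ∑ n ∈ ns k, u n * hetAmp (ket n) α := by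
    rw [ae_all_iff]
    intro k
    have h5 : ∀ᵐ α : Fin m → ℂ, ∀ n : Occ m,
        (u n • (memLp_hetAmp_ket n).toLp : Lp ℂ 2 (volume : Measure (Fin m → ℂ))) α
          = u n * hetAmp (ket n) α := by
      rw [ae_all_iff]
      intro n
      filter_upwards [Lp.coeFn_smul (u n) (memLp_hetAmp_ket n).toLp,
        (memLp_hetAmp_ket n).coeFn_toLp] with α h6 h7
      rw [h6, Pi.smul_apply, h7, smul_eq_mul]
    have h8 := Lp.coeFn_finsetSum (ns k)
      fun n => (u n • (memLp_hetAmp_ket n).toLp : Lp ℂ 2 (volume : Measure (Fin m → ℂ)))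
    filter_upwards [h5, h8] with α h6 h7
    rw [h7, Finset.sum_apply]
    exact Finset.sum_congr rfl fun n _ => h6 n
  filter_upwards [h3, h4] with α h5 h6
  refine tendsto_nhds_unique h5 ?_
  simp only [h6]
  exact (hasSum_hetAmp u α).comp hns

theorem memLp_hetAmp (u : Fock m) : MemLp (hetAmp u) 2 :=
  (memLp_congr_ae (hetIsometry_ae_eq u)).1 (Lp.memLp _)

/-- Resolution of the identity by coherent states. -/
theorem integral_norm_hetAmp_sq (u : Fock m) : ∫ α, ‖hetAmp u α‖ ^ 2 = ‖u‖ ^ 2 := by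
  have h := L2.inner_def (𝕜 := ℂ) (hetIsometry m u) (hetIsometry m u)
  rw [(hetIsometry m).inner_map_map] at h
  have h1 : ∀ᵐ α : Fin m → ℂ, ⟪hetIsometry m u α, hetIsometry m u α⟫_ℂ
      = ((‖hetAmp u α‖ ^ 2 : ℝ) : ℂ) := by
    filter_upwards [hetIsometry_ae_eq u] with α h1
    rw [h1, inner_self_eq_norm_sq_to_K]; push_cast; rfl
  rw [integral_congr_ae h1, integral_complex_ofReal] at h
  have h2 := congrArg Complex.re h
  rw [Complex.ofReal_re] at h2
  rw [← h2]
  exact inner_self_eq_norm_sq (𝕜 := ℂ) u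

theorem integrable_norm_hetAmp_sq (u : Fock m) : Integrable fun α => ‖hetAmp u α‖ ^ 2 :=
  (memLp_two_iff_integrable_sq_norm (continuous_hetAmp u).aestronglyMeasurable).1 (memLp_hetAmp u)

/-- The exponential vectors are total in Fock space. -/
theorem eq_zero_of_inner_expVec_eq_zero {u : Fock m} (h : ∀ α, ⟪expVec α, u⟫_ℂ = 0) : u = 0 := by
  have h1 := integral_norm_hetAmp_sq u
  simp only [hetAmp, h, mul_zero, norm_zero] at h1
  simpa using h1.symm

theorem eq_of_inner_expVec_eq {u v : Fock m} (h : ∀ α, ⟪expVec α, u⟫_ℂ = ⟪expVec α, v⟫_ℂ) :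
    u = v := by
  rw [← sub_eq_zero]
  exact eq_zero_of_inner_expVec_eq_zero fun α => by rw [inner_sub_right, h, sub_self]

/-- The expectation of a bounded function of the heterodyne outcome is continuous in the state. -/
theorem continuous_integral_mul_norm_hetAmp_sq {g : (Fin m → ℂ) → ℂ} (hg : Continuous g) {C : ℝ}
    (hC : ∀ α, ‖g α‖ ≤ C) :
    Continuous fun u : Fock m => ∫ α, g α * (hetAmp u α * conj (hetAmp u α)) := by
  have hgL : MemLp g ⊤ (volume : Measure (Fin m → ℂ)) :=
    memLp_top_of_bound hg.aestronglyMeasurable C (Filter.Eventually.of_forall hC)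
  set T := (ContinuousLinearMap.mul ℂ ℂ).holderL (volume : Measure (Fin m → ℂ)) ⊤ 2 2 hgL.toLp
    with hT
  have h1 : ∀ u : Fock m, ∫ α, g α * (hetAmp u α * conj (hetAmp u α))
      = ⟪hetIsometry m u, T (hetIsometry m u)⟫_ℂ := fun u => by
    rw [L2.inner_def]
    refine integral_congr_ae ?_
    filter_upwards [hetIsometry_ae_eq u, hgL.coeFn_toLp,
      (ContinuousLinearMap.mul ℂ ℂ).coeFn_holder (r := 2) hgL.toLp (hetIsometry m u)]
      with α h2 h3 h4
    have h5 : T (hetIsometry m u) α = g α * hetAmp u α := by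
      rw [← h2, ← h3]; exact h4
    rw [h5, h2, RCLike.inner_apply]
    ring
  simp only [h1]
  have h2 := (hetIsometry m).continuous
  exact h2.inner (T.continuous.comp h2)

/-! ### Displacement operators -/

theorem denseRange_linearCombination_of_total {ι : Type*} (v : ι → Fock m)
    (hv : ∀ u : Fock m, (∀ a, ⟪v a, u⟫_ℂ = 0) → u = 0) :
    DenseRange (Finsupp.linearCombination ℂ v) := by
  have h1 : (Submodule.span ℂ (Set.range v))ᗮ = ⊥ := by
    rw [Submodule.eq_bot_iff]
    intro u hu
    refine hv u fun a => ?_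
    exact (Submodule.mem_orthogonal _ u).1 hu _ (Submodule.subset_span ⟨a, rfl⟩)
  rw [← Submodule.topologicalClosure_eq_top_iff] at h1
  have h2 : Set.range (Finsupp.linearCombination ℂ v)
      = (Submodule.span ℂ (Set.range v) : Set _) := by
    rw [← Finsupp.range_linearCombination]; rfl
  rw [DenseRange, h2]
  exact Submodule.dense_iff_topologicalClosure_eq_top.2 h1

theorem norm_linearCombination_eq {ι : Type*} (v w : ι → Fock m)
    (h : ∀ a b, ⟪v a, v b⟫_ℂ = ⟪w a, w b⟫_ℂ) (x : ι →₀ ℂ) :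
    ‖Finsupp.linearCombination ℂ v x‖ = ‖Finsupp.linearCombination ℂ w x‖ := by
  have key : ∀ x y : ι →₀ ℂ,
      ⟪Finsupp.linearCombination ℂ v x, Finsupp.linearCombination ℂ v y⟫_ℂ
        = ⟪Finsupp.linearCombination ℂ w x, Finsupp.linearCombination ℂ w y⟫_ℂ := by
    intro x y
    induction x using Finsupp.induction_linear with
    | zero => simp
    | add f g hf hg => simp only [map_add, inner_add_left, hf, hg]
    | single a c =>
      induction y using Finsupp.induction_linear with
      | zero => simp
      | add f g hf hg => simp only [map_add, inner_add_right, hf, hg]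
      | single b d => simp [h]
  have h1 := congrArg Complex.re (key x x)
  have h2 := inner_self_eq_norm_sq (𝕜 := ℂ) (Finsupp.linearCombination ℂ v x)
  have h3 := inner_self_eq_norm_sq (𝕜 := ℂ) (Finsupp.linearCombination ℂ w x)
  have h4 : ‖Finsupp.linearCombination ℂ v x‖ ^ 2 = ‖Finsupp.linearCombination ℂ w x‖ ^ 2 := by
    rw [← h2, ← h3]; exact h1
  exact (sq_eq_sq₀ (norm_nonneg _) (norm_nonneg _)).1 h4

/-- Two total families with the same Gram matrix are related by a unitary operator. -/
theorem exists_unitary_of_gram_eq {ι : Type*} (v w : ι → Fock m)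
    (h : ∀ a b, ⟪v a, v b⟫_ℂ = ⟪w a, w b⟫_ℂ)
    (hv : ∀ u : Fock m, (∀ a, ⟪v a, u⟫_ℂ = 0) → u = 0)
    (hw : ∀ u : Fock m, (∀ a, ⟪w a, u⟫_ℂ = 0) → u = 0) :
    ∃ V : Fock m ≃ₗᵢ[ℂ] Fock m, ∀ a, V (v a) = w a := by
  have hn := norm_linearCombination_eq v w h
  refine ⟨(LinearEquiv.refl ℂ (ι →₀ ℂ)).extendOfIsometry (Finsupp.linearCombination ℂ v)
    (Finsupp.linearCombination ℂ w) (denseRange_linearCombination_of_total v hv)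
    (denseRange_linearCombination_of_total w hw) fun x => (hn x).symm, fun a => ?_⟩
  have := LinearEquiv.extendOfIsometry_eq (LinearEquiv.refl ℂ (ι →₀ ℂ))
    (Finsupp.linearCombination ℂ v) (Finsupp.linearCombination ℂ w)
    (denseRange_linearCombination_of_total v hv) (denseRange_linearCombination_of_total w hw)
    (fun x => (hn x).symm) (Finsupp.single a 1)
  simpa using this

/-- The image `e^{-|β|²/2 - β*·α} e(α + β)` of the exponential vector `e(α)` under the displacement
by `β`. -/
def dispVec (β α : Fin m → ℂ) : Fock m :=
  Complex.exp (-(∑ i, conj (β i) * β i) / 2 - ∑ i, conj (β i) * α i) • expVec (α + β)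

theorem inner_dispVec_left (β α : Fin m → ℂ) (u : Fock m) :
    ⟪dispVec β α, u⟫_ℂ = Complex.exp (-(∑ i, conj (β i) * β i) / 2 - ∑ i, β i * conj (α i))
      * ⟪expVec (α + β), u⟫_ℂ := by
  rw [dispVec, inner_smul_left, ← Complex.exp_conj]
  congr 2
  simp only [map_sub, map_neg, map_div₀, map_sum, map_mul, Complex.conj_conj, map_ofNat]
  congr 3
  exact Finset.sum_congr rfl fun i _ => mul_comm _ _

theorem inner_dispVec_dispVec (β α α' : Fin m → ℂ) :
    ⟪dispVec β α, dispVec β α'⟫_ℂ = ⟪expVec α, expVec α'⟫_ℂ := by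
  rw [inner_dispVec_left, dispVec, inner_smul_right, inner_expVec_expVec, inner_expVec_expVec,
    ← Complex.exp_add, ← Complex.exp_add]
  congr 1
  have h1 : ∑ i, conj ((α + β) i) * (α' + β) i = ∑ i, conj (α i) * α' i
      + ∑ i, β i * conj (α i) + ∑ i, conj (β i) * α' i + ∑ i, conj (β i) * β i := by
    simp only [← Finset.sum_add_distrib]
    refine Finset.sum_congr rfl fun i _ => ?_
    simp only [Pi.add_apply, map_add]; ring
  rw [h1]; ring

theorem eq_zero_of_inner_dispVec_eq_zero (β : Fin m → ℂ) (u : Fock m)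
    (h : ∀ α, ⟪dispVec β α, u⟫_ℂ = 0) : u = 0 := by
  refine eq_zero_of_inner_expVec_eq_zero fun α => ?_
  have := h (α - β)
  rw [inner_dispVec_left, sub_add_cancel] at this
  exact (mul_eq_zero.1 this).resolve_left (Complex.exp_ne_zero _)

/-- The Weyl unitary of displacement `β`, determined by its action on exponential vectors. -/
def weyl (β : Fin m → ℂ) : Fock m ≃ₗᵢ[ℂ] Fock m :=
  (exists_unitary_of_gram_eq expVec (dispVec β) (fun a b => (inner_dispVec_dispVec β a b).symm)
    (fun _ => eq_zero_of_inner_expVec_eq_zero) (eq_zero_of_inner_dispVec_eq_zero β)).choose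

theorem weyl_expVec (β α : Fin m → ℂ) : weyl β (expVec α) = dispVec β α :=
  (exists_unitary_of_gram_eq expVec (dispVec β) (fun a b => (inner_dispVec_dispVec β a b).symm)
    (fun _ => eq_zero_of_inner_expVec_eq_zero) (eq_zero_of_inner_dispVec_eq_zero β)).choose_spec α

theorem denseRange_linearCombination_expVec :
    DenseRange (Finsupp.linearCombination ℂ (expVec (m := m))) :=
  denseRange_linearCombination_of_total _ fun _ => eq_zero_of_inner_expVec_eq_zero

theorem eq_of_apply_expVec_eq {V W : Fock m ≃ₗᵢ[ℂ] Fock m}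
    (h : ∀ α, V (expVec α) = W (expVec α)) : V = W := by
  have h1 : (V : Fock m → Fock m) = W :=
    denseRange_linearCombination_expVec.equalizer V.continuous W.continuous <| by
      funext x
      simp only [Function.comp_apply, Finsupp.linearCombination_apply, Finsupp.sum, map_sum,
        map_smul, h]
  exact LinearIsometryEquiv.ext fun x => congrFun h1 x

theorem weyl_add_smul (β : Fin m → ℂ) (s t : ℝ) :
    weyl (fun i => ((s + t : ℝ) : ℂ) * β i)
      = weyl (fun i => (s : ℂ) * β i) * weyl (fun i => (t : ℂ) * β i) := by
  refine eq_of_apply_expVec_eq fun α => ?_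
  rw [LinearIsometryEquiv.coe_mul, Function.comp_apply, weyl_expVec, weyl_expVec]
  conv_rhs => rw [dispVec, map_smul, weyl_expVec, dispVec, smul_smul, ← Complex.exp_add]
  rw [dispVec]
  congr 1
  · congr 1
    have h1 : ∀ r : ℝ, ∀ γ : Fin m → ℂ, ∑ i, conj ((r : ℂ) * β i) * γ i
        = r * ∑ i, conj (β i) * γ i := fun r γ => by
      rw [Finset.mul_sum]
      refine Finset.sum_congr rfl fun i _ => ?_
      rw [map_mul, Complex.conj_ofReal, mul_assoc]
    have h2 : ∀ r : ℝ, ∑ i, conj (β i) * ((r : ℂ) * β i) = r * ∑ i, conj (β i) * β i := fun r => by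
      rw [Finset.mul_sum]
      exact Finset.sum_congr rfl fun i _ => by ring
    simp only [h1, h2, Pi.add_apply, mul_add, Finset.sum_add_distrib]
    push_cast
    ring
  · congr 1
    funext i
    simp only [Pi.add_apply]
    push_cast; ring

theorem continuous_weyl_smul (β : Fin m → ℂ) (x : Fock m) :
    Continuous fun t : ℝ => weyl (fun i => (t : ℂ) * β i) x := by
  induction x using DenseRange.induction_on denseRange_linearCombination_expVec with
  | hp =>
    refine isClosed_of_closure_subset fun x hx => ?_
    refine continuous_of_uniform_approx_of_continuous fun U hU => ?_
    obtain ⟨ε, hε, hU⟩ := Metric.mem_uniformity_dist.1 hU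
    obtain ⟨y, hy, hxy⟩ := Metric.mem_closure_iff.1 hx ε hε
    exact ⟨_, hy, fun t => hU (by rw [LinearIsometryEquiv.dist_map]; exact hxy)⟩
  | ih a =>
    simp only [Finsupp.linearCombination_apply, Finsupp.sum, map_sum, map_smul, weyl_expVec,
      dispVec]
    refine continuous_finsetSum _ fun α _ => ?_
    have hc : Continuous fun z : ℂ => conj z := Complex.continuous_conj
    have h1 : Continuous fun t : ℝ => expVec (α + fun i => (t : ℂ) * β i) :=
      continuous_expVec.comp (by fun_prop)
    have h2 : Continuous fun t : ℝ =>
        Complex.exp (-(∑ i, conj ((t : ℂ) * β i) * ((t : ℂ) * β i)) / 2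
        - ∑ i, conj ((t : ℂ) * β i) * α i) := by fun_prop
    exact (h2.smul h1).const_smul (a α)

theorem weyl_zero_smul (β : Fin m → ℂ) : weyl (fun i => ((0 : ℝ) : ℂ) * β i) = 1 := by
  have h := weyl_add_smul β 0 0
  rw [add_zero] at h
  exact left_eq_mul.1 h

theorem inner_expVec_weyl (β α : Fin m → ℂ) (t : ℝ) (u : Fock m) :
    ⟪expVec α, weyl (fun i => (t : ℂ) * β i) u⟫_ℂ
      = Complex.exp (-(t ^ 2 * ∑ i, conj (β i) * β i) / 2 + t * ∑ i, β i * conj (α i))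
        * ⟪expVec (fun i => α i + t * -β i), u⟫_ℂ := by
  have h := weyl_add_smul β t (-t)
  rw [add_neg_cancel, weyl_zero_smul] at h
  have h1 : expVec α = weyl (fun i => (t : ℂ) * β i)
      (weyl (fun i => ((-t : ℝ) : ℂ) * β i) (expVec α)) := by
    rw [← Function.comp_apply (f := weyl (fun i => (t : ℂ) * β i)), ← LinearIsometryEquiv.coe_mul,
      ← h, LinearIsometryEquiv.coe_one, id]
  rw [h1, LinearIsometryEquiv.inner_map_map, weyl_expVec, inner_dispVec_left]
  congr 1
  · congr 1
    have e1 : ∑ i, conj (((-t : ℝ) : ℂ) * β i) * (((-t : ℝ) : ℂ) * β i)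
        = t ^ 2 * ∑ i, conj (β i) * β i := by
      rw [Finset.mul_sum]
      refine Finset.sum_congr rfl fun i _ => ?_
      rw [map_mul, Complex.conj_ofReal]; push_cast; ring
    have e2 : ∑ i, ((-t : ℝ) : ℂ) * β i * conj (α i) = -(t * ∑ i, β i * conj (α i)) := by
      rw [Finset.mul_sum, ← Finset.sum_neg_distrib]
      exact Finset.sum_congr rfl fun i _ => by push_cast; ring
    rw [e1, e2, sub_neg_eq_add]
  · congr 2
    funext i
    simp only [Pi.add_apply]; push_cast; ring

theorem hasDerivAt_expCoeff (a b : Fin m → ℂ) (n : Occ m) (t : ℝ) :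
    HasDerivAt (fun t : ℝ => expCoeff (fun i => a i + t * b i) n)
      (∑ i, b i * ((Real.sqrt (n i : ℝ) : ℂ)
        * expCoeff (fun i => a i + t * b i) (n - Pi.single i 1))) t := by
  have h0 : ∀ i, HasDerivAt (fun t : ℝ => a i + t * b i) (b i) t := fun i => by
    have := ((hasDerivAt_id t).ofReal_comp.mul_const (b i)).const_add (a i)
    simpa using this
  have h1 : ∀ i ∈ Finset.univ, HasDerivAt
      (fun t : ℝ => (a i + t * b i) ^ n i / (Real.sqrt (n i).factorial : ℂ))
      ((n i : ℂ) * (a i + t * b i) ^ (n i - 1) * b i / (Real.sqrt (n i).factorial : ℂ)) t :=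
    fun i _ => ((h0 i).pow (n i)).div_const _
  have h2 := HasDerivAt.fun_finsetProd h1
  refine h2.congr_deriv ?_
  refine Finset.sum_congr rfl fun i _ => ?_
  rw [smul_eq_mul, expCoeff, ← Finset.mul_prod_erase _ _ (Finset.mem_univ i)]
  have h3 : ∏ j ∈ Finset.univ.erase i, ((a j + t * b j) ^ (n - Pi.single i 1 : Occ m) j
        / (Real.sqrt ((n - Pi.single i 1 : Occ m) j).factorial : ℂ))
      = ∏ j ∈ Finset.univ.erase i, ((a j + t * b j) ^ n j / (Real.sqrt (n j).factorial : ℂ)) := by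
    refine Finset.prod_congr rfl fun j hj => ?_
    rw [Pi.sub_apply, Pi.single_eq_of_ne (Finset.ne_of_mem_erase hj), Nat.sub_zero]
  rw [h3, Pi.sub_apply, Pi.single_eq_same]
  rcases Nat.eq_zero_or_pos (n i) with hn | hn
  · simp [hn]
  obtain ⟨k, hk⟩ : ∃ k, n i = k + 1 := ⟨n i - 1, by omega⟩
  rw [hk, Nat.factorial_succ, Nat.add_sub_cancel]
  have hk0 : ((Real.sqrt ((k : ℝ) + 1) : ℝ) : ℂ) ≠ 0 := by
    exact_mod_cast (Real.sqrt_pos.2 (by positivity)).ne'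
  have hk1 : ((Real.sqrt (k.factorial : ℝ) : ℝ) : ℂ) ≠ 0 := by
    exact_mod_cast (Real.sqrt_pos.2 (by positivity)).ne'
  have hk2 : ((Real.sqrt ((k : ℝ) + 1) : ℝ) : ℂ) ^ 2 = (k : ℂ) + 1 := by
    rw [← Complex.ofReal_pow, Real.sq_sqrt (by positivity)]; push_cast; ring
  push_cast
  rw [Real.sqrt_mul (by positivity)]
  push_cast
  rw [← hk2]
  field_simp

/-- The generator `∑ᵢ (βᵢ aᵢ† - βᵢ* aᵢ)` of the displacements along `β`. -/
abbrev dispGen (β : Fin m → ℂ) : Fin0 m →ₗ[ℂ] Fin0 m :=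
  ∑ i, (β i • creation i - conj (β i) • annihilation i)

theorem conj_expCoeff (α : Fin m → ℂ) (n : Occ m) :
    conj (expCoeff α n) = expCoeff (fun i => conj (α i)) n := by
  simp [expCoeff, map_prod, map_div₀, Complex.conj_ofReal]

theorem hasDerivAt_inner_expVec_weyl (β α : Fin m → ℂ) (v : Fin0 m) (t : ℝ) :
    HasDerivAt (fun t : ℝ => ⟪expVec α, weyl (fun i => (t : ℂ) * β i) (incl m v)⟫_ℂ)
      ⟪expVec α, weyl (fun i => (t : ℂ) * β i) (incl m (dispGen β v))⟫_ℂ t := by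
  induction v using Finsupp.induction_linear with
  | zero => simpa using hasDerivAt_const t (0 : ℂ)
  | add f g hf hg => simpa only [map_add, inner_add_right] using hf.fun_add hg
  | single n c =>
    simp only [inner_expVec_weyl]
    have h1 : HasDerivAt (fun t : ℝ => Complex.exp (-((t : ℂ) ^ 2 * ∑ i, conj (β i) * β i) / 2
          + t * ∑ i, β i * conj (α i)))
        (Complex.exp (-((t : ℂ) ^ 2 * ∑ i, conj (β i) * β i) / 2 + t * ∑ i, β i * conj (α i))
          * (-(t * ∑ i, conj (β i) * β i) + ∑ i, β i * conj (α i))) t := by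
      have hid : HasDerivAt (fun t : ℝ => (t : ℂ)) 1 t := (hasDerivAt_id t).ofReal_comp
      refine HasDerivAt.cexp ?_
      have := (((hid.pow 2).mul_const (∑ i, conj (β i) * β i)).neg.div_const 2).add
        (hid.mul_const (∑ i, β i * conj (α i)))
      refine this.congr_deriv ?_
      simp; ring
    have h2 := hasDerivAt_expCoeff (fun i => conj (α i)) (fun i => -conj (β i)) n t
    have h3 := (h1.mul h2).const_mul c
    have e1 : ∀ t : ℝ, (fun i => conj (α i + t * -β i)) = fun i => conj (α i) + t * -conj (β i) :=
      fun t => by funext i; simp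
    refine (h3.congr_deriv ?_).congr_of_eventuallyEq (Filter.Eventually.of_forall fun s => ?_)
    · simp only [LinearMap.sum_apply, LinearMap.sub_apply, LinearMap.smul_apply, map_sum, map_sub,
        map_smul, inner_sum, inner_sub_right, inner_smul_right, inner_expVec_incl_creation,
        inner_expVec_incl_annihilation_single, incl_single, inner_expVec_ket, conj_expCoeff, e1]
      rw [Finset.sum_sub_distrib]
      have e2 : ∑ i, β i * (conj (α i + t * -β i)
            * (c * expCoeff (fun i => conj (α i) + t * -conj (β i)) n))
          = (-(t * ∑ i, conj (β i) * β i) + ∑ i, β i * conj (α i))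
            * (c * expCoeff (fun i => conj (α i) + t * -conj (β i)) n) := by
        rw [Finset.mul_sum, ← Finset.sum_neg_distrib, ← Finset.sum_add_distrib, Finset.sum_mul]
        refine Finset.sum_congr rfl fun i _ => ?_
        simp only [map_add, map_mul, map_neg, Complex.conj_ofReal]
        ring
      have e3 : ∑ i, conj (β i) * (c * (Real.sqrt (n i : ℝ) : ℂ)
            * expCoeff (fun i => conj (α i) + t * -conj (β i)) (n - Pi.single i 1))
          = -(c * ∑ i, -conj (β i) * ((Real.sqrt (n i : ℝ) : ℂ)
            * expCoeff (fun i => conj (α i) + t * -conj (β i)) (n - Pi.single i 1))) := by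
        rw [Finset.mul_sum, ← Finset.sum_neg_distrib]
        exact Finset.sum_congr rfl fun i _ => by ring
      rw [e2, e3]
      ring
    · simp only [incl_single, inner_smul_right, inner_expVec_ket, conj_expCoeff, e1, Pi.mul_apply]
      ring

theorem hasDerivAt_weyl_incl (β : Fin m → ℂ) (v : Fin0 m) :
    HasDerivAt (fun t : ℝ => weyl (fun i => (t : ℂ) * β i) (incl m v))
      (incl m (dispGen β v)) 0 := by
  set V : ℝ → (Fock m ≃ₗᵢ[ℂ] Fock m) := fun t => weyl (fun i => (t : ℂ) * β i) with hV
  have hc : Continuous fun s => V s (incl m (dispGen β v)) := continuous_weyl_smul β _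
  have h1 : ∀ t : ℝ, V t (incl m v) = incl m v + ∫ s in (0 : ℝ)..t, V s (incl m (dispGen β v)) := by
    intro t
    refine eq_of_inner_expVec_eq fun α => ?_
    rw [inner_add_right]
    have h2 := (innerSL ℂ (expVec α)).intervalIntegral_comp_comm
      (hc.intervalIntegrable (μ := volume) 0 t)
    have h3 := intervalIntegral.integral_eq_sub_of_hasDerivAt
      (fun s _ => hasDerivAt_inner_expVec_weyl β α v s)
      ((continuous_const.inner hc).intervalIntegrable (μ := volume) 0 t)
    simp only [innerSL_apply_apply] at h2
    rw [← h2, h3, weyl_zero_smul]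
    simp [hV]
  have h4 : HasDerivAt (fun t => incl m v + ∫ s in (0 : ℝ)..t, V s (incl m (dispGen β v)))
      (V 0 (incl m (dispGen β v))) 0 :=
    (hc.integral_hasStrictDerivAt 0 0).hasDerivAt.const_add _
  have h5 : V 0 = 1 := weyl_zero_smul β
  rw [h5] at h4
  exact h4.congr_of_eventuallyEq (Filter.Eventually.of_forall h1)

/-- The displacement generators exponentiate, to the Weyl unitaries. -/
theorem isExp_weyl (β : Fin m → ℂ) : IsExp (dispGen β) (weyl β) :=
  ⟨fun t => weyl (fun i => (t : ℂ) * β i), weyl_add_smul β, continuous_weyl_smul β,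
    hasDerivAt_weyl_incl β, by simp⟩

/-! ### Uniqueness of the displacement operators -/

section UnitaryGroup

variable {V : ℝ → (Fock m ≃ₗᵢ[ℂ] Fock m)}

theorem group_zero (hV : ∀ s t : ℝ, V (s + t) = V s * V t) : V 0 = 1 := by
  have h := hV 0 0
  rw [add_zero] at h
  exact left_eq_mul.1 h

theorem hasDerivAt_group (hV : ∀ s t : ℝ, V (s + t) = V s * V t) {x y : Fock m}
    (h : HasDerivAt (fun t => V t x) y 0) (t : ℝ) : HasDerivAt (fun t => V t x) (V t y) t := by
  have h1 : HasDerivAt (fun s => V (s - t) x) y t := by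
    have h0 : HasDerivAt (fun t => V t x) y (t - t) := by rwa [sub_self]
    exact h0.comp_sub_const t t
  have h2 := ((V t).toContinuousLinearEquiv.toContinuousLinearMap.restrictScalars ℝ).hasFDerivAt
    |>.comp_hasDerivAt t h1
  refine h2.congr_of_eventuallyEq (Filter.Eventually.of_forall fun s => ?_)
  have h3 : V s = V t * V (s - t) := by rw [← hV]; congr 1; ring
  change V s x = V t (V (s - t) x)
  rw [h3]; rfl

theorem hasDerivAt_group_apply (hV : ∀ s t : ℝ, V (s + t) = V s * V t) {x y : Fock m}
    (h : HasDerivAt (fun t => V t x) y 0) (t : ℝ) :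
    HasDerivAt (fun s => V s (V t x)) (V t y) 0 := by
  have h2 := ((V t).toContinuousLinearEquiv.toContinuousLinearMap.restrictScalars ℝ).hasFDerivAt
    |>.comp_hasDerivAt 0 h
  refine h2.congr_of_eventuallyEq (Filter.Eventually.of_forall fun s => ?_)
  have h3 : V s * V t = V t * V s := by rw [← hV, ← hV, add_comm]
  exact congrArg (fun W : Fock m ≃ₗᵢ[ℂ] Fock m => W x) h3

/-- The generator of a unitary group is closed: it may be applied termwise to a convergent series
of finite combinations of Fock states if the series of the images converges too. -/
theorem hasDerivAt_of_hasSum (hV : ∀ s t : ℝ, V (s + t) = V s * V t) {A : Fin0 m →ₗ[ℂ] Fin0 m}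
    (hA : ∀ v : Fin0 m, HasDerivAt (fun t => V t (incl m v)) (incl m (A v)) 0) {ι : Type*}
    {v : ι → Fin0 m} {x y : Fock m} (hx : HasSum (fun k => incl m (v k)) x)
    (hy : HasSum (fun k => incl m (A (v k))) y) : HasDerivAt (fun t => V t x) y 0 := by
  have h1 : HasDerivAt (fun t => V t x) (V 0 y) 0 := by
    refine hasDerivAt_of_tendstoUniformly (l := Filter.atTop)
      (f := fun (s : Finset ι) t => V t (incl m (∑ k ∈ s, v k)))
      (f' := fun (s : Finset ι) t => V t (incl m (A (∑ k ∈ s, v k))))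
      (g' := fun t => V t y) ?_
      (Filter.Eventually.of_forall fun s t => hasDerivAt_group hV (hA _) t) (fun t => ?_) 0
    · rw [Metric.tendstoUniformly_iff]
      intro ε hε
      filter_upwards [Metric.tendsto_nhds.1 hy ε hε] with s hs t
      rw [LinearIsometryEquiv.dist_map, dist_comm]
      simpa only [map_sum] using hs
    · simp only [map_sum]
      have h2 : Filter.Tendsto (fun s : Finset ι => V t (∑ k ∈ s, incl m (v k))) Filter.atTop
          (nhds (V t x)) := ((V t).continuous.tendsto x).comp hx
      simpa only [map_sum] using h2
  rw [group_zero hV] at h1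
  exact h1

/-- The generator of a unitary group is skew-symmetric. -/
theorem inner_add_inner_generator_eq_zero (hV : ∀ s t : ℝ, V (s + t) = V s * V t)
    {x x' y y' : Fock m} (hx : HasDerivAt (fun t => V t x) x' 0)
    (hy : HasDerivAt (fun t => V t y) y' 0) : ⟪x, y'⟫_ℂ + ⟪x', y⟫_ℂ = 0 := by
  have h := hx.inner ℂ hy
  simp only [LinearIsometryEquiv.inner_map_map, group_zero hV] at h
  exact h.unique (hasDerivAt_const _ _)

end UnitaryGroup

theorem summable_incl_dispGen (β α : Fin m → ℂ) :
    Summable fun n => incl m (dispGen β (Finsupp.single n (expCoeff α n))) := by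
  simp only [LinearMap.sum_apply, LinearMap.sub_apply, LinearMap.smul_apply, map_sum, map_sub,
    map_smul]
  exact summable_sum fun i _ => ((summable_incl_creation α i).const_smul _).sub
    ((hasSum_incl_annihilation α i).summable.const_smul _)

/-- A unitary group generated by the displacement generator agrees with the Weyl unitaries: on
exponential vectors, which lie in the domain of both generators, the overlap of the two orbits is
constant by skew-symmetry. -/
theorem eq_weyl_of_isExp {β : Fin m → ℂ} {W : Fock m ≃ₗᵢ[ℂ] Fock m} (hW : IsExp (dispGen β) W) :
    W = weyl β := by
  obtain ⟨V, hV, _, hA, rfl⟩ := hW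
  set V' : ℝ → (Fock m ≃ₗᵢ[ℂ] Fock m) := fun t => weyl (fun i => (t : ℂ) * β i) with hV'def
  have hV' : ∀ s t : ℝ, V' (s + t) = V' s * V' t := weyl_add_smul β
  have hx : ∀ α, HasSum (fun n => incl m (Finsupp.single n (expCoeff α n))) (expVec α) :=
    fun α => by simpa using hasSum_expVec α
  set y : (Fin m → ℂ) → Fock m := fun α =>
    ∑' n, incl m (dispGen β (Finsupp.single n (expCoeff α n))) with hydef
  have hy : ∀ α, HasSum (fun n => incl m (dispGen β (Finsupp.single n (expCoeff α n)))) (y α) :=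
    fun α => (summable_incl_dispGen β α).hasSum
  have hd : ∀ α, HasDerivAt (fun t => V t (expVec α)) (y α) 0 :=
    fun α => hasDerivAt_of_hasSum hV hA (hx α) (hy α)
  have hd' : ∀ α, HasDerivAt (fun t => V' t (expVec α)) (y α) 0 :=
    fun α => hasDerivAt_of_hasSum hV' (hasDerivAt_weyl_incl β) (hx α) (hy α)
  have key : ∀ α' α, ⟪V 1 (expVec α'), V' 1 (expVec α)⟫_ℂ = ⟪expVec α', expVec α⟫_ℂ := by
    intro α' α
    have hder : ∀ t, HasDerivAt (fun t => ⟪V t (expVec α'), V' t (expVec α)⟫_ℂ) 0 t := by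
      intro t
      have h1 := (hasDerivAt_group hV (hd α') t).inner ℂ (hasDerivAt_group hV' (hd' α) t)
      -- both generators act on the multiple `V' t e(α)` of an exponential vector in the same way
      have h2 : HasDerivAt (fun s => V s (V' t (expVec α))) (V' t (y α)) 0 := by
        have h3 := hasDerivAt_group_apply hV' (hd' α) t
        set c : ℂ := Complex.exp (-(∑ i, conj ((t : ℂ) * β i) * ((t : ℂ) * β i)) / 2
            - ∑ i, conj ((t : ℂ) * β i) * α i)
        have hc : V' t (expVec α) = c • expVec (α + fun i => (t : ℂ) * β i) := weyl_expVec _ _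
        rw [hc] at h3 ⊢
        simp only [map_smul] at h3 ⊢
        have h4 := (hd' (α + fun i => (t : ℂ) * β i)).fun_const_smul c
        have h5 := (hd (α + fun i => (t : ℂ) * β i)).fun_const_smul c
        rwa [h4.unique h3] at h5
      have h7 := inner_add_inner_generator_eq_zero hV (hasDerivAt_group_apply hV (hd α') t) h2
      rwa [h7] at h1
    have hdiff : Differentiable ℝ fun t => ⟪V t (expVec α'), V' t (expVec α)⟫_ℂ :=
      fun t => (hder t).differentiableAt
    have := is_const_of_deriv_eq_zero hdiff (fun t => (hder t).deriv) 1 0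
    rw [this, group_zero hV, group_zero hV']
    rfl
  have h1 : V' 1 = weyl β := by simp [hV'def]
  rw [← h1]
  refine eq_of_apply_expVec_eq fun α => ?_
  have h2 : (V 1).symm (V' 1 (expVec α)) = expVec α := by
    refine eq_of_inner_expVec_eq fun α' => ?_
    rw [← key, ← LinearIsometryEquiv.inner_map_map (V 1) (expVec α'),
      LinearIsometryEquiv.apply_symm_apply]
  rw [← h2, LinearIsometryEquiv.apply_symm_apply, h2]

theorem displacement_eq_weyl (β : Fin m → ℂ) : displacement β = weyl β := by
  have h : ∃ W, IsExp (dispGen β) W := ⟨_, isExp_weyl β⟩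
  have h1 : displacement β = h.choose := by
    rw [displacement, opExp, dif_pos h]
  rw [h1]
  exact eq_weyl_of_isExp h.choose_spec

/-! ### Coherent states -/

/-- The coherent state `|α⟩ = e^{-|α|²/2} e(α)`. -/
def coh (α : Fin m → ℂ) : Fock m := ((Real.exp (-(∑ i, ‖α i‖ ^ 2) / 2) : ℝ) : ℂ) • expVec α

theorem norm_coh (α : Fin m → ℂ) : ‖coh α‖ = 1 := by
  have h : ‖coh α‖ ^ 2 = 1 := by
    rw [coh, norm_smul, mul_pow, norm_expVec_sq, Complex.norm_real, Real.norm_eq_abs, sq_abs,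
      ← Real.exp_nat_mul, ← Real.exp_add]
    norm_num
    ring
  exact (pow_eq_one_iff_of_nonneg (norm_nonneg _) two_ne_zero).1 h

theorem norm_hetAmp_sq (u : Fock m) (α : Fin m → ℂ) :
    ‖hetAmp u α‖ ^ 2 = (Real.pi ^ m)⁻¹ * ‖⟪coh α, u⟫_ℂ‖ ^ 2 := by
  rw [hetAmp, coh, inner_smul_left, norm_mul, norm_mul, mul_pow, mul_pow, RCLike.norm_conj,
    Complex.norm_real, Complex.norm_real, Real.norm_eq_abs, Real.norm_eq_abs, sq_abs, sq_abs,
    div_pow, Real.sq_sqrt (by positivity)]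
  ring

theorem displacement_vac (γ : Fin m → ℂ) : displacement γ (vac m) = coh γ := by
  rw [displacement_eq_weyl, ← expVec_zero, weyl_expVec, dispVec, coh, zero_add]
  congr 1
  have h : ∑ i, conj (γ i) * γ i = ((∑ i, ‖γ i‖ ^ 2 : ℝ) : ℂ) := by
    push_cast
    exact Finset.sum_congr rfl fun i _ => by rw [Complex.conj_mul']
  rw [h]
  simp

/-- Displacing a coherent state gives a coherent state, up to a phase. -/
theorem exists_phase_displacement_coh (β γ : Fin m → ℂ) :
    ∃ c : ℂ, ‖c‖ = 1 ∧ displacement γ (vac m) = c • displacement β (coh (γ - β)) := by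
  have h1 : ∃ c : ℂ, displacement γ (vac m) = c • displacement β (coh (γ - β)) := by
    rw [displacement_vac, displacement_eq_weyl]
    simp only [coh, map_smul, weyl_expVec, dispVec, sub_add_cancel, smul_smul]
    have h2 : ∀ a b d : ℂ, b ≠ 0 → d ≠ 0 → a = a * b⁻¹ * d⁻¹ * (b * d) := fun a b d hb hd => by
      field_simp
    exact ⟨_, congrArg (fun z : ℂ => z • expVec γ)
      (h2 _ _ _ (by exact_mod_cast (Real.exp_pos _).ne') (Complex.exp_ne_zero _))⟩
  obtain ⟨c, hc⟩ := h1
  refine ⟨c, ?_, hc⟩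
  have h3 := congrArg norm hc
  rw [displacement_vac, norm_smul, LinearIsometryEquiv.norm_map, norm_coh, norm_coh, mul_one] at h3
  exact h3.symm

/-! ### Passive linear transformations -/

/-- Seen from the exponential vector of `α`, a creation operator in front of `Û` is multiplication
by the conjugate of a component of `U† α`: exponential vectors are eigenvectors of annihilation. -/
theorem inner_expVec_passive {U : Matrix (Fin m) (Fin m) ℂ} {Uhat : Fock m ≃ₗᵢ[ℂ] Fock m}
    (h : IsPassive U Uhat) (α : Fin m → ℂ) (i : Fin m) (v : Fin0 m) :
    ⟪expVec α, Uhat (incl m (creation i v))⟫_ℂ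
      = conj (U.conjTranspose.mulVec α i) * ⟪expVec α, Uhat (incl m v)⟫_ℂ := by
  have e : ∀ (z : Fock m) (f : Occ m → Fock m) (x : Fock m), HasSum f x →
      HasSum (fun n => ⟪f n, z⟫_ℂ) ⟪x, z⟫_ℂ := fun z f x hf => by
    have h1 := (hf.mapL (innerSL ℂ z)).map (starRingEnd ℂ) Complex.continuous_conj
    simpa only [Function.comp_def, innerSL_apply_apply, inner_conj_symm] using h1
  have h1 := e (Uhat (incl m (creation i v))) _ _ (hasSum_expVec α)
  have h2 : HasSum (fun n => ∑ j, U j i * ⟪incl m (annihilation j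
      (Finsupp.single n (expCoeff α n))), Uhat (incl m v)⟫_ℂ)
      (∑ j, U j i * ⟪α j • expVec α, Uhat (incl m v)⟫_ℂ) :=
    hasSum_sum fun j _ => (e (Uhat (incl m v)) _ _ (hasSum_incl_annihilation α j)).mul_left _
  have h3 : ∀ n, ⟪expCoeff α n • ket n, Uhat (incl m (creation i v))⟫_ℂ
      = ∑ j, U j i * ⟪incl m (annihilation j (Finsupp.single n (expCoeff α n))),
        Uhat (incl m v)⟫_ℂ := fun n => by
    rw [← h.creation_rel, incl_single]
  simp only [h3] at h1
  rw [h1.unique h2]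
  simp only [inner_smul_left, Matrix.mulVec, dotProduct, Matrix.conjTranspose_apply, map_sum,
    map_mul, Finset.sum_mul]
  refine Finset.sum_congr rfl fun j _ => ?_
  rw [← Complex.star_def, star_star]; ring

/-- A passive transformation preserves the vacuum, up to a phase. -/
theorem exists_phase_passive_vac {U : Matrix (Fin m) (Fin m) ℂ} {Uhat : Fock m ≃ₗᵢ[ℂ] Fock m}
    (h : IsPassive U Uhat) (hU : U ∈ Matrix.unitaryGroup (Fin m) ℂ) :
    ∃ c : ℂ, ‖c‖ = 1 ∧ Uhat (vac m) = c • vac m := by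
  -- `Û|0⟩` is annihilated by all annihilation operators, hence a multiple of the vacuum
  have h1 : ∀ (i : Fin m) (w : Fin0 m),
      ∑ j, conj (U j i) * ⟪incl m (creation j w), Uhat (vac m)⟫_ℂ = 0 := by
    intro i w
    have h2 := h.annihilation_rel i (Finsupp.single 0 1) w
    rw [annihilation_single] at h2
    simp only [incl_single, one_smul, Pi.zero_apply, Nat.cast_zero, Real.sqrt_zero,
      Complex.ofReal_zero, mul_zero, zero_smul, map_zero, inner_zero_right] at h2
    exact h2.symm
  have hUU : U * U.conjTranspose = 1 := Matrix.mem_unitaryGroup_iff.1 hU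
  have h3 : ∀ (j : Fin m) (w : Fin0 m), ⟪incl m (creation j w), Uhat (vac m)⟫_ℂ = 0 := by
    intro j w
    set x : Fin m → ℂ := fun j => ⟪incl m (creation j w), Uhat (vac m)⟫_ℂ with hx
    have h4 : U.conjTranspose.mulVec x = 0 := funext fun i => h1 i w
    have h5 : x = 0 := by
      rw [← Matrix.one_mulVec x, ← hUU, ← Matrix.mulVec_mulVec, h4, Matrix.mulVec_zero]
    exact congrFun h5 j
  have h6 : Uhat (vac m) = (Uhat (vac m) 0) • vac m := by
    ext n
    rw [lp.coeFn_smul, Pi.smul_apply, vac, ket_apply, smul_eq_mul]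
    split_ifs with hn
    · subst hn; simp
    · obtain ⟨i, hi⟩ : ∃ i, n i ≠ 0 := by
        by_contra! hc; exact hn (funext fun i => (hc i).symm)
      have h7 := h3 i (Finsupp.single (n - Pi.single i 1) 1)
      have h8 : n - Pi.single i 1 + Pi.single i 1 = n := by
        funext j
        by_cases hj : j = i
        · subst hj; simp; omega
        · simp [Pi.single_eq_of_ne hj]
      rw [creation_single, h8, incl_single, inner_smul_left, inner_ket_left] at h7
      rw [mul_zero]
      refine (mul_eq_zero.1 h7).resolve_left ?_
      intro h0
      rw [map_eq_zero, one_mul, Complex.ofReal_eq_zero] at h0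
      exact (Real.sqrt_pos.2 (by positivity)).ne' h0
  refine ⟨_, ?_, h6⟩
  have h9 := congrArg norm h6
  rw [LinearIsometryEquiv.norm_map, norm_smul, vac, norm_ket, mul_one] at h9
  exact h9.symm

theorem inner_expVec_passive_ket {U : Matrix (Fin m) (Fin m) ℂ} {Uhat : Fock m ≃ₗᵢ[ℂ] Fock m}
    (h : IsPassive U Uhat) (α : Fin m → ℂ) (n : Occ m) :
    ⟪expVec α, Uhat (ket n)⟫_ℂ
      = conj (expCoeff (U.conjTranspose.mulVec α) n) * ⟪expVec α, Uhat (vac m)⟫_ℂ := by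
  induction hk : ∑ i, n i generalizing n with
  | zero =>
    have hn : n = 0 := by
      funext i
      exact (Finset.sum_eq_zero_iff.1 hk) i (Finset.mem_univ i)
    subst hn
    simp [expCoeff, vac]
  | succ k ih =>
    obtain ⟨i, hi⟩ : ∃ i, n i ≠ 0 := by
      by_contra! hc; simp [hc] at hk
    obtain ⟨n', rfl⟩ : ∃ n' : Occ m, n = n' + Pi.single i 1 := by
      refine ⟨n - Pi.single i 1, ?_⟩
      funext j
      by_cases hj : j = i
      · subst hj; simp; omega
      · simp [Pi.single_eq_of_ne hj]
    have h1 := ih n' (by simp [Finset.sum_add_distrib] at hk; exact hk)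
    have h2 := inner_expVec_passive h α i (Finsupp.single n' 1)
    rw [creation_single, incl_single, incl_single, map_smul, inner_smul_right, one_mul, one_smul,
      h1] at h2
    have h3 := congrArg conj (expCoeff_add_single (U.conjTranspose.mulVec α) i n')
    simp only [map_mul, Complex.conj_ofReal] at h3
    have h4 : ((Real.sqrt ((n' i : ℝ) + 1) : ℝ) : ℂ) ≠ 0 := by
      exact_mod_cast (Real.sqrt_pos.2 (by positivity)).ne'
    refine mul_left_cancel₀ h4 ?_
    rw [h2]
    linear_combination (-⟪expVec α, Uhat (vac m)⟫_ℂ) * h3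

/-- A passive transformation maps the coherent state of `U† α` to that of `α`, up to a phase. -/
theorem exists_phase_passive_coh {U : Matrix (Fin m) (Fin m) ℂ} {Uhat : Fock m ≃ₗᵢ[ℂ] Fock m}
    (h : IsPassive U Uhat) (hU : U ∈ Matrix.unitaryGroup (Fin m) ℂ) (α : Fin m → ℂ) :
    ∃ c : ℂ, ‖c‖ = 1 ∧ coh α = c • Uhat (coh (U.conjTranspose.mulVec α)) := by
  obtain ⟨c, hc, hvac⟩ := exists_phase_passive_vac h hU
  have h1 : ∀ n, ⟪expVec α, Uhat (ket n)⟫_ℂ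
      = c * ⟪expVec (U.conjTranspose.mulVec α), ket n⟫_ℂ := fun n => by
    rw [inner_expVec_passive_ket h, hvac, inner_smul_right, inner_expVec_ket, vac,
      inner_expVec_ket]
    simp [expCoeff]; ring
  have h2 : Uhat.symm (expVec α) = conj c • expVec (U.conjTranspose.mulVec α) := by
    ext n
    rw [← inner_ket_left, ← inner_ket_left, ← inner_conj_symm, inner_smul_right,
      ← inner_conj_symm (ket n) (expVec _), ← map_mul, ← h1,
      ← LinearIsometryEquiv.inner_map_map Uhat, LinearIsometryEquiv.apply_symm_apply]
  have h3 : expVec α = conj c • Uhat (expVec (U.conjTranspose.mulVec α)) := by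
    rw [← map_smul, ← h2, LinearIsometryEquiv.apply_symm_apply]
  have h4 : ∃ d : ℂ, coh α = d • Uhat (coh (U.conjTranspose.mulVec α)) := by
    refine ⟨((Real.exp (-(∑ i, ‖α i‖ ^ 2) / 2) : ℝ) : ℂ) * conj c *
      ((Real.exp (-(∑ i, ‖U.conjTranspose.mulVec α i‖ ^ 2) / 2) : ℝ) : ℂ)⁻¹, ?_⟩
    rw [coh, coh, h3, map_smul, smul_smul, smul_smul,
      inv_mul_cancel_right₀ (by exact_mod_cast (Real.exp_pos _).ne')]
  obtain ⟨d, hd⟩ := h4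
  refine ⟨d, ?_, hd⟩
  have h6 := congrArg norm hd
  rw [norm_smul, LinearIsometryEquiv.norm_map, norm_coh, norm_coh, mul_one] at h6
  exact h6.symm

/-! ### Bounds on the estimator functions -/

/-- Generating function of the Laguerre 2D polynomials. -/
theorem hasSum_lag_mul_pow (k : ℕ) (w ζ : ℂ) :
    HasSum (fun l : ℕ => ζ ^ l * ((-1) ^ k * lag k l w / (Real.sqrt l.factorial : ℂ)))
      (Complex.exp (w * ζ) * ((ζ - conj w) ^ k / (Real.sqrt k.factorial : ℂ))) := by
  have hs : ∀ n : ℕ, ((Real.sqrt n.factorial : ℝ) : ℂ) ≠ 0 := fun n => by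
    exact_mod_cast (Real.sqrt_pos.2 (by positivity)).ne'
  have h1 : ∀ q : ℕ, HasSum (fun l : ℕ => if q ≤ l then
      ζ ^ q * (w * ζ) ^ (l - q) / ((l - q).factorial : ℂ) else 0)
      (ζ ^ q * Complex.exp (w * ζ)) := by
    intro q
    have hinj : Function.Injective fun j : ℕ => q + j := fun a b h => by simpa using h
    rw [← hinj.hasSum_iff]
    · have h2 : HasSum (fun j : ℕ => (w * ζ) ^ j / (j.factorial : ℂ)) (Complex.exp (w * ζ)) := by
        rw [Complex.exp_eq_exp_ℂ]; exact NormedSpace.expSeries_div_hasSum_exp _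
      refine (h2.mul_left (ζ ^ q)).congr_fun fun j => ?_
      simp only [Function.comp_apply]
      rw [if_pos (by omega), Nat.add_sub_cancel_left, mul_div_assoc]
    · intro l hl
      rw [if_neg]
      intro h
      exact hl ⟨l - q, by simp only; omega⟩
  have h2 := hasSum_sum (s := Finset.range (k + 1)) fun q _ =>
    (h1 q).mul_left ((-conj w) ^ (k - q) * (k.choose q : ℂ) / (Real.sqrt k.factorial : ℂ))
  have h3 : ∑ q ∈ Finset.range (k + 1), (-conj w) ^ (k - q) * (k.choose q : ℂ)
        / (Real.sqrt k.factorial : ℂ) * (ζ ^ q * Complex.exp (w * ζ))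
      = Complex.exp (w * ζ) * ((ζ - conj w) ^ k / (Real.sqrt k.factorial : ℂ)) := by
    rw [sub_eq_add_neg, add_pow, Finset.sum_div, Finset.mul_sum]
    exact Finset.sum_congr rfl fun q _ => by ring
  rw [h3] at h2
  refine h2.congr_fun fun l => ?_
  have h4 : ∑ q ∈ Finset.range (k + 1), (-conj w) ^ (k - q) * (k.choose q : ℂ)
        / (Real.sqrt k.factorial : ℂ)
        * (if q ≤ l then ζ ^ q * (w * ζ) ^ (l - q) / ((l - q).factorial : ℂ) else 0)
      = ∑ q ∈ Finset.range (min k l + 1), (-conj w) ^ (k - q) * (k.choose q : ℂ)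
        / (Real.sqrt k.factorial : ℂ) * (ζ ^ q * (w * ζ) ^ (l - q) / ((l - q).factorial : ℂ)) := by
    rw [← Finset.sum_subset (s₁ := Finset.range (min k l + 1))]
    · refine Finset.sum_congr rfl fun q hq => ?_
      rw [Finset.mem_range] at hq
      rw [if_pos (by omega)]
    · intro q hq; rw [Finset.mem_range] at hq ⊢; omega
    · intro q hq hq'
      rw [Finset.mem_range] at hq hq'
      rw [if_neg (by omega), mul_zero]
  rw [h4, lag, Finset.mul_sum, Finset.sum_div, Finset.mul_sum]
  refine Finset.sum_congr rfl fun q hq => ?_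
  rw [Finset.mem_range] at hq
  obtain ⟨k', rfl⟩ : ∃ k', k = q + k' := ⟨k - q, by omega⟩
  obtain ⟨l', rfl⟩ : ∃ l', l = q + l' := ⟨l - q, by omega⟩
  have e1 : ((q + k').choose q : ℂ) = (q + k').factorial / (q.factorial * k'.factorial) := by
    rw [Nat.cast_choose ℂ (by omega), Nat.add_sub_cancel_left]
  have e2 : ((Real.sqrt (q + k').factorial : ℝ) : ℂ) ^ 2 = ((q + k').factorial : ℂ) := by
    rw [← Complex.ofReal_pow, Real.sq_sqrt (by positivity), Complex.ofReal_natCast]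
  rw [e1, Nat.add_sub_cancel_left, Nat.add_sub_cancel_left, ← e2, neg_pow, mul_pow]
  have h5 := hs (q + k')
  have h6 := hs (q + l')
  have f1 : (q.factorial : ℂ) ≠ 0 := by exact_mod_cast (Nat.factorial_pos _).ne'
  have f2 : (k'.factorial : ℂ) ≠ 0 := by exact_mod_cast (Nat.factorial_pos _).ne'
  have f3 : (l'.factorial : ℂ) ≠ 0 := by exact_mod_cast (Nat.factorial_pos _).ne'
  have e3 : (-1 : ℂ) ^ q * (-1) ^ q = 1 := by rw [← mul_pow]; norm_num
  push_cast
  field_simp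
  rw [pow_add, pow_add]
  linear_combination (ζ ^ q * ζ ^ l' * w ^ l' * conj w ^ k' * (-1) ^ k') * e3

/-- Two everywhere convergent power series with the same sum have the same coefficients. -/
theorem eq_of_hasSum_pow_mul {a b : ℕ → ℂ} {F : ℂ → ℂ}
    (ha : ∀ ζ, HasSum (fun n => ζ ^ n * a n) (F ζ))
    (hb : ∀ ζ, HasSum (fun n => ζ ^ n * b n) (F ζ)) : a = b := by
  have h : ∀ a : ℕ → ℂ, (∀ ζ, HasSum (fun n => ζ ^ n * a n) (F ζ)) →
      HasFPowerSeriesAt F (FormalMultilinearSeries.ofScalars ℂ a) 0 := fun a ha => by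
    rw [hasFPowerSeriesAt_iff]
    refine Filter.Eventually.of_forall fun ζ => ?_
    simpa [FormalMultilinearSeries.coeff_ofScalars] using ha ζ
  have h1 := (h a ha).eq_formalMultilinearSeries (h b hb)
  funext n
  have := congrArg (fun p => FormalMultilinearSeries.coeff p n) h1
  simpa [FormalMultilinearSeries.coeff_ofScalars] using this

/-- The Laguerre 2D polynomials are, up to the Gaussian factor and a sign, matrix elements of the
displacement operators, and therefore bounded. -/
theorem norm_lag_le (k l : ℕ) (w : ℂ) : ‖lag k l w‖ ≤ Real.exp (‖w‖ ^ 2 / 2) := by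
  set x : Fock 1 := weyl (fun i => ((1 : ℝ) : ℂ) * (fun _ : Fin 1 => w) i) (ket fun _ => k) with hx
  have hs : ∀ n : ℕ, ((Real.sqrt n.factorial : ℝ) : ℂ) ≠ 0 := fun n => by
    exact_mod_cast (Real.sqrt_pos.2 (by positivity)).ne'
  have h1 : ∀ ζ : ℂ, HasSum (fun n : ℕ => ζ ^ n * (x (fun _ => n) / (Real.sqrt n.factorial : ℂ)))
      (Complex.exp (-(conj w * w) / 2)
        * (Complex.exp (w * ζ) * ((ζ - conj w) ^ k / (Real.sqrt k.factorial : ℂ)))) := fun ζ => by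
    have h2 := hasSum_inner_expVec (fun _ : Fin 1 => conj ζ) x
    rw [hx, inner_expVec_weyl, inner_expVec_ket, ← hx] at h2
    rw [← (Equiv.funUnique (Fin 1) ℕ).symm.hasSum_iff] at h2
    have h3 := h2.congr_fun (g := fun n : ℕ => ζ ^ n * (x (fun _ => n)
      / (Real.sqrt n.factorial : ℂ))) fun n => by
        have he : (Equiv.funUnique (Fin 1) ℕ).symm n = fun _ => n := by
          funext i; obtain rfl := Subsingleton.elim i default; rfl
        rw [Function.comp_apply, he]
        simp [expCoeff]
        ring
    convert h3 using 1
    simp [expCoeff, Complex.exp_add]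
    ring
  have h2 : ∀ ζ : ℂ, HasSum (fun n : ℕ => ζ ^ n * (Complex.exp (-(conj w * w) / 2)
      * ((-1) ^ k * lag k n w / (Real.sqrt n.factorial : ℂ))))
      (Complex.exp (-(conj w * w) / 2)
        * (Complex.exp (w * ζ) * ((ζ - conj w) ^ k / (Real.sqrt k.factorial : ℂ)))) := fun ζ =>
    ((hasSum_lag_mul_pow k w ζ).mul_left _).congr_fun fun n => by ring
  have h3 := congrFun (eq_of_hasSum_pow_mul h1 h2) l
  have h4 : x (fun _ => l) = Complex.exp (-(conj w * w) / 2) * ((-1) ^ k * lag k l w) := by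
    have := hs l
    rw [← mul_div_assoc] at h3
    exact (div_left_inj' this).1 h3
  have h5 : ‖x (fun _ => l)‖ ≤ 1 := by
    have h6 : ‖x‖ = 1 := by rw [hx, LinearIsometryEquiv.norm_map, norm_ket]
    exact (lp.norm_apply_le_norm two_ne_zero x _).trans h6.le
  have h7 : ‖Complex.exp (-(conj w * w) / 2)‖ = Real.exp (-(‖w‖ ^ 2 / 2)) := by
    rw [Complex.norm_exp, Complex.conj_mul', ← Complex.ofReal_pow]
    congr 1
    rw [← Complex.ofReal_neg, ← Complex.ofReal_ofNat, ← Complex.ofReal_div, Complex.ofReal_re]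
    ring
  rw [h4, norm_mul, h7, norm_mul, norm_pow, norm_neg, norm_one, one_pow, one_mul,
    Real.exp_neg] at h5
  rw [inv_mul_le_iff₀ (Real.exp_pos _)] at h5
  simpa using h5

theorem norm_fEst (k l : ℕ) (z : ℂ) {η : ℝ} (hη : 0 < η) :
    ‖fEst k l z η‖ = 1 / η ^ (1 + ((k : ℝ) + (l : ℝ)) / 2)
      * (Real.exp (-(1 - η) * ‖z / (Real.sqrt η : ℂ)‖ ^ 2)
        * ‖lag l k (z / (Real.sqrt η : ℂ))‖) := by
  rw [fEst, norm_mul, Complex.norm_real, Real.norm_of_nonneg (by positivity), norm_div,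
    Complex.norm_real, Real.norm_of_nonneg (Real.sqrt_nonneg _), div_pow, Real.sq_sqrt hη.le,
    mul_assoc]
  have h : (1 - 1 / η) * ‖z‖ ^ 2 = -(1 - η) * (‖z‖ ^ 2 / η) := by field_simp; ring
  rw [h]

/-- The Gaussian damping `e^{-(1-η)|w|²}` controls the Laguerre polynomials in `g^{(p)}`. For
`η ≤ 1/2` this is the unitarity of displacements; the threshold `(p+1)/(p(p+c))` exceeds `1/2` only
for `p = 1` and `c ≤ 2`, where the polynomials have degree at most two. -/
theorem exp_mul_norm_lag_le {c p k l j : ℕ} (hk : k < c) (hl : l < c) (hj : j < p) {η : ℝ}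
    (hη1 : η ≤ ((p : ℝ) + 1) / ((p : ℝ) * ((p : ℝ) + c))) (w : ℂ) :
    Real.exp (-(1 - η) * ‖w‖ ^ 2) * ‖lag (l + j) (k + j) w‖
      ≤ Real.sqrt (2 ^ (max k l - min k l) * ((max k l).choose (min k l) : ℝ)) := by
  have hone : (1 : ℝ) ≤ Real.sqrt (2 ^ (max k l - min k l) * ((max k l).choose (min k l) : ℝ)) := by
    rw [Real.one_le_sqrt]
    have h1 : (1 : ℝ) ≤ ((max k l).choose (min k l) : ℝ) := by
      exact_mod_cast Nat.choose_pos (min_le_max)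
    exact one_le_mul_of_one_le_of_one_le (one_le_pow₀ (by norm_num)) h1
  have hp : (1 : ℝ) ≤ p := by exact_mod_cast (by omega : 1 ≤ p)
  have hc : (1 : ℝ) ≤ c := by exact_mod_cast (by omega : 1 ≤ c)
  rw [le_div_iff₀ (by positivity)] at hη1
  have hw := sq_nonneg ‖w‖
  by_cases h : η ≤ 1 / 2
  · refine le_trans ?_ hone
    have h1 := norm_lag_le (l + j) (k + j) w
    calc Real.exp (-(1 - η) * ‖w‖ ^ 2) * ‖lag (l + j) (k + j) w‖
        ≤ Real.exp (-(‖w‖ ^ 2 / 2)) * Real.exp (‖w‖ ^ 2 / 2) := by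
          refine mul_le_mul (Real.exp_le_exp.2 (by nlinarith)) h1 (norm_nonneg _)
            (Real.exp_pos _).le
      _ = 1 := by rw [← Real.exp_add]; simp
  · push Not at h
    have hp1 : p = 1 := by
      by_contra hne
      have : (2 : ℝ) ≤ p := by exact_mod_cast (by omega : 2 ≤ p)
      nlinarith [mul_nonneg (sub_nonneg.2 this) (by linarith : (0 : ℝ) ≤ (p : ℝ) + c),
        mul_nonneg (by linarith : (0 : ℝ) ≤ η - 1 / 2)
          (by positivity : (0 : ℝ) ≤ (p : ℝ) * (p + c))]
    subst hp1
    obtain rfl : j = 0 := by omega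
    have hc2 : c ≤ 2 := by
      by_contra hne
      have : (3 : ℝ) ≤ c := by exact_mod_cast (by omega : 3 ≤ c)
      push_cast at hη1
      nlinarith
    push_cast at hη1
    have hη' : η ≤ 1 := by nlinarith
    rw [Nat.add_zero, Nat.add_zero]
    have hle1 : Real.exp (-(1 - η) * ‖w‖ ^ 2) ≤ 1 := by
      rw [Real.exp_le_one_iff]; nlinarith
    rcases (by omega : k = 0 ∧ l = 0 ∨ c = 2) with ⟨rfl, rfl⟩ | rfl
    · simpa [lag] using hle1
    have hη'' : η ≤ 2 / 3 := by norm_num at hη1; linarith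
    have hexp : Real.exp (-(1 - η) * ‖w‖ ^ 2) * Real.exp (‖w‖ ^ 2 / 3) ≤ 1 := by
      rw [← Real.exp_add, Real.exp_le_one_iff]; nlinarith
    have hquad := Real.quadratic_le_exp_of_nonneg (by positivity : 0 ≤ ‖w‖ ^ 2 / 3)
    have hnorm : ∀ x : ℝ, x ≤ Real.exp (‖w‖ ^ 2 / 3) →
        Real.exp (-(1 - η) * ‖w‖ ^ 2) * x ≤ 1 := fun x hx =>
      (mul_le_mul_of_nonneg_left hx (Real.exp_pos _).le).trans hexp
    have hsqrt2 : Real.exp (-(1 - η) * ‖w‖ ^ 2) * ‖w‖ ≤ Real.sqrt 2 := by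
      have h2 : (1 : ℝ) ≤ Real.sqrt 2 := by rw [Real.one_le_sqrt]; norm_num
      refine (hnorm _ ?_).trans h2
      nlinarith [sq_nonneg (‖w‖ - 1), sq_nonneg (‖w‖ ^ 2 / 3)]
    interval_cases k <;> interval_cases l
    · simpa [lag] using hle1
    · simpa [lag] using hsqrt2
    · simpa [lag] using hsqrt2
    · have h3 : lag 1 1 w = ((‖w‖ ^ 2 - 1 : ℝ) : ℂ) := by
        simp only [lag, min_self, Finset.sum_range_succ, Finset.sum_range_zero]
        norm_num
        rw [Complex.mul_conj, Complex.normSq_eq_norm_sq]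
        push_cast; ring
      rw [h3, Complex.norm_real]
      refine (hnorm _ ?_).trans hone
      rw [Real.norm_eq_abs, abs_le]
      constructor
      · nlinarith [Real.exp_pos (‖w‖ ^ 2 / 3)]
      · nlinarith [sq_nonneg (‖w‖ ^ 2 / 3 - 2)]

theorem norm_gEst_le {c p k l : ℕ} (hp : 1 ≤ p) (hk : k < c) (hl : l < c) {η : ℝ} (hη : 0 < η)
    (hη1 : η ≤ ((p : ℝ) + 1) / ((p : ℝ) * ((p : ℝ) + c))) (z : ℂ) :
    ‖gEst p k l z η‖ ≤ 1 / η ^ (1 + ((k : ℝ) + (l : ℝ)) / 2) * ((max k l + p).choose (p - 1) : ℝ)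
      * Real.sqrt (2 ^ (max k l - min k l) * ((max k l).choose (min k l) : ℝ)) := by
  -- the binomial coefficient in `B` collects those of the `p` summands of `g^{(p)}`
  have h1 : ((max k l + p).choose (p - 1) : ℝ)
      = ∑ j ∈ Finset.range p, ((max k l + j).choose (max k l) : ℝ) := by
    have h2 := Nat.sum_range_add_choose (p - 1) (max k l)
    rw [Nat.sub_add_cancel hp] at h2
    have h3 : (max k l + p).choose (p - 1) = (p - 1 + max k l + 1).choose (max k l + 1) := by
      rw [show max k l + p = (p - 1) + (max k l + 1) by omega, Nat.choose_symm_add]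
      rfl
    rw [h3, ← h2]
    push_cast
    exact Finset.sum_congr rfl fun j _ => by rw [add_comm]
  rw [h1, Finset.mul_sum, Finset.sum_mul, gEst]
  refine norm_sum_le_of_le _ fun j hj => ?_
  rw [Finset.mem_range] at hj
  rw [norm_mul, norm_fEst _ _ _ hη, Complex.norm_real, norm_mul, norm_mul, norm_pow, norm_neg,
    norm_one, one_pow, one_mul, Real.norm_of_nonneg (by positivity : 0 ≤ η ^ j),
    Real.norm_of_nonneg (Real.sqrt_nonneg _)]
  have h4 : η ^ (1 + (((k + j : ℕ) : ℝ) + ((l + j : ℕ) : ℝ)) / 2)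
      = η ^ (1 + ((k : ℝ) + (l : ℝ)) / 2) * η ^ j := by
    rw [← Real.rpow_natCast η j, ← Real.rpow_add hη]
    congr 1; push_cast; ring
  have h5 : Real.sqrt (((k + j).choose k : ℝ) * ((l + j).choose l : ℝ))
      ≤ ((max k l + j).choose (max k l) : ℝ) := by
    have h6 : ∀ n, n ≤ max k l → ((n + j).choose n : ℝ) ≤ ((max k l + j).choose (max k l) : ℝ) := by
      intro n hn
      rw [Nat.choose_symm_add, Nat.choose_symm_add]
      exact_mod_cast Nat.choose_le_choose j (by omega)
    rw [Real.sqrt_le_left (by positivity), sq]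
    exact mul_le_mul (h6 k (le_max_left _ _)) (h6 l (le_max_right _ _)) (by positivity)
      (by positivity)
  have h7 := exp_mul_norm_lag_le hk hl hj hη1 (z / (Real.sqrt η : ℂ))
  rw [h4]
  have h8 : 0 < η ^ (1 + ((k : ℝ) + (l : ℝ)) / 2) := Real.rpow_pos_of_pos hη _
  have h9 : 0 < η ^ j := by positivity
  calc _ = 1 / η ^ (1 + ((k : ℝ) + (l : ℝ)) / 2)
        * Real.sqrt (((k + j).choose k : ℝ) * ((l + j).choose l : ℝ))
        * (Real.exp (-(1 - η) * ‖z / (Real.sqrt η : ℂ)‖ ^ 2)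
          * ‖lag (l + j) (k + j) (z / (Real.sqrt η : ℂ))‖) := by field_simp
    _ ≤ _ := by gcongr

/-- The complex double sum whose real part is `g_C^{(p)}`. -/
def gCoreC (p c : ℕ) (coef : ℕ → ℂ) (z : ℂ) (η : ℝ) : ℂ :=
  ∑ k ∈ Finset.range c, ∑ l ∈ Finset.range c, conj (coef k) * coef l * gEst p k l z η

theorem norm_gCoreC_le {c p : ℕ} (hp : 1 ≤ p) (coef : ℕ → ℂ) {η : ℝ} (hη : 0 < η)
    (hη1 : η ≤ ((p : ℝ) + 1) / ((p : ℝ) * ((p : ℝ) + c))) (z : ℂ) :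
    ‖gCoreC p c coef z η‖ ≤ constB p c coef η / η ^ c := by
  rw [gCoreC, constB, Finset.sum_div]
  refine norm_sum_le_of_le _ fun k hk => ?_
  rw [Finset.sum_div]
  refine norm_sum_le_of_le _ fun l hl => ?_
  rw [Finset.mem_range] at hk hl
  have h := norm_gEst_le hp hk hl hη hη1 z
  rw [norm_mul, norm_mul, RCLike.norm_conj, ← norm_mul]
  have h2 : η ^ ((c : ℝ) - 1 - ((k : ℝ) + (l : ℝ)) / 2) / η ^ c
      = 1 / η ^ (1 + ((k : ℝ) + (l : ℝ)) / 2) := by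
    rw [← Real.rpow_natCast η c, ← Real.rpow_sub hη, one_div, ← Real.rpow_neg hη.le]
    congr 1; ring
  calc _ ≤ ‖coef k * coef l‖ * (1 / η ^ (1 + ((k : ℝ) + (l : ℝ)) / 2)
          * ((max k l + p).choose (p - 1) : ℝ)
          * Real.sqrt (2 ^ (max k l - min k l) * ((max k l).choose (min k l) : ℝ))) := by gcongr
    _ = _ := by rw [← h2]; ring

theorem continuous_fEst (k l : ℕ) (η : ℝ) : Continuous fun z => fEst k l z η := by
  have hc : Continuous fun z : ℂ => conj z := Complex.continuous_conj
  unfold fEst lag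
  fun_prop

theorem continuous_gEst (p k l : ℕ) (η : ℝ) : Continuous fun z => gEst p k l z η := by
  unfold gEst
  exact continuous_finsetSum _ fun j _ => continuous_const.mul (continuous_fEst _ _ _)

theorem continuous_gCoreC (p c : ℕ) (coef : ℕ → ℂ) (η : ℝ) :
    Continuous fun z => gCoreC p c coef z η := by
  unfold gCoreC
  exact continuous_finsetSum _ fun k _ => continuous_finsetSum _ fun l _ =>
    continuous_const.mul (continuous_gEst _ _ _ _)

theorem gCore_eq_re (p c : ℕ) (coef : ℕ → ℂ) (z : ℂ) (η : ℝ) :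
    gCore p c coef z η = (gCoreC p c coef z η).re := rfl

/-! ### Projections onto the core states of single modes -/

theorem sum_norm_sq_comp_le (u : Fock m) (s : Finset (Occ m)) (φ : Occ m → Occ m)
    (hφ : Set.InjOn φ s) : ∑ a ∈ s, ‖u (φ a)‖ ^ 2 ≤ ‖u‖ ^ 2 := by
  classical
  rw [← Finset.sum_image (f := fun b => ‖u b‖ ^ 2) hφ]
  exact sum_le_hasSum _ (fun _ _ => by positivity) (hasSum_norm_sq u)

theorem injOn_update (i : Fin m) (k l : ℕ) (s : Finset (Occ m)) :
    Set.InjOn (fun a : Occ m => Function.update a i l) (s.filter fun a => a i = k) := by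
  intro a ha b hb h
  simp only [Finset.coe_filter, Set.mem_ofPred_eq] at ha hb
  funext j
  by_cases hj : j = i
  · subst hj; rw [ha.2, hb.2]
  · have := congrFun h j
    simpa [Function.update_of_ne hj] using this

theorem sum_norm_sq_shift_le (i : Fin m) (k l : ℕ) (u : Fock m) (s : Finset (Occ m)) :
    ∑ a ∈ s, ‖if a i = k then u (Function.update a i l) else 0‖ ^ 2 ≤ ‖u‖ ^ 2 := by
  have h : ∀ a ∈ s, ‖if a i = k then u (Function.update a i l) else 0‖ ^ 2
      = if a i = k then ‖u (Function.update a i l)‖ ^ 2 else 0 := fun a _ => by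
    split_ifs <;> simp
  rw [Finset.sum_congr rfl h, ← Finset.sum_filter]
  exact sum_norm_sq_comp_le u _ _ (injOn_update i k l s)

/-- The operator `|k⟩⟨l|` acting on mode `i`. -/
def shiftOp (i : Fin m) (k l : ℕ) : Fock m →L[ℂ] Fock m :=
  LinearMap.mkContinuous
    { toFun := fun u => ⟨fun a => if a i = k then u (Function.update a i l) else 0,
        memℓp_gen' (C := ‖u‖ ^ 2) fun s => by
          simpa using sum_norm_sq_shift_le i k l u s⟩
      map_add' := fun u v => by
        ext a
        simp only [lp.coeFn_add, Pi.add_apply]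
        split_ifs <;> simp
      map_smul' := fun c u => by
        ext a
        simp only [lp.coeFn_smul, Pi.smul_apply, RingHom.id_apply]
        split_ifs <;> simp }
    1 fun u => by
      rw [one_mul]
      refine lp.norm_le_of_forall_sum_le (by norm_num) (norm_nonneg _) fun s => ?_
      simpa using sum_norm_sq_shift_le i k l u s

theorem shiftOp_apply (i : Fin m) (k l : ℕ) (u : Fock m) (a : Occ m) :
    shiftOp i k l u a = if a i = k then u (Function.update a i l) else 0 := rfl

/-- The projection `|C⟩⟨C|` acting on mode `i`, for the core state with coefficients `coef`. -/
def modeProj (c : ℕ) (coef : ℕ → ℂ) (i : Fin m) : Fock m →L[ℂ] Fock m :=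
  ∑ k ∈ Finset.range c, ∑ l ∈ Finset.range c, (coef k * conj (coef l)) • shiftOp i k l

theorem modeProj_apply (c : ℕ) (coef : ℕ → ℂ) (i : Fin m) (u : Fock m) (a : Occ m) :
    modeProj c coef i u a = (if a i < c then coef (a i) else 0)
      * ∑ l ∈ Finset.range c, conj (coef l) * u (Function.update a i l) := by
  have h : modeProj c coef i u a = ∑ k ∈ Finset.range c, ∑ l ∈ Finset.range c,
      coef k * conj (coef l) * (if a i = k then u (Function.update a i l) else 0) := by
    simp only [modeProj, sum_apply, smul_apply,
      lp.coeFn_sum, Finset.sum_apply, lp.coeFn_smul, Pi.smul_apply, smul_eq_mul, shiftOp_apply]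
  rw [h]
  have h2 : ∀ k ∈ Finset.range c, ∑ l ∈ Finset.range c,
      coef k * conj (coef l) * (if a i = k then u (Function.update a i l) else 0)
      = if a i = k then coef (a i) * ∑ l ∈ Finset.range c,
        conj (coef l) * u (Function.update a i l) else 0 := fun k _ => by
    split_ifs with hk
    · rw [hk, Finset.mul_sum]; exact Finset.sum_congr rfl fun l _ => by ring
    · simp
  rw [Finset.sum_congr rfl h2, Finset.sum_ite_eq]
  simp only [Finset.mem_range]
  split_ifs <;> simp

section CoreProjection

variable {c : ℕ} {coef : ℕ → ℂ}

theorem sum_conj_mul_cut (hn : ∑ n ∈ Finset.range c, ‖coef n‖ ^ 2 = 1) :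
    ∑ l ∈ Finset.range c, conj (coef l) * (if l < c then coef l else 0) = 1 := by
  have h : ∀ l ∈ Finset.range c, conj (coef l) * (if l < c then coef l else 0)
      = ((‖coef l‖ ^ 2 : ℝ) : ℂ) := fun l hl => by
    rw [if_pos (Finset.mem_range.1 hl), Complex.conj_mul']; push_cast; rfl
  rw [Finset.sum_congr rfl h, ← Complex.ofReal_sum, hn, Complex.ofReal_one]

theorem modeProj_modeProj (hn : ∑ n ∈ Finset.range c, ‖coef n‖ ^ 2 = 1) (i : Fin m) (u : Fock m) :
    modeProj c coef i (modeProj c coef i u) = modeProj c coef i u := by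
  ext a
  rw [modeProj_apply]
  simp only [modeProj_apply c coef i u, Function.update_self, Function.update_idem, ← mul_assoc]
  rw [← Finset.sum_mul, sum_conj_mul_cut hn, one_mul]

theorem modeProj_comm {c' : ℕ} {coef' : ℕ → ℂ} {i j : Fin m} (hij : i ≠ j) (u : Fock m) :
    modeProj c coef i (modeProj c' coef' j u) = modeProj c' coef' j (modeProj c coef i u) := by
  ext a
  rw [modeProj_apply, modeProj_apply]
  simp only [modeProj_apply, Function.update_of_ne hij, Function.update_of_ne hij.symm,
    Finset.mul_sum]
  rw [Finset.sum_comm]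
  refine Finset.sum_congr rfl fun k _ => Finset.sum_congr rfl fun l _ => ?_
  rw [Function.update_comm hij]
  ring

theorem modeProj_ket (i : Fin m) (a : Occ m) :
    modeProj c coef i (ket a) = conj (if a i < c then coef (a i) else 0)
      • ∑ l ∈ Finset.range c, coef l • ket (Function.update a i l) := by
  ext b
  rw [modeProj_apply]
  simp only [lp.coeFn_smul, lp.coeFn_sum, Pi.smul_apply, Finset.sum_apply, ket_apply, smul_eq_mul]
  by_cases h : b = Function.update a i (b i)
  · have h1 : ∀ l, a = Function.update b i l ↔ a i = l := fun l => by
      constructor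
      · intro h2; rw [h2]; simp
      · rintro rfl; rw [h]; simp
    have h2 : ∀ l, Function.update a i l = b ↔ b i = l := fun l => by
      constructor
      · intro h2; rw [← h2]; simp
      · rintro rfl; exact h.symm
    simp only [h1, h2, mul_ite, mul_one, mul_zero, Finset.sum_ite_eq, Finset.mem_range]
    split_ifs <;> simp [mul_comm]
  · have h1 : ∀ l, a ≠ Function.update b i l := fun l h2 => h (by rw [h2]; simp)
    have h2 : ∀ l, Function.update a i l ≠ b := fun l h2 => h (by rw [← h2]; simp)
    simp [h1, h2]

theorem inner_modeProj (i : Fin m) (u v : Fock m) :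
    ⟪modeProj c coef i u, v⟫_ℂ = ⟪u, modeProj c coef i v⟫_ℂ := by
  have h1 : ∀ a : Occ m, ⟪modeProj c coef i (ket a), v⟫_ℂ = ⟪ket a, modeProj c coef i v⟫_ℂ := by
    intro a
    rw [modeProj_ket, inner_smul_left, sum_inner, inner_ket_left, modeProj_apply, Complex.conj_conj]
    congr 1
    exact Finset.sum_congr rfl fun l _ => by rw [inner_smul_left, inner_ket_left]
  refine denseRange_incl.induction_on
    (p := fun u => ⟪modeProj c coef i u, v⟫_ℂ = ⟪u, modeProj c coef i v⟫_ℂ) u ?_ fun w => ?_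
  · exact isClosed_eq (by fun_prop) (by fun_prop)
  · induction w using Finsupp.induction_linear with
    | zero => simp
    | add f g hf hg => simp only [map_add, inner_add_left, hf, hg]
    | single n d => rw [incl_single, map_smul, inner_smul_left, inner_smul_left, h1]

theorem re_inner_modeProj (hn : ∑ n ∈ Finset.range c, ‖coef n‖ ^ 2 = 1) (i : Fin m) (u : Fock m) :
    (⟪modeProj c coef i u, u⟫_ℂ).re = ‖modeProj c coef i u‖ ^ 2 := by
  rw [← modeProj_modeProj hn, inner_modeProj]
  exact inner_self_eq_norm_sq (𝕜 := ℂ) (modeProj c coef i u) |> fun h => by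
    rw [modeProj_modeProj hn]; exact h

theorem norm_sub_modeProj_sq (hn : ∑ n ∈ Finset.range c, ‖coef n‖ ^ 2 = 1) (i : Fin m)
    (u : Fock m) : ‖u - modeProj c coef i u‖ ^ 2 = ‖u‖ ^ 2 - ‖modeProj c coef i u‖ ^ 2 := by
  have h := re_inner_modeProj hn i u
  rw [@norm_sub_sq ℂ, inner_re_symm]
  have h2 : RCLike.re ⟪modeProj c coef i u, u⟫_ℂ = ‖modeProj c coef i u‖ ^ 2 := h
  rw [h2]; ring

theorem norm_modeProj_le (hn : ∑ n ∈ Finset.range c, ‖coef n‖ ^ 2 = 1) (i : Fin m) (u : Fock m) :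
    ‖modeProj c coef i u‖ ≤ ‖u‖ := by
  have h := norm_sub_modeProj_sq hn i u
  have h2 := sq_nonneg ‖u - modeProj c coef i u‖
  exact (sq_le_sq₀ (norm_nonneg _) (norm_nonneg _)).1 (by linarith)

end CoreProjection

namespace Target

variable (T : Target m)

/-- The projection onto the core state of mode `i` of the target. -/
abbrev proj (i : Fin m) : Fock m →L[ℂ] Fock m := modeProj (T.c i) (T.coef i) i

/-- The product of the core-state projections of a list of modes. -/
def projList : List (Fin m) → Fock m →L[ℂ] Fock m
  | [] => ContinuousLinearMap.id ℂ (Fock m)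
  | i :: L => T.proj i ∘L projList L

theorem proj_projList_comm (i : Fin m) (L : List (Fin m)) (u : Fock m) :
    T.proj i (T.projList L u) = T.projList L (T.proj i u) := by
  induction L with
  | nil => rfl
  | cons j L ih =>
    simp only [projList, ContinuousLinearMap.comp_apply]
    rw [← ih]
    by_cases hij : i = j
    · subst hij; rfl
    · exact modeProj_comm hij _

theorem norm_projList_le (L : List (Fin m)) (u : Fock m) : ‖T.projList L u‖ ≤ ‖u‖ := by
  induction L with
  | nil => exact le_rfl
  | cons i L ih => exact (norm_modeProj_le (T.normalized i) i _).trans ih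

theorem inner_projList (L : List (Fin m)) (u v : Fock m) :
    ⟪T.projList L u, v⟫_ℂ = ⟪u, T.projList L v⟫_ℂ := by
  induction L generalizing u v with
  | nil => rfl
  | cons i L ih =>
    simp only [projList, ContinuousLinearMap.comp_apply]
    rw [inner_modeProj, ih, ← proj_projList_comm]

/-- A union bound for commuting projections. -/
theorem norm_sq_sub_projList_le (L : List (Fin m)) (u : Fock m) :
    ‖u‖ ^ 2 - ‖T.projList L u‖ ^ 2 ≤ (L.map fun i => ‖u‖ ^ 2 - ‖T.proj i u‖ ^ 2).sum := by
  induction L with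
  | nil => simp [projList]
  | cons i L ih =>
    rw [List.map_cons, List.sum_cons]
    simp only [projList, ContinuousLinearMap.comp_apply]
    have h1 := norm_sub_modeProj_sq (T.normalized i) i (T.projList L u)
    have h2 := norm_sub_modeProj_sq (T.normalized i) i u
    have h3 : T.projList L u - T.proj i (T.projList L u) = T.projList L (u - T.proj i u) := by
      rw [map_sub, proj_projList_comm]
    have h4 := T.norm_projList_le L (u - T.proj i u)
    rw [← h3] at h4
    have h5 := pow_le_pow_left₀ (norm_nonneg _) h4 2
    linarith

theorem proj_projList_of_mem {i : Fin m} {L : List (Fin m)} (hi : i ∈ L) (u : Fock m) :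
    T.proj i (T.projList L u) = T.projList L u := by
  induction L with
  | nil => simp at hi
  | cons j L ih =>
    simp only [projList, ContinuousLinearMap.comp_apply]
    by_cases hij : i = j
    · subst hij; exact modeProj_modeProj (T.normalized i) i _
    · rw [proj, proj, modeProj_comm hij]
      rw [← proj, ← proj, ih ((List.mem_cons.1 hi).resolve_left hij)]

theorem coreProduct_apply (a : Occ m) :
    T.coreProduct a = ∏ i, if a i < T.c i then T.coef i (a i) else 0 := by
  rw [coreProduct]
  simp only [lp.coeFn_sum, Finset.sum_apply, lp.coeFn_smul, Pi.smul_apply, ket_apply, smul_eq_mul,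
    mul_ite, mul_one, mul_zero]
  rw [Finset.sum_ite_eq']
  simp only [Fintype.mem_piFinset, Finset.mem_range]
  split_ifs with h
  · exact Finset.prod_congr rfl fun i _ => by rw [if_pos (h i)]
  · push Not at h
    obtain ⟨i, hi⟩ := h
    exact (Finset.prod_eq_zero (Finset.mem_univ i) (by rw [if_neg (by omega)])).symm

theorem proj_coreProduct (i : Fin m) : T.proj i T.coreProduct = T.coreProduct := by
  ext a
  rw [modeProj_apply]
  simp only [coreProduct_apply]
  have h : ∀ l, ∏ j, (if Function.update a i l j < T.c j
        then T.coef j (Function.update a i l j) else 0)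
      = (if l < T.c i then T.coef i l else 0)
        * ∏ j ∈ Finset.univ.erase i, (if a j < T.c j then T.coef j (a j) else 0) := fun l => by
    rw [← Finset.mul_prod_erase _ _ (Finset.mem_univ i), Function.update_self]
    congr 1
    exact Finset.prod_congr rfl fun j hj => by
      rw [Function.update_of_ne (Finset.ne_of_mem_erase hj)]
  simp only [h, ← mul_assoc]
  rw [← Finset.sum_mul, sum_conj_mul_cut (T.normalized i), one_mul,
    Finset.mul_prod_erase _ (fun j => if a j < T.c j then T.coef j (a j) else 0)
      (Finset.mem_univ i)]

theorem norm_coreProduct : ‖T.coreProduct‖ = 1 := by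
  have h : ‖T.coreProduct‖ ^ 2 = 1 := by
    have h1 := hasSum_norm_sq T.coreProduct
    have h2 : ∀ a : Occ m, a ∉ Fintype.piFinset (fun i => Finset.range (T.c i)) →
        ‖T.coreProduct a‖ ^ 2 = 0 := fun a ha => by
      simp only [Fintype.mem_piFinset, Finset.mem_range] at ha
      push Not at ha
      obtain ⟨i, hi⟩ := ha
      rw [coreProduct_apply, Finset.prod_eq_zero (Finset.mem_univ i) (by rw [if_neg (by omega)])]
      simp
    rw [h1.unique (hasSum_sum_of_ne_finset_zero h2)]
    have h3 : ∀ a ∈ Fintype.piFinset (fun i => Finset.range (T.c i)), ‖T.coreProduct a‖ ^ 2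
        = ∏ i, ‖T.coef i (a i)‖ ^ 2 := fun a ha => by
      simp only [Fintype.mem_piFinset, Finset.mem_range] at ha
      rw [coreProduct_apply, norm_prod, ← Finset.prod_pow]
      exact Finset.prod_congr rfl fun i _ => by rw [if_pos (ha i)]
    rw [Finset.sum_congr rfl h3, ← Finset.prod_univ_sum (fun i => Finset.range (T.c i))
      fun i n => ‖T.coef i n‖ ^ 2]
    exact Finset.prod_eq_one fun i _ => T.normalized i
  exact (pow_eq_one_iff_of_nonneg (norm_nonneg _) two_ne_zero).1 h

/-- The core-state projections of all the modes together project onto the product of the core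
states: peeling off one mode at a time, a common fixed vector factorises. -/
theorem exists_eq_smul_coreProduct {v : Fock m} (hv : ∀ i, T.proj i v = v) :
    ∃ μ : ℂ, v = μ • T.coreProduct := by
  have key : ∀ s : Finset (Fin m), ∃ w : Occ m → ℂ,
      (∀ a, v a = (∏ i ∈ s, if a i < T.c i then T.coef i (a i) else 0) * w a) ∧
      ∀ i ∈ s, ∀ a l, w (Function.update a i l) = w a := by
    intro s
    induction s using Finset.induction_on with
    | empty => exact ⟨v, by simp, by simp⟩
    | insert j s hj ih =>
      obtain ⟨w, hw, hw'⟩ := ih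
      refine ⟨fun a => ∑ l ∈ Finset.range (T.c j), conj (T.coef j l) * w (Function.update a j l),
        fun a => ?_, fun i hi a l => ?_⟩
      · have h1 : v a = T.proj j v a := by rw [hv]
        rw [h1, modeProj_apply, Finset.prod_insert hj, mul_assoc]
        congr 1
        rw [Finset.mul_sum]
        refine Finset.sum_congr rfl fun l _ => ?_
        rw [hw]
        have h2 : ∏ i ∈ s, (if Function.update a j l i < T.c i
              then T.coef i (Function.update a j l i) else 0)
            = ∏ i ∈ s, if a i < T.c i then T.coef i (a i) else 0 := by
          refine Finset.prod_congr rfl fun i hi => ?_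
          have hij : i ≠ j := by rintro rfl; exact hj hi
          rw [Function.update_of_ne hij]
        rw [h2]; ring
      · refine Finset.sum_congr rfl fun k _ => ?_
        by_cases hij : i = j
        · subst hij; rw [Function.update_idem]
        · rw [Function.update_comm hij,
            hw' i ((Finset.mem_insert.1 hi).resolve_left hij)]
  obtain ⟨w, hw, hw'⟩ := key Finset.univ
  have hconst : ∀ a, w a = w 0 := by
    intro a
    have h1 : ∀ s : Finset (Fin m), w (fun i => if i ∈ s then a i else 0) = w 0 := by
      intro s
      induction s using Finset.induction_on with
      | empty => simp; rfl
      | insert j s hj ih =>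
        rw [← ih, ← hw' j (Finset.mem_univ j) (fun i => if i ∈ s then a i else 0) (a j)]
        congr 1
        funext i
        by_cases hij : i = j
        · subst hij; simp
        · simp [hij]
    simpa using h1 Finset.univ
  refine ⟨w 0, ?_⟩
  ext a
  rw [hw a, hconst, lp.coeFn_smul, Pi.smul_apply, coreProduct_apply, smul_eq_mul, mul_comm]

/-- The fidelity with a product of core states is at least one minus the sum of the infidelities
of the single modes. -/
theorem norm_sq_sub_inner_coreProduct_le (u : Fock m) :
    ‖u‖ ^ 2 - ‖⟪T.coreProduct, u⟫_ℂ‖ ^ 2 ≤ ∑ i, (‖u‖ ^ 2 - ‖T.proj i u‖ ^ 2) := by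
  set L := List.finRange m with hL
  have hfix : ∀ i, T.proj i (T.projList L u) = T.projList L u := fun i =>
    T.proj_projList_of_mem (List.mem_finRange i) u
  obtain ⟨μ, hμ⟩ := T.exists_eq_smul_coreProduct hfix
  have hcore : ∀ L, T.projList L T.coreProduct = T.coreProduct := by
    intro L
    induction L with
    | nil => rfl
    | cons i L ih =>
      simp only [projList, ContinuousLinearMap.comp_apply]
      rw [ih, proj_coreProduct]
  have h1 : ‖⟪T.coreProduct, u⟫_ℂ‖ = ‖T.projList L u‖ := by
    rw [← hcore L, inner_projList, hμ, inner_smul_right, inner_self_eq_norm_sq_to_K,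
      norm_coreProduct, norm_smul, norm_coreProduct]
    simp
  have h2 := T.norm_sq_sub_projList_le L u
  rw [h1]
  refine h2.trans (le_of_eq ?_)
  rw [hL, ← List.ofFn_eq_map, List.sum_ofFn]

theorem norm_inner_coreProduct_le (i : Fin m) (u : Fock m) :
    ‖⟪T.coreProduct, u⟫_ℂ‖ ≤ ‖T.proj i u‖ := by
  rw [← T.proj_coreProduct i, inner_modeProj]
  refine (norm_inner_le_norm _ _).trans ?_
  rw [norm_coreProduct, one_mul]

end Target

/-! ### Bias of the estimator -/

theorem abs_alternating_sum_choose {p J : ℕ} (hp : 1 ≤ p) (hJ : 1 ≤ J) :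
    |∑ j ∈ Finset.range p, (-1 : ℝ) ^ j * (J.choose j : ℝ)| = ((J - 1).choose (p - 1) : ℝ) := by
  obtain ⟨q, rfl⟩ : ∃ q, p = q + 1 := ⟨p - 1, by omega⟩
  obtain ⟨n, rfl⟩ : ∃ n, J = n + 1 := ⟨J - 1, by omega⟩
  have h : ∑ j ∈ Finset.range (q + 1), (-1 : ℝ) ^ j * ((n + 1).choose j : ℝ)
      = (-1) ^ q * (n.choose q : ℝ) := by
    exact_mod_cast Int.alternating_sum_range_choose_eq_choose (n := n) (m := q)
  rw [h, abs_mul, abs_pow, abs_neg, abs_one, one_pow, one_mul, Nat.add_sub_cancel,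
    Nat.add_sub_cancel, Nat.abs_cast]

/-- For `η` up to the threshold `(p+1)/(p(p+c))`, the weights of the contributions of index shift
`J ≥ p` do not increase with `J`: the bound `η (c+J) J / ((J+1) (J-p+1))` on the ratio of
consecutive weights is largest at `J = p`, where the threshold makes it at most one. -/
theorem weight_le {c p k l : ℕ} (hp : 1 ≤ p) (hk : k < c) (hl : l < c) {η : ℝ} (hη : 0 < η)
    (hη1 : η ≤ ((p : ℝ) + 1) / ((p : ℝ) * ((p : ℝ) + c))) {J : ℕ} (hJ : p ≤ J) :
    η ^ J * Real.sqrt (((k + J).choose k : ℝ) * ((l + J).choose l : ℝ))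
        * ((J - 1).choose (p - 1) : ℝ)
      ≤ η ^ p * Real.sqrt (((k + p).choose k : ℝ) * ((l + p).choose l : ℝ)) := by
  induction J, hJ using Nat.le_induction with
  | base => simp
  | succ J hJ ih =>
    refine le_trans ?_ ih
    have hstep : ∀ n, n < c → ((n + (J + 1)).choose n : ℝ)
        ≤ ((n + J).choose n : ℝ) * (((c : ℝ) + J) / (J + 1)) := by
      intro n hn
      have h1 : (n + (J + 1)).choose n * (J + 1) = (n + J).choose n * (n + J + 1) := by
        have := Nat.choose_mul_succ_eq (n + J) n
        rw [show n + J + 1 - n = J + 1 by omega] at this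
        rw [← add_assoc]; exact this.symm
      have h2 : ((n + (J + 1)).choose n : ℝ) * ((J : ℝ) + 1)
          = ((n + J).choose n : ℝ) * ((n : ℝ) + J + 1) := by exact_mod_cast h1
      rw [← mul_div_assoc, le_div_iff₀ (by positivity), h2]
      have h3 : (n : ℝ) + 1 ≤ c := by exact_mod_cast hn
      exact mul_le_mul_of_nonneg_left (by linarith) (by positivity)
    have hsqrt : Real.sqrt (((k + (J + 1)).choose k : ℝ) * ((l + (J + 1)).choose l : ℝ))
        ≤ Real.sqrt (((k + J).choose k : ℝ) * ((l + J).choose l : ℝ))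
          * (((c : ℝ) + J) / (J + 1)) := by
      rw [Real.sqrt_le_left (by positivity), mul_pow, Real.sq_sqrt (by positivity)]
      calc _ ≤ (((k + J).choose k : ℝ) * (((c : ℝ) + J) / (J + 1)))
            * (((l + J).choose l : ℝ) * (((c : ℝ) + J) / (J + 1))) :=
            mul_le_mul (hstep k hk) (hstep l hl) (by positivity) (by positivity)
        _ = _ := by ring
    have hch : (((J + 1 - 1).choose (p - 1) : ℕ) : ℝ) * ((J : ℝ) - p + 1)
        = ((J - 1).choose (p - 1) : ℝ) * J := by
      have h1 := Nat.choose_mul_succ_eq (J - 1) (p - 1)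
      rw [Nat.sub_add_cancel (by omega : 1 ≤ J), show J - (p - 1) = J - p + 1 by omega] at h1
      rw [Nat.add_sub_cancel, ← Nat.cast_sub hJ]
      exact_mod_cast h1.symm
    have hJp : (0 : ℝ) < (J : ℝ) - p + 1 := by
      have : (p : ℝ) ≤ J := by exact_mod_cast hJ
      linarith
    have hch' : (((J + 1 - 1).choose (p - 1) : ℕ) : ℝ)
        = ((J - 1).choose (p - 1) : ℝ) * (J / ((J : ℝ) - p + 1)) := by
      rw [← mul_div_assoc, eq_div_iff hJp.ne', hch]
    have hratio : η * ((((c : ℝ) + J) / (J + 1)) * (J / ((J : ℝ) - p + 1))) ≤ 1 := by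
      obtain ⟨t, rfl⟩ : ∃ t, J = p + t := ⟨J - p, by omega⟩
      obtain ⟨q, rfl⟩ : ∃ q, p = q + 1 := ⟨p - 1, by omega⟩
      obtain ⟨d, rfl⟩ : ∃ d, c = d + 1 := ⟨c - 1, by omega⟩
      push_cast at hη1 hJp ⊢
      rw [div_mul_div_comm]
      have hpos : (0 : ℝ) < ((q : ℝ) + 1 + t + 1) * ((q : ℝ) + 1 + t - (q + 1) + 1) := by positivity
      rw [← mul_div_assoc, div_le_one hpos]
      have hη2 : η * (((q : ℝ) + 1) * ((q : ℝ) + 1 + (d + 1))) ≤ (q : ℝ) + 1 + 1 := by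
        rwa [le_div_iff₀ (by positivity)] at hη1
      have hpoly : ((q : ℝ) + 1 + 1) * (((d : ℝ) + 1 + (q + 1 + t)) * ((q : ℝ) + 1 + t))
          ≤ (((q : ℝ) + 1) * ((q : ℝ) + 1 + (d + 1)))
            * (((q : ℝ) + 1 + t + 1) * ((q : ℝ) + 1 + t - (q + 1) + 1)) := by
        rw [← sub_nonneg]
        have e : (((q : ℝ) + 1) * ((q : ℝ) + 1 + (d + 1)))
            * (((q : ℝ) + 1 + t + 1) * ((q : ℝ) + 1 + t - (q + 1) + 1))
            - ((q : ℝ) + 1 + 1) * (((d : ℝ) + 1 + (q + 1 + t)) * ((q : ℝ) + 1 + t))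
            = t * (q ^ 3 + q ^ 2 * d + 4 * q ^ 2 + 3 * q * d + 4 * q + d)
              + t ^ 2 * (q ^ 2 + q * d + 2 * q + d) := by ring
        rw [e]; positivity
      have hP : (0 : ℝ) < ((q : ℝ) + 1) * ((q : ℝ) + 1 + (d + 1)) := by positivity
      have hX : (0 : ℝ) ≤ ((d : ℝ) + 1 + (q + 1 + t)) * ((q : ℝ) + 1 + t) := by positivity
      refine le_of_mul_le_mul_left ?_ hP
      calc _ = η * (((q : ℝ) + 1) * ((q : ℝ) + 1 + (d + 1)))
            * (((d : ℝ) + 1 + (q + 1 + t)) * ((q : ℝ) + 1 + t)) := by ring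
        _ ≤ ((q : ℝ) + 1 + 1) * (((d : ℝ) + 1 + (q + 1 + t)) * ((q : ℝ) + 1 + t)) :=
            mul_le_mul_of_nonneg_right hη2 hX
        _ ≤ _ := hpoly
    rw [hch']
    have hX : 0 ≤ Real.sqrt (((k + J).choose k : ℝ) * ((l + J).choose l : ℝ)) := Real.sqrt_nonneg _
    have hC : (0 : ℝ) ≤ ((J - 1).choose (p - 1) : ℝ) * (J / ((J : ℝ) - p + 1)) := by positivity
    calc _ ≤ η ^ (J + 1) * (Real.sqrt (((k + J).choose k : ℝ) * ((l + J).choose l : ℝ))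
          * (((c : ℝ) + J) / (J + 1)))
          * (((J - 1).choose (p - 1) : ℝ) * (J / ((J : ℝ) - p + 1))) := by
          gcongr
      _ = (η ^ J * Real.sqrt (((k + J).choose k : ℝ) * ((l + J).choose l : ℝ))
          * ((J - 1).choose (p - 1) : ℝ))
          * (η * ((((c : ℝ) + J) / (J + 1)) * (J / ((J : ℝ) - p + 1)))) := by ring
      _ ≤ _ := mul_le_of_le_one_right (by positivity) hratio

/-- The coefficient of index shift `s - k` in the expectation of `g_{k,l}^{(p)}`. -/
def shiftWeight (p k l : ℕ) (η : ℝ) (s : ℕ) : ℝ :=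
  η ^ (s - k) * Real.sqrt ((s.choose k : ℝ) * ((s - k + l).choose l : ℝ))
    * ∑ j ∈ Finset.range p, (-1 : ℝ) ^ j * ((s - k).choose j : ℝ)

theorem shiftWeight_self {p : ℕ} (hp : 1 ≤ p) (k l : ℕ) (η : ℝ) : shiftWeight p k l η k = 1 := by
  have h : ∑ j ∈ Finset.range p, (-1 : ℝ) ^ j * ((0 : ℕ).choose j : ℝ) = 1 := by
    obtain ⟨q, rfl⟩ : ∃ q, p = q + 1 := ⟨p - 1, by omega⟩
    rw [Finset.sum_range_succ']
    simp
  simp [shiftWeight, h]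

theorem abs_shiftWeight_le {c p k l : ℕ} (hp : 1 ≤ p) (hk : k < c) (hl : l < c) {η : ℝ}
    (hη : 0 < η) (hη1 : η ≤ ((p : ℝ) + 1) / ((p : ℝ) * ((p : ℝ) + c))) {s : ℕ} (hs : k < s) :
    |shiftWeight p k l η s|
      ≤ η ^ p * (Real.sqrt ((k + p).choose k : ℝ) * Real.sqrt ((l + p).choose l : ℝ)) := by
  obtain ⟨J, rfl⟩ : ∃ J, s = k + J := ⟨s - k, by omega⟩
  rw [shiftWeight, abs_mul, Nat.add_sub_cancel_left, abs_alternating_sum_choose hp (by omega),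
    abs_of_nonneg (by positivity), add_comm J l, ← Real.sqrt_mul (by positivity)]
  by_cases hJ : p ≤ J
  · exact weight_le hp hk hl hη hη1 hJ
  · rw [Nat.choose_eq_zero_of_lt (by omega : J - 1 < p - 1)]
    simp only [Nat.cast_zero, mul_zero]
    positivity

theorem incl_apply (v : Fin0 m) (a : Occ m) : incl m v a = v a := by
  induction v using Finsupp.induction_linear with
  | zero => simp
  | add f g hf hg => simp [hf, hg]
  | single n c =>
    rw [incl_single, lp.coeFn_smul, Pi.smul_apply, ket_apply, Finsupp.single_apply]
    split_ifs <;> simp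

theorem hetAmp_incl (v : Fin0 m) (α : Fin m → ℂ) :
    hetAmp (incl m v) α = ∑ a ∈ v.support, v a * hetAmp (ket a) α := by
  have h := hasSum_hetAmp (incl m v) α
  simp only [incl_apply] at h
  refine h.unique (hasSum_sum_of_ne_finset_zero fun a ha => ?_)
  rw [Finsupp.notMem_support_iff.1 ha, zero_mul]

/-- Expectation of `g_{k,l}^{(p)}` of the outcome of mode `i` in a finite combination of Fock
states. -/
theorem integral_gEst_hetAmp_incl (i : Fin m) (p k l : ℕ) {η : ℝ} (hη : 0 < η) (v : Fin0 m) :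
    Integrable (fun α => gEst p k l (α i) η
      * (hetAmp (incl m v) α * conj (hetAmp (incl m v) α))) ∧
    ∫ α, gEst p k l (α i) η * (hetAmp (incl m v) α * conj (hetAmp (incl m v) α))
      = ∑ a ∈ v.support, if k ≤ a i then (shiftWeight p k l η (a i) : ℂ)
          * (v a * conj (v (Function.update a i (a i - k + l)))) else 0 := by
  have h1 : ∀ α : Fin m → ℂ, gEst p k l (α i) η
      * (hetAmp (incl m v) α * conj (hetAmp (incl m v) α))
      = ∑ a ∈ v.support, ∑ b ∈ v.support, (v a * conj (v b))
        * (gEst p k l (α i) η * (hetAmp (ket a) α * conj (hetAmp (ket b) α))) := fun α => by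
    rw [hetAmp_incl, map_sum, Finset.sum_mul_sum, Finset.mul_sum]
    refine Finset.sum_congr rfl fun a _ => ?_
    rw [Finset.mul_sum]
    refine Finset.sum_congr rfl fun b _ => ?_
    rw [map_mul]; ring
  have h2 := fun a b : Occ m => integral_mode_mul_hetAmp_ket i (fun z => gEst p k l z η) a b
    (integral_gEst_mul_gaussMono p k l (a i) (b i) hη).1
  simp only [h1]
  refine ⟨integrable_finsetSum _ fun a _ => integrable_finsetSum _ fun b _ =>
    (h2 a b).1.const_mul _, ?_⟩
  rw [integral_finsetSum _ fun a _ => integrable_finsetSum _ fun b _ => (h2 a b).1.const_mul _]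
  refine Finset.sum_congr rfl fun a _ => ?_
  rw [integral_finsetSum _ fun b _ => (h2 a b).1.const_mul _]
  have h3 : ∀ b ∈ v.support, ∫ α, (v a * conj (v b))
        * (gEst p k l (α i) η * (hetAmp (ket a) α * conj (hetAmp (ket b) α)))
      = if Function.update a i (a i - k + l) = b then
          (if k ≤ a i then (shiftWeight p k l η (a i) : ℂ) * (v a * conj (v b)) else 0)
        else 0 := fun b _ => by
    rw [integral_const_mul, (h2 a b).2, (integral_gEst_mul_gaussMono p k l (a i) (b i) hη).2]
    by_cases hb : b = Function.update a i (b i)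
    · by_cases hk : k ≤ a i ∧ b i = a i - k + l
      · have hb2 : Function.update a i (a i - k + l) = b := by rw [← hk.2, ← hb]
        have hne : ((Real.pi * Real.sqrt ((a i).factorial * (b i).factorial) : ℝ) : ℂ) ≠ 0 := by
          exact_mod_cast (mul_pos Real.pi_pos (Real.sqrt_pos.2 (by positivity))).ne'
        rw [if_pos hb, if_pos hk, if_pos hb2, if_pos hk.1, shiftWeight, ← hk.2,
          Complex.ofReal_mul (Real.pi * _), inv_mul_cancel_left₀ hne]
        ring
      · rw [if_pos hb, if_neg hk, mul_zero, mul_zero]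
        split_ifs with h4 h5
        · exact absurd ⟨h5, by rw [← h4]; simp⟩ hk
        · rfl
        · rfl
    · rw [if_neg hb, mul_zero, if_neg]
      rintro rfl
      simp at hb
  rw [Finset.sum_congr rfl h3, Finset.sum_ite_eq]
  by_cases h4 : Function.update a i (a i - k + l) ∈ v.support
  · rw [if_pos h4]
  · rw [if_neg h4, Finsupp.notMem_support_iff.1 h4]
    simp

theorem inner_shiftOp_incl (i : Fin m) (k l : ℕ) (v : Fin0 m) :
    ⟪shiftOp i k l (incl m v), incl m v⟫_ℂ
      = ∑ a ∈ v.support, if a i = k then v a * conj (v (Function.update a i l)) else 0 := by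
  have h := lp.hasSum_inner (𝕜 := ℂ) (shiftOp i k l (incl m v)) (incl m v)
  refine h.unique ?_
  have h2 : ∀ a : Occ m, ⟪shiftOp i k l (incl m v) a, incl m v a⟫_ℂ
      = if a i = k then v a * conj (v (Function.update a i l)) else 0 := fun a => by
    rw [shiftOp_apply, RCLike.inner_apply, incl_apply, incl_apply]
    split_ifs <;> simp
  simp only [h2]
  refine hasSum_sum_of_ne_finset_zero fun a ha => ?_
  rw [Finsupp.notMem_support_iff.1 ha]
  simp

theorem norm_integral_gEst_sub_le {c p k l : ℕ} (hp : 1 ≤ p) (hk : k < c) (hl : l < c) {η : ℝ}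
    (hη : 0 < η) (hη1 : η ≤ ((p : ℝ) + 1) / ((p : ℝ) * ((p : ℝ) + c))) (i : Fin m) (v : Fin0 m) :
    ‖(∫ α, gEst p k l (α i) η * (hetAmp (incl m v) α * conj (hetAmp (incl m v) α)))
      - ⟪shiftOp i k l (incl m v), incl m v⟫_ℂ‖
      ≤ η ^ p * (Real.sqrt ((k + p).choose k : ℝ) * Real.sqrt ((l + p).choose l : ℝ))
        * ‖incl m v‖ ^ 2 := by
  set X := η ^ p * (Real.sqrt ((k + p).choose k : ℝ) * Real.sqrt ((l + p).choose l : ℝ)) with hX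
  have hX0 : 0 ≤ X := by positivity
  set φ : Occ m → Occ m := fun a => Function.update a i (a i - k + l) with hφ
  rw [(integral_gEst_hetAmp_incl i p k l hη v).2, inner_shiftOp_incl, ← Finset.sum_sub_distrib]
  have h1 : ∀ a ∈ v.support, ‖(if k ≤ a i then (shiftWeight p k l η (a i) : ℂ)
          * (v a * conj (v (Function.update a i (a i - k + l)))) else 0)
        - (if a i = k then v a * conj (v (Function.update a i l)) else 0)‖
      ≤ X / 2 * ‖incl m v a‖ ^ 2 + if k < a i then X / 2 * ‖incl m v (φ a)‖ ^ 2 else 0 := by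
    intro a _
    rw [incl_apply, incl_apply]
    rcases lt_trichotomy (a i) k with h | h | h
    · rw [if_neg (by omega), if_neg (by omega), if_neg (by omega), sub_zero, norm_zero]
      positivity
    · rw [if_pos h.ge, if_pos h, if_neg (by omega), h, shiftWeight_self hp, Nat.sub_self, zero_add,
        Complex.ofReal_one, one_mul, sub_self, norm_zero]
      positivity
    · rw [if_pos h.le, if_neg (by omega), if_pos h, sub_zero, norm_mul, norm_mul, RCLike.norm_conj,
        Complex.norm_real, Real.norm_eq_abs]
      have h2 := abs_shiftWeight_le hp hk hl hη hη1 h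
      have h3 : ‖v a‖ * ‖v (φ a)‖ ≤ (‖v a‖ ^ 2 + ‖v (φ a)‖ ^ 2) / 2 := by
        nlinarith [sq_nonneg (‖v a‖ - ‖v (φ a)‖)]
      calc _ ≤ X * ((‖v a‖ ^ 2 + ‖v (φ a)‖ ^ 2) / 2) := by
            exact mul_le_mul h2 h3 (by positivity) hX0
        _ = _ := by ring
  refine (norm_sum_le_of_le _ h1).trans ?_
  rw [Finset.sum_add_distrib, ← Finset.mul_sum, ← Finset.sum_filter, ← Finset.mul_sum]
  have h2 : ∑ a ∈ v.support, ‖incl m v a‖ ^ 2 ≤ ‖incl m v‖ ^ 2 :=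
    sum_le_hasSum _ (fun _ _ => by positivity) (hasSum_norm_sq _)
  have h3 : ∑ a ∈ v.support.filter (fun a => k < a i), ‖incl m v (φ a)‖ ^ 2 ≤ ‖incl m v‖ ^ 2 := by
    refine sum_norm_sq_comp_le _ _ φ ?_
    intro a ha b hb h
    simp only [Finset.coe_filter, Set.mem_ofPred_eq] at ha hb
    funext j
    by_cases hj : j = i
    · subst hj
      have h4 := congrFun h j
      simp only [hφ, Function.update_self] at h4
      omega
    · have := congrFun h j
      simpa [hφ, Function.update_of_ne hj] using this
  nlinarith [mul_le_mul_of_nonneg_left h2 hX0, mul_le_mul_of_nonneg_left h3 hX0]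

/-- The expectation of `g_C^{(p)}` of the outcome of mode `i` differs from the fidelity of that mode
with the core state `|C⟩` by at most `A η^p`. -/
theorem norm_integral_gCoreC_sub_le {c p : ℕ} (hp : 1 ≤ p) (coef : ℕ → ℂ) {η : ℝ}
    (hη : 0 < η) (hη1 : η ≤ ((p : ℝ) + 1) / ((p : ℝ) * ((p : ℝ) + c))) (i : Fin m) (u : Fock m) :
    ‖(∫ α, gCoreC p c coef (α i) η * (hetAmp u α * conj (hetAmp u α)))
      - ⟪modeProj c coef i u, u⟫_ℂ‖ ≤ constA p c coef * η ^ p * ‖u‖ ^ 2 := by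
  have hg : Continuous fun α : Fin m → ℂ => gCoreC p c coef (α i) η :=
    (continuous_gCoreC p c coef η).comp (continuous_apply i)
  have hcont := continuous_integral_mul_norm_hetAmp_sq hg
    fun α => norm_gCoreC_le hp coef hη hη1 (α i)
  refine denseRange_incl.induction_on (p := fun u =>
    ‖(∫ α, gCoreC p c coef (α i) η * (hetAmp u α * conj (hetAmp u α)))
      - ⟪modeProj c coef i u, u⟫_ℂ‖ ≤ constA p c coef * η ^ p * ‖u‖ ^ 2) u ?_ fun v => ?_
  · exact isClosed_le (hcont.sub (by fun_prop)).norm (by fun_prop)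
  have h1 : ∫ α, gCoreC p c coef (α i) η * (hetAmp (incl m v) α * conj (hetAmp (incl m v) α))
      = ∑ k ∈ Finset.range c, ∑ l ∈ Finset.range c, conj (coef k) * coef l
        * ∫ α, gEst p k l (α i) η * (hetAmp (incl m v) α * conj (hetAmp (incl m v) α)) := by
    have h2 : ∀ k l, Integrable fun α : Fin m → ℂ => conj (coef k) * coef l
        * (gEst p k l (α i) η * (hetAmp (incl m v) α * conj (hetAmp (incl m v) α))) :=
      fun k l => (integral_gEst_hetAmp_incl i p k l hη v).1.const_mul _
    simp only [gCoreC, Finset.sum_mul]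
    simp only [mul_assoc] at h2 ⊢
    rw [integral_finsetSum _ fun k _ => integrable_finsetSum _ fun l _ => h2 k l]
    refine Finset.sum_congr rfl fun k _ => ?_
    rw [integral_finsetSum _ fun l _ => h2 k l]
    refine Finset.sum_congr rfl fun l _ => ?_
    rw [integral_const_mul, integral_const_mul]
  have h3 : ⟪modeProj c coef i (incl m v), incl m v⟫_ℂ
      = ∑ k ∈ Finset.range c, ∑ l ∈ Finset.range c, conj (coef k) * coef l
        * ⟪shiftOp i k l (incl m v), incl m v⟫_ℂ := by
    simp only [modeProj, sum_apply, smul_apply, sum_inner, inner_smul_left, map_mul,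
      Complex.conj_conj]
  rw [h1, h3, ← Finset.sum_sub_distrib]
  simp only [← Finset.sum_sub_distrib, ← mul_sub]
  have h4 : constA p c coef * η ^ p * ‖incl m v‖ ^ 2
      = ∑ k ∈ Finset.range c, ∑ l ∈ Finset.range c, ‖coef k‖ * ‖coef l‖
        * (η ^ p * (Real.sqrt ((k + p).choose k : ℝ) * Real.sqrt ((l + p).choose l : ℝ))
        * ‖incl m v‖ ^ 2) := by
    rw [constA, sq, Finset.sum_mul_sum, Finset.sum_mul, Finset.sum_mul]
    refine Finset.sum_congr rfl fun k _ => ?_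
    rw [Finset.sum_mul, Finset.sum_mul]
    exact Finset.sum_congr rfl fun l _ => by ring
  rw [h4]
  refine norm_sum_le_of_le _ fun k hk => norm_sum_le_of_le _ fun l hl => ?_
  rw [norm_mul, norm_mul, RCLike.norm_conj]
  exact mul_le_mul_of_nonneg_left (norm_integral_gEst_sub_le hp (Finset.mem_range.1 hk)
    (Finset.mem_range.1 hl) hη hη1 i v) (by positivity)

/-! ### Density operators and fidelities of several copies -/

/-- A positive operator has the form `x† x`. -/
theorem exists_inner_eq_of_isPositive {H : Type*} [NormedAddCommGroup H] [InnerProductSpace ℂ H]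
    [CompleteSpace H] {ρ : H →L[ℂ] H} (hρ : ρ.IsPositive) :
    ∃ x : H →L[ℂ] H, ∀ φ ψ, ⟪φ, ρ ψ⟫_ℂ = ⟪x φ, x ψ⟫_ℂ := by
  obtain ⟨x, hx⟩ := CStarAlgebra.nonneg_iff_eq_star_mul_self.1
    ((ContinuousLinearMap.nonneg_iff_isPositive ρ).2 hρ)
  exact ⟨x, fun φ ψ => by
    rw [hx, ContinuousLinearMap.star_eq_adjoint, mul_apply_eq_comp,
      ContinuousLinearMap.adjoint_inner_right]⟩

theorem IsDensity.exists_inner_eq {ρ : Fock m →L[ℂ] Fock m} (hρ : IsDensity ρ) :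
    ∃ x : Fock m →L[ℂ] Fock m, HasSum (fun n => ‖x (ket n)‖ ^ 2) 1 ∧
      ∀ φ ψ, ⟪φ, ρ ψ⟫_ℂ = ⟪x φ, x ψ⟫_ℂ := by
  obtain ⟨x, h⟩ := exists_inner_eq_of_isPositive hρ.pos
  refine ⟨x, ?_, h⟩
  have h1 := Complex.hasSum_re hρ.trace_one
  simp only [h, Complex.one_re] at h1
  exact h1.congr_fun fun n => (inner_self_eq_norm_sq (𝕜 := ℂ) (x (ket n))).symm

/-- A density operator is a mixture `∑ |uₙ⟩⟨uₙ|` with `∑ ‖uₙ‖² = 1`. -/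
theorem IsDensity.exists_mixture {ρ : Fock m →L[ℂ] Fock m} (hρ : IsDensity ρ) :
    ∃ u : Occ m → Fock m, HasSum (fun n => ‖u n‖ ^ 2) 1 ∧
      ∀ φ, HasSum (fun n => ‖⟪u n, φ⟫_ℂ‖ ^ 2) (⟪φ, ρ φ⟫_ℂ).re := by
  obtain ⟨x, hx, h⟩ := hρ.exists_inner_eq
  refine ⟨fun n => ContinuousLinearMap.adjoint x (ket n), ?_, fun φ => ?_⟩
  · -- the Hilbert-Schmidt norms of `x` and of its adjoint agree
    have ht : ∀ a : Occ m, HasSum (fun b => ‖x (ket a) b‖ ^ 2) (‖x (ket a)‖ ^ 2) := fun a =>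
      hasSum_norm_sq _
    have hs : Summable fun q : Occ m × Occ m => ‖x (ket q.1) q.2‖ ^ 2 := by
      refine (summable_prod_of_nonneg fun _ => by positivity).2
        ⟨fun a => (ht a).summable, hx.summable.congr fun a => (ht a).tsum_eq.symm⟩
    have h1 := hs.hasSum.prod_fiberwise ht
    have h2 := hs.hasSum
    rw [h1.unique hx, ← (Equiv.prodComm (Occ m) (Occ m)).hasSum_iff] at h2
    refine h2.prod_fiberwise fun b => ?_
    have h3 : ∀ a, ‖x (ket a) b‖ ^ 2 = ‖ContinuousLinearMap.adjoint x (ket b) a‖ ^ 2 := fun a => by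
      rw [← inner_ket_left a, ContinuousLinearMap.adjoint_inner_right, inner_ket_right,
        RCLike.norm_conj]
    simp only [Function.comp_def, Equiv.prodComm_apply, Prod.fst_swap, Prod.snd_swap, h3]
    exact hasSum_norm_sq _
  · have h1 : (⟪φ, ρ φ⟫_ℂ).re = ‖x φ‖ ^ 2 := by
      rw [h]; exact inner_self_eq_norm_sq (𝕜 := ℂ) _
    rw [h1]
    refine (hasSum_norm_sq (x φ)).congr_fun fun n => ?_
    rw [ContinuousLinearMap.adjoint_inner_left, inner_ket_left]

/-- The expansion of `⟨ψ|ρ|ψ⟩` in the Fock basis converges absolutely: the entries of `ρ` satisfy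
`|ρ_{ab}|² ≤ ρ_{aa} ρ_{bb}`, and the diagonal is summable. -/
theorem IsDensity.summable_and_tsum_matrix {ρ : Fock m →L[ℂ] Fock m} (hρ : IsDensity ρ)
    (ψ : Fock m) :
    Summable (fun q : Occ m × Occ m =>
      ‖conj ⟪ket q.1, ψ⟫_ℂ * ⟪ket q.1, ρ (ket q.2)⟫_ℂ * ⟪ket q.2, ψ⟫_ℂ‖) ∧
    ∑' q : Occ m × Occ m, conj ⟪ket q.1, ψ⟫_ℂ * ⟪ket q.1, ρ (ket q.2)⟫_ℂ * ⟪ket q.2, ψ⟫_ℂ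
      = ⟪ψ, ρ ψ⟫_ℂ := by
  obtain ⟨x, hx, h⟩ := hρ.exists_inner_eq
  have h0 : Summable fun a : Occ m => ‖ψ a‖ * ‖x (ket a)‖ := by
    refine Summable.of_nonneg_of_le (fun _ => by positivity) (fun a => ?_)
      ((hasSum_norm_sq ψ).summable.add hx.summable)
    nlinarith [sq_nonneg (‖ψ a‖ - ‖x (ket a)‖), sq_nonneg (‖ψ a‖), sq_nonneg (‖x (ket a)‖)]
  have h1 : Summable (fun q : Occ m × Occ m =>
      ‖conj ⟪ket q.1, ψ⟫_ℂ * ⟪ket q.1, ρ (ket q.2)⟫_ℂ * ⟪ket q.2, ψ⟫_ℂ‖) := by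
    refine Summable.of_nonneg_of_le (fun _ => by positivity) (fun q => ?_)
      (h0.mul_of_nonneg h0 (fun _ => by positivity) fun _ => by positivity)
    rw [norm_mul, norm_mul, RCLike.norm_conj, h, inner_ket_left, inner_ket_left]
    calc _ ≤ ‖ψ q.1‖ * (‖x (ket q.1)‖ * ‖x (ket q.2)‖) * ‖ψ q.2‖ := by
          gcongr; exact norm_inner_le_norm _ _
      _ = _ := by ring
  refine ⟨h1, (h1.of_norm.hasSum.prod_fiberwise (g := fun a => conj (ψ a) * (ρ ψ) a)
    fun a => ?_).unique ?_⟩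
  · have h2 := ((innerSL ℂ (ket a)).comp ρ).hasSum (hasSum_smul_ket ψ)
    have h3 := h2.mul_left (conj (ψ a))
    simp only [ContinuousLinearMap.comp_apply, innerSL_apply_apply, map_smul, smul_eq_mul,
      inner_ket_left] at h3 ⊢
    exact h3.congr_fun fun b => by ring
  · have h2 := lp.hasSum_inner (𝕜 := ℂ) ψ (ρ ψ)
    exact h2.congr_fun fun b => by rw [RCLike.inner_apply]; ring

/-- The fidelity of `M` copies is the `M`-th power of the fidelity of one copy. -/
theorem fidelity_eq_pow {ρ : Fock m →L[ℂ] Fock m} (hρ : IsDensity ρ) (M : ℕ) (ψ : Fock m) :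
    fidelity M ψ ρ = (⟪ψ, ρ ψ⟫_ℂ).re ^ M := by
  obtain ⟨x, hx, h⟩ := hρ.exists_inner_eq
  obtain ⟨hs, ht⟩ := hρ.summable_and_tsum_matrix ψ
  have h1 := (hasSum_prod_pi (fun (_ : Fin M) (q : Occ m × Occ m) =>
    conj ⟪ket q.1, ψ⟫_ℂ * ⟪ket q.1, ρ (ket q.2)⟫_ℂ * ⟪ket q.2, ψ⟫_ℂ) fun _ => hs).2
  rw [← (Equiv.arrowProdEquivProdArrow (Fin M) (fun _ => Occ m) (fun _ => Occ m)).symm.hasSum_iff]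
    at h1
  simp only [ht, Finset.prod_const, Finset.card_univ, Fintype.card_fin] at h1
  have h2 : fidelity M ψ ρ = (⟪ψ, ρ ψ⟫_ℂ ^ M).re := by
    rw [fidelity, ← h1.tsum_eq]
    congr 1
    refine tsum_congr fun q => ?_
    simp only [tensorPowVec, tensorPowMat, map_prod, ← Finset.prod_mul_distrib]
    rfl
  rw [h2, h, inner_self_eq_norm_sq_to_K]
  norm_cast

/-! ### The law of the samples -/

/-- The Husimi densities of a mixture of vectors integrate to a probability law, and expectations
are mixtures of the expectations. -/
theorem hasSum_integral_of_mixture {v : Occ m → Fock m} (hv : HasSum (fun n => ‖v n‖ ^ 2) 1)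
    {Q : (Fin m → ℂ) → ℝ} (hQ : ∀ α, HasSum (fun n => ‖hetAmp (v n) α‖ ^ 2) (Q α)) :
    Measurable Q ∧ ∫⁻ α, ENNReal.ofReal (Q α) = 1 ∧
    ∀ (g : (Fin m → ℂ) → ℂ) (C : ℝ), Continuous g → (∀ α, ‖g α‖ ≤ C) →
      Integrable (fun α => g α * (Q α : ℂ)) ∧
      HasSum (fun n => ∫ α, g α * (hetAmp (v n) α * conj (hetAmp (v n) α)))
        (∫ α, g α * (Q α : ℂ)) := by
  have hm : ∀ n, Measurable fun α => ‖hetAmp (v n) α‖ ^ 2 := fun n =>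
    ((continuous_hetAmp (v n)).norm.pow 2).measurable
  have hQe : ∀ α, ENNReal.ofReal (Q α) = ∑' n, ENNReal.ofReal (‖hetAmp (v n) α‖ ^ 2) := fun α => by
    rw [← (hQ α).tsum_eq, ENNReal.ofReal_tsum_of_nonneg (fun _ => by positivity) (hQ α).summable]
  have hQ0 : ∀ α, 0 ≤ Q α := fun α => (hQ α).nonneg fun _ => by positivity
  have hQme : Measurable fun α => ENNReal.ofReal (Q α) := by
    simp only [hQe]
    exact Measurable.tsum fun n => (hm n).ennreal_ofReal
  have hQm : Measurable Q := by
    simpa only [ENNReal.toReal_ofReal (hQ0 _)] using hQme.ennreal_toReal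
  have hQl : ∫⁻ α, ENNReal.ofReal (Q α) = 1 := by
    simp only [hQe]
    rw [lintegral_tsum fun n => (hm n).ennreal_ofReal.aemeasurable]
    have h1 : ∀ n, ∫⁻ α, ENNReal.ofReal (‖hetAmp (v n) α‖ ^ 2) = ENNReal.ofReal (‖v n‖ ^ 2) :=
      fun n => by
        rw [← ofReal_integral_eq_lintegral_ofReal (integrable_norm_hetAmp_sq _)
          (Filter.Eventually.of_forall fun _ => by positivity), integral_norm_hetAmp_sq]
    simp only [h1]
    rw [← ENNReal.ofReal_tsum_of_nonneg (fun _ => by positivity) hv.summable, hv.tsum_eq,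
      ENNReal.ofReal_one]
  have hQint : Integrable Q :=
    (lintegral_ofReal_ne_top_iff_integrable hQm.aestronglyMeasurable
      (Filter.Eventually.of_forall hQ0)).1 (by rw [hQl]; exact ENNReal.one_ne_top)
  refine ⟨hQm, hQl, fun g C hg hC => ⟨?_, ?_⟩⟩
  · exact hQint.ofReal.bdd_mul hg.aestronglyMeasurable (Filter.Eventually.of_forall hC)
  · have hn : ∀ n α, ‖g α * (hetAmp (v n) α * conj (hetAmp (v n) α))‖
        ≤ C * ‖hetAmp (v n) α‖ ^ 2 := fun n α => by
      rw [norm_mul, norm_mul, RCLike.norm_conj, ← sq]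
      exact mul_le_mul_of_nonneg_right (hC α) (by positivity)
    have hi : ∀ n, Integrable fun α => g α * (hetAmp (v n) α * conj (hetAmp (v n) α)) := fun n =>
      ((integrable_norm_hetAmp_sq (v n)).const_mul C).mono'
        (by have := continuous_hetAmp (v n); fun_prop) (Filter.Eventually.of_forall (hn n))
    have h1 := hasSum_integral_of_summable_integral_norm hi (by
      refine Summable.of_nonneg_of_le (fun _ => integral_nonneg fun _ => norm_nonneg _)
        (fun n => ?_) (hv.summable.mul_left C)
      rw [← integral_norm_hetAmp_sq, ← integral_const_mul]
      exact integral_mono (hi n).norm ((integrable_norm_hetAmp_sq (v n)).const_mul C) (hn n))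
    have h2 : ∀ α, ∑' n, g α * (hetAmp (v n) α * conj (hetAmp (v n) α)) = g α * (Q α : ℂ) :=
      fun α => by
        rw [tsum_mul_left, ← (hQ α).tsum_eq, Complex.ofReal_tsum]
        congr 1
        exact tsum_congr fun n => by rw [Complex.mul_conj']; push_cast; rfl
    simpa only [h2] using h1

theorem inner_symm_left (V : Fock m ≃ₗᵢ[ℂ] Fock m) (u φ : Fock m) :
    ⟪V.symm u, φ⟫_ℂ = ⟪u, V φ⟫_ℂ := by
  rw [← V.inner_map_map, V.apply_symm_apply]

theorem isProbabilityMeasure_heterodyneLaw {ρ : Fock m →L[ℂ] Fock m} (hρ : IsDensity ρ)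
    (ξ : Fin m → ℂ) : IsProbabilityMeasure (heterodyneLaw ρ ξ) := by
  obtain ⟨u, hu, hφ⟩ := hρ.exists_mixture
  have h := (hasSum_integral_of_mixture (v := fun n => (squeezing ξ).symm (u n))
    (by simpa only [LinearIsometryEquiv.norm_map] using hu)
    (Q := fun γ => (Real.pi ^ m)⁻¹ * (⟪squeezedCoherent γ ξ, ρ (squeezedCoherent γ ξ)⟫_ℂ).re)
    fun γ => by
      refine ((hφ (squeezedCoherent γ ξ)).mul_left ((Real.pi ^ m)⁻¹)).congr_fun fun n => ?_
      rw [norm_hetAmp_sq, norm_inner_symm, inner_symm_left, squeezedCoherent, displacement_vac]).2.1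
  exact ⟨by rw [heterodyneLaw, withDensity_apply _ MeasurableSet.univ, Measure.restrict_univ, h]⟩

theorem isProbabilityMeasure_sampleLaw {ρ : Fock m →L[ℂ] Fock m} (hρ : IsDensity ρ) (N : ℕ)
    (ξ : Fin m → ℂ) : IsProbabilityMeasure (sampleLaw N ρ ξ) := by
  have := isProbabilityMeasure_heterodyneLaw hρ ξ
  rw [sampleLaw]
  infer_instance

theorem measurePreserving_postProcess (T : Target m) : MeasurePreserving (postProcess T) := by
  have hdet : Complex.normSq T.U.conjTranspose.det = 1 := by
    have h1 := T.unitary_U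
    rw [Matrix.mem_unitaryGroup_iff] at h1
    have h2 := congrArg Matrix.det h1
    rw [Matrix.det_mul, Matrix.det_one, Matrix.star_eq_conjTranspose, Matrix.det_conjTranspose]
      at h2
    rw [Matrix.det_conjTranspose, ← Complex.ofReal_inj, Complex.normSq_eq_conj_mul_self]
    simpa using h2
  have hlin : MeasurePreserving (fun γ : Fin m → ℂ => T.U.conjTranspose.mulVec γ) := by
    refine ⟨by fun_prop, ?_⟩
    have h1 : LinearMap.det ((Matrix.toLin' T.U.conjTranspose).restrictScalars ℝ) = 1 := by
      rw [LinearMap.det_restrictScalars, Algebra.norm_complex_apply, LinearMap.det_toLin', hdet]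
    have h2 := Measure.map_linearMap_addHaar_eq_smul_addHaar (volume : Measure (Fin m → ℂ))
      (f := (Matrix.toLin' T.U.conjTranspose).restrictScalars ℝ) (by rw [h1]; norm_num)
    rw [h1] at h2
    rw [inv_one, abs_one, ENNReal.ofReal_one, one_smul] at h2
    exact h2
  exact hlin.comp (measurePreserving_sub_right volume T.β)

/-- The unitary `S(ξ) D(β) Û` that prepares the target from the core states. -/
def Target.prep (T : Target m) : Fock m ≃ₗᵢ[ℂ] Fock m :=
  T.Uhat.trans ((displacement T.β).trans (squeezing T.ξ))

theorem exists_phase_squeezedCoherent (T : Target m) (γ : Fin m → ℂ) :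
    ∃ c : ℂ, ‖c‖ = 1 ∧ squeezedCoherent γ T.ξ = c • T.prep (coh (postProcess T γ)) := by
  obtain ⟨c, hc, h⟩ := exists_phase_displacement_coh T.β γ
  obtain ⟨d, hd, h'⟩ := exists_phase_passive_coh T.passive T.unitary_U (γ - T.β)
  refine ⟨c * d, by rw [norm_mul, hc, hd, one_mul], ?_⟩
  rw [squeezedCoherent, h, h', map_smul, map_smul, map_smul, smul_smul]
  rfl

/-- The mode fidelities `Fᵢ` of a state: they bound its fidelity `F` with the target by
`1 - ∑ (1 - Fᵢ) ≤ F ≤ Fᵢ`, and the expectation of the estimator of mode `i` is `Fᵢ` up to a bias of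
`A η^p`. -/
theorem exists_mode_fidelity (T : Target m) {ρ : Fock m →L[ℂ] Fock m} (hρ : IsDensity ρ) :
    ∃ F : Fin m → ℝ, (∀ i, F i ≤ 1) ∧ (∀ i, (⟪T.state, ρ T.state⟫_ℂ).re ≤ F i) ∧
      0 ≤ (⟪T.state, ρ T.state⟫_ℂ).re ∧ (⟪T.state, ρ T.state⟫_ℂ).re ≤ 1 ∧
      1 - (⟪T.state, ρ T.state⟫_ℂ).re ≤ ∑ i, (1 - F i) ∧
      ∀ (i : Fin m) (p : ℕ) (η : ℝ), 1 ≤ p → 0 < η →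
        η ≤ ((p : ℝ) + 1) / ((p : ℝ) * ((p : ℝ) + T.c i)) →
        |(∫ γ, gCore p (T.c i) (T.coef i) (postProcess T γ i) η ∂heterodyneLaw ρ T.ξ) - F i|
          ≤ constA p (T.c i) (T.coef i) * η ^ p := by
  obtain ⟨u, hu, hφ⟩ := hρ.exists_mixture
  set w : Occ m → Fock m := fun n => T.prep.symm (u n) with hw
  have hw1 : HasSum (fun n => ‖w n‖ ^ 2) 1 := by
    simpa only [hw, LinearIsometryEquiv.norm_map] using hu
  have hf : HasSum (fun n => ‖⟪T.coreProduct, w n⟫_ℂ‖ ^ 2) (⟪T.state, ρ T.state⟫_ℂ).re := by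
    refine (hφ T.state).congr_fun fun n => ?_
    rw [norm_inner_symm, hw, inner_symm_left]
    rfl
  have hsF : ∀ i, Summable fun n => ‖T.proj i (w n)‖ ^ 2 := fun i =>
    Summable.of_nonneg_of_le (fun _ => by positivity)
      (fun n => pow_le_pow_left₀ (norm_nonneg _) (norm_modeProj_le (T.normalized i) i (w n)) 2)
      hw1.summable
  have hF := fun i => (hsF i).hasSum
  refine ⟨fun i => ∑' n, ‖T.proj i (w n)‖ ^ 2, fun i => ?_, fun i => ?_, ?_, ?_, ?_, ?_⟩
  · exact hasSum_le (fun n => pow_le_pow_left₀ (norm_nonneg _)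
      (norm_modeProj_le (T.normalized i) i (w n)) 2) (hF i) hw1
  · exact hasSum_le (fun n => pow_le_pow_left₀ (norm_nonneg _)
      (T.norm_inner_coreProduct_le i (w n)) 2) hf (hF i)
  · exact hf.nonneg fun _ => by positivity
  · refine hasSum_le (fun n => pow_le_pow_left₀ (norm_nonneg _) ?_ 2) hf hw1
    simpa only [T.norm_coreProduct, one_mul] using norm_inner_le_norm (𝕜 := ℂ) T.coreProduct (w n)
  · exact hasSum_le (fun n => T.norm_sq_sub_inner_coreProduct_le (w n)) (hw1.sub hf)
      (hasSum_sum fun i _ => hw1.sub (hF i))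
  · intro i p η hp hη hη1
    -- the density of the outcome `γ`, as a function of `α = U†(γ - β)`
    set Q : (Fin m → ℂ) → ℝ := fun α =>
      (Real.pi ^ m)⁻¹ * (⟪T.prep (coh α), ρ (T.prep (coh α))⟫_ℂ).re with hQdef
    have hQ : ∀ α, HasSum (fun n => ‖hetAmp (w n) α‖ ^ 2) (Q α) := fun α => by
      refine ((hφ (T.prep (coh α))).mul_left ((Real.pi ^ m)⁻¹)).congr_fun fun n => ?_
      rw [norm_hetAmp_sq, norm_inner_symm, hw, inner_symm_left]
    obtain ⟨hQm, -, hQi⟩ := hasSum_integral_of_mixture hw1 hQ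
    have hQ0 : ∀ α, 0 ≤ Q α := fun α => (hQ α).nonneg fun _ => by positivity
    have hlaw : heterodyneLaw ρ T.ξ
        = volume.withDensity fun γ => ENNReal.ofReal (Q (postProcess T γ)) := by
      rw [heterodyneLaw]
      congr 1
      funext γ
      obtain ⟨c, hc, h⟩ := exists_phase_squeezedCoherent T γ
      have hc2 : c * conj c = 1 := by rw [Complex.mul_conj', hc]; norm_num
      rw [h, map_smul, inner_smul_left, inner_smul_right, ← mul_assoc, mul_comm (conj c), hc2,
        one_mul]
    have hmp := measurePreserving_postProcess T
    have hgc : Continuous fun α : Fin m → ℂ => gCoreC p (T.c i) (T.coef i) (α i) η :=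
      (continuous_gCoreC p (T.c i) (T.coef i) η).comp (continuous_apply i)
    have hint : ∫ γ, gCore p (T.c i) (T.coef i) (postProcess T γ i) η ∂heterodyneLaw ρ T.ξ
        = ∫ α, Q α * gCore p (T.c i) (T.coef i) (α i) η := by
      rw [hlaw, integral_withDensity_eq_integral_toReal_smul
        (f := fun γ => ENNReal.ofReal (Q (postProcess T γ)))
        (hQm.comp hmp.measurable).ennreal_ofReal (Filter.Eventually.of_forall fun _ => by simp)]
      simp only [ENNReal.toReal_ofReal (hQ0 _), smul_eq_mul]
      have h1 := integral_map (μ := volume) (φ := postProcess T) hmp.measurable.aemeasurable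
        (f := fun α => Q α * gCore p (T.c i) (T.coef i) (α i) η)
        (hQm.mul (Complex.continuous_re.comp hgc).measurable).aestronglyMeasurable
      rw [hmp.map_eq] at h1
      exact h1.symm
    obtain ⟨hI, hsum⟩ := hQi _ _ hgc fun α => norm_gCoreC_le hp (T.coef i) hη hη1 (α i)
    have hre : (∫ α, gCoreC p (T.c i) (T.coef i) (α i) η * (Q α : ℂ)).re
        = ∫ α, Q α * gCore p (T.c i) (T.coef i) (α i) η := by
      refine (integral_re hI).symm.trans
        (integral_congr_ae (Filter.Eventually.of_forall fun α => ?_))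
      simp [gCore_eq_re, mul_comm]
    rw [hint, ← hre]
    have hb := (Complex.hasSum_re hsum).sub (hF i)
    have hA : 0 ≤ constA p (T.c i) (T.coef i) * η ^ p :=
      mul_nonneg (sq_nonneg _) (by positivity)
    have hn : ∀ n, |(∫ α, gCoreC p (T.c i) (T.coef i) (α i) η
        * (hetAmp (w n) α * conj (hetAmp (w n) α))).re - ‖T.proj i (w n)‖ ^ 2|
        ≤ constA p (T.c i) (T.coef i) * η ^ p * ‖w n‖ ^ 2 := fun n => by
      rw [← re_inner_modeProj (T.normalized i), ← Complex.sub_re]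
      exact (Complex.abs_re_le_norm _).trans
        (norm_integral_gCoreC_sub_le hp (T.coef i) hη hη1 i (w n))
    have hw2 := hw1.mul_left (constA p (T.c i) (T.coef i) * η ^ p)
    rw [mul_one] at hw2
    rw [abs_le]
    exact ⟨neg_le.1 (hasSum_le (fun n => neg_le.2 (abs_le.1 (hn n)).1) hb.neg hw2),
      hasSum_le (fun n => (abs_le.1 (hn n)).2) hb hw2⟩

/-! ### Concentration of the estimates -/

/-- Two-sided Hoeffding inequality for the mean of `N` independent copies of a variable bounded by
`R`. -/
theorem real_pi_mean_sub_integral_le {Ω : Type*} [MeasurableSpace Ω] (ν : Measure Ω)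
    [IsProbabilityMeasure ν] {X : Ω → ℝ} (hX : Measurable X) {R : ℝ} (hR : ∀ ω, |X ω| ≤ R)
    {N : ℕ} (hN : 1 ≤ N) {t : ℝ} (ht : 0 ≤ t) :
    (Measure.pi fun _ : Fin N => ν).real
        {γ | t ≤ |(1 / (N : ℝ)) * ∑ k, X (γ k) - ∫ ω, X ω ∂ν|}
      ≤ 2 * Real.exp (-(N * t ^ 2 / (2 * R ^ 2))) := by
  have hN0 : (0 : ℝ) < N := by exact_mod_cast hN
  have hone : ∀ Y : Ω → ℝ, Measurable Y → (∀ ω, |Y ω| ≤ R) →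
      (Measure.pi fun _ : Fin N => ν).real
        {γ | N * t ≤ ∑ k, (Y (γ k) - ∫ ω, Y ω ∂ν)} ≤ Real.exp (-(N * t ^ 2 / (2 * R ^ 2))) := by
    intro Y hY hYR
    have hR0 : 0 ≤ R := by
      obtain ⟨ω⟩ : Nonempty Ω := ν.nonempty_of_neZero
      exact (abs_nonneg _).trans (hYR ω)
    have hsub := ProbabilityTheory.hasSubgaussianMGF_of_mem_Icc (μ := ν) hY.aemeasurable
      (Filter.Eventually.of_forall fun ω => (abs_le.1 (hYR ω)))
    have hind := ProbabilityTheory.iIndepFun_pi (μ := fun _ : Fin N => ν)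
      (X := fun _ ω => Y ω - ∫ ω, Y ω ∂ν) fun _ => (hY.sub_const _).aemeasurable
    have h := ProbabilityTheory.HasSubgaussianMGF.measure_sum_ge_le_of_iIndepFun hind
      (s := Finset.univ) (c := fun _ => (‖R - -R‖₊ / 2) ^ 2) (fun k _ => by
        refine ProbabilityTheory.HasSubgaussianMGF.of_map (μ := Measure.pi fun _ : Fin N => ν)
          (Y := fun γ => γ k) (X := fun ω => Y ω - ∫ ω, Y ω ∂ν)
          (measurable_pi_apply k).aemeasurable ?_
        rw [(measurePreserving_eval (fun _ : Fin N => ν) k).map_eq]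
        exact hsub) (mul_nonneg hN0.le ht)
    refine h.trans (le_of_eq ?_)
    congr 1
    have hc : (((‖R - -R‖₊ / 2) ^ 2 : NNReal) : ℝ) = R ^ 2 := by
      push_cast
      rw [Real.norm_eq_abs, sub_neg_eq_add, div_pow, sq_abs]
      ring
    rw [NNReal.coe_sum]
    simp only [hc, Finset.sum_const, Finset.card_univ, Fintype.card_fin, nsmul_eq_mul]
    by_cases hR2 : R = 0
    · simp [hR2]
    · field_simp
  have hsplit : {γ : Fin N → Ω | t ≤ |(1 / (N : ℝ)) * ∑ k, X (γ k) - ∫ ω, X ω ∂ν|}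
      ⊆ {γ | N * t ≤ ∑ k, (X (γ k) - ∫ ω, X ω ∂ν)}
        ∪ {γ | N * t ≤ ∑ k, (-X (γ k) - ∫ ω, -X ω ∂ν)} := by
    intro γ hγ
    have e : (1 / (N : ℝ)) * ∑ k, X (γ k) - ∫ ω, X ω ∂ν
        = (∑ k, (X (γ k) - ∫ ω, X ω ∂ν)) / N := by
      rw [Finset.sum_sub_distrib, Finset.sum_const, Finset.card_univ, Fintype.card_fin,
        nsmul_eq_mul]
      field_simp
    have e2 : ∑ k, (-X (γ k) - ∫ ω, -X ω ∂ν) = -∑ k, (X (γ k) - ∫ ω, X ω ∂ν) := by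
      rw [integral_neg, ← Finset.sum_neg_distrib]
      exact Finset.sum_congr rfl fun _ _ => by ring
    simp only [Set.mem_ofPred_eq, e, Set.mem_union, e2] at hγ ⊢
    rw [abs_div, abs_of_pos hN0, le_div_iff₀ hN0, mul_comm] at hγ
    exact le_abs.1 hγ
  refine (measureReal_mono hsplit).trans ((measureReal_union_le _ _).trans ?_)
  have h1 := hone X hX hR
  have h2 := hone (fun ω => -X ω) hX.neg fun ω => by rw [abs_neg]; exact hR ω
  linarith

/-- The probability that one of the estimates deviates from its mode fidelity by at least `t`, when
the statistical error granted to mode `i` is `lam i` and its estimator is bounded by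
`Bd i / η^c`. -/
theorem real_sampleLaw_deviation_le (T : Target m) {ρ : Fock m →L[ℂ] Fock m} (hρ : IsDensity ρ)
    {F : Fin m → ℝ} {p : Fin m → ℕ} (hp : ∀ i, 1 ≤ p i) {η : Fin m → ℝ} (hη : ∀ i, 0 < η i)
    (hη1 : ∀ i, η i ≤ ((p i : ℝ) + 1) / ((p i : ℝ) * ((p i : ℝ) + T.c i)))
    (hF : ∀ i, |(∫ γ, gCore (p i) (T.c i) (T.coef i) (postProcess T γ i) (η i)
      ∂heterodyneLaw ρ T.ξ) - F i| ≤ constA (p i) (T.c i) (T.coef i) * η i ^ p i)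
    {Bd : Fin m → ℝ} (hBd : ∀ i, constB (p i) (T.c i) (T.coef i) (η i) ≤ Bd i)
    {lam : Fin m → ℝ} (hlam : ∀ i, 0 ≤ lam i) {t : ℝ}
    (ht : ∀ i, lam i + constA (p i) (T.c i) (T.coef i) * η i ^ p i ≤ t) {N : ℕ} (hN : 1 ≤ N) :
    (sampleLaw N ρ T.ξ).real {γ | ∃ i, t < |meanEstimate T p η γ i - F i|}
      ≤ ∑ i, 2 * Real.exp (-(N * lam i ^ 2 / (2 * (Bd i / η i ^ T.c i) ^ 2))) := by
  have := isProbabilityMeasure_heterodyneLaw hρ T.ξ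
  have := isProbabilityMeasure_sampleLaw hρ N T.ξ
  have hsub : {γ : Fin N → Fin m → ℂ | ∃ i, t < |meanEstimate T p η γ i - F i|}
      ⊆ ⋃ i ∈ (Finset.univ : Finset (Fin m)), {γ | lam i ≤ |meanEstimate T p η γ i
        - ∫ γ, gCore (p i) (T.c i) (T.coef i) (postProcess T γ i) (η i) ∂heterodyneLaw ρ T.ξ|} := by
    rintro γ ⟨i, hi⟩
    simp only [Finset.mem_univ, Set.iUnion_true, Set.mem_iUnion, Set.mem_ofPred_eq]
    refine ⟨i, ?_⟩
    have h1 := abs_sub_le (meanEstimate T p η γ i)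
      (∫ γ, gCore (p i) (T.c i) (T.coef i) (postProcess T γ i) (η i) ∂heterodyneLaw ρ T.ξ) (F i)
    linarith [hF i, ht i]
  refine (measureReal_mono hsub (measure_ne_top _ _)).trans
    ((measureReal_biUnion_finset_le _ _).trans ?_)
  refine Finset.sum_le_sum fun i _ => ?_
  refine real_pi_mean_sub_integral_le (heterodyneLaw ρ T.ξ)
    (X := fun γ => gCore (p i) (T.c i) (T.coef i) (postProcess T γ i) (η i)) ?_ (fun γ => ?_) hN
    (hlam i)
  · have h1 : Measurable fun γ => postProcess T γ i :=
      (measurable_pi_apply i).comp (measurePreserving_postProcess T).measurable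
    exact (Complex.continuous_re.comp
      (continuous_gCoreC (p i) (T.c i) (T.coef i) (η i))).measurable.comp h1
  · refine ((Complex.abs_re_le_norm _).trans
      (norm_gCoreC_le (hp i) (T.coef i) (hη i) (hη1 i) _)).trans ?_
    exact div_le_div_of_nonneg_right (hBd i) (pow_nonneg (hη i).le _)

/-! ### The fidelity witness -/

theorem pow_add_pow_le_one_add_pow {a b : ℝ} (ha : a ≤ 1) (hb0 : 0 ≤ b) (hb : b ≤ 1)
    (hab : 1 ≤ a + b) {M : ℕ} (hM : 1 ≤ M) : a ^ M + b ^ M ≤ 1 + (a + b - 1) ^ M := by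
  induction M, hM using Nat.le_induction with
  | base => simp
  | succ M _ ih =>
    have h1 : (a + b - 1) * (b ^ M - (a + b - 1) ^ M) ≤ a * (1 - a ^ M) := by
      have h2 : 0 ≤ b ^ M - (a + b - 1) ^ M :=
        sub_nonneg.2 (pow_le_pow_left₀ (by linarith) (by linarith) M)
      exact mul_le_mul (by linarith) (by linarith) h2 (by linarith)
    have h3 : b ^ M * (1 - a) ≤ 1 * (1 - a) :=
      mul_le_mul_of_nonneg_right (pow_le_one₀ hb0 hb) (by linarith)
    have e : 1 + (a + b - 1) ^ (M + 1) - (a ^ (M + 1) + b ^ (M + 1))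
        = (a * (1 - a ^ M) - (a + b - 1) * (b ^ M - (a + b - 1) ^ M))
          + (1 * (1 - a) - b ^ M * (1 - a)) := by ring
    linarith

/-- The case in which the infidelities add up to at most one, by induction over the modes. -/
theorem one_sub_sum_pow_le {ι : Type*} (s : Finset ι) {F : ι → ℝ} (h0 : ∀ i, 0 ≤ F i)
    (h1 : ∀ i, F i ≤ 1) {M : ℕ} (hM : 1 ≤ M) (hs : ∑ i ∈ s, (1 - F i) ≤ 1) :
    1 - ∑ i ∈ s, (1 - F i ^ M) ≤ (1 - ∑ i ∈ s, (1 - F i)) ^ M := by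
  classical
  induction s using Finset.induction_on with
  | empty => simp
  | insert j s hj ih =>
    rw [Finset.sum_insert hj] at hs
    rw [Finset.sum_insert hj, Finset.sum_insert hj]
    have h2 : 0 ≤ ∑ i ∈ s, (1 - F i) := Finset.sum_nonneg fun i _ => by linarith [h1 i]
    have h3 := pow_add_pow_le_one_add_pow (a := 1 - ∑ i ∈ s, (1 - F i)) (b := F j)
      (by linarith) (h0 j) (h1 j) (by linarith) hM
    have h4 := ih (by linarith [h1 j])
    have e : 1 - (1 - F j + ∑ i ∈ s, (1 - F i)) = 1 - ∑ i ∈ s, (1 - F i) + F j - 1 := by ring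
    rw [e]
    linarith

/-- The `M`-copy witness of the mode fidelities is a lower bound on the `M`-copy fidelity. -/
theorem one_sub_sum_pow_le_pow {ι : Type*} (s : Finset ι) {F : ι → ℝ} (h0 : ∀ i, 0 ≤ F i)
    (h1 : ∀ i, F i ≤ 1) {f : ℝ} (hf : 0 ≤ f) (hfF : 1 - f ≤ ∑ i ∈ s, (1 - F i)) {M : ℕ}
    (hM : 1 ≤ M) : 1 - ∑ i ∈ s, (1 - F i ^ M) ≤ f ^ M := by
  by_cases hs : ∑ i ∈ s, (1 - F i) ≤ 1
  · exact (one_sub_sum_pow_le s h0 h1 hM hs).trans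
      (pow_le_pow_left₀ (by linarith) (by linarith) M)
  · have h2 : ∑ i ∈ s, (1 - F i) ≤ ∑ i ∈ s, (1 - F i ^ M) := Finset.sum_le_sum fun i _ => by
      have := pow_le_of_le_one (h0 i) (h1 i) (by omega : M ≠ 0)
      linarith
    have h3 := pow_nonneg hf M
    linarith

theorem Target.norm_state (T : Target m) : ‖T.state‖ = 1 := by
  rw [Target.state, LinearIsometryEquiv.norm_map, LinearIsometryEquiv.norm_map,
    LinearIsometryEquiv.norm_map, T.norm_coreProduct]

theorem fidelity_state_of_eq (T : Target m) {ρ : Fock m →L[ℂ] Fock m} (hρ : IsDensity ρ) (M : ℕ)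
    (h : ρ = InnerProductSpace.rankOne ℂ T.state T.state) : fidelity M T.state ρ = 1 := by
  have h1 : ⟪T.state, ρ T.state⟫_ℂ = 1 := by
    rw [h, InnerProductSpace.rankOne_apply, inner_smul_right, inner_self_eq_norm_sq_to_K,
      T.norm_state]
    simp
  rw [fidelity_eq_pow hρ, h1]
  simp

theorem one_sub_le_real_of_compl {Ω : Type*} [MeasurableSpace Ω] (μ : Measure Ω)
    [IsProbabilityMeasure μ] {s t : Set Ω} {δ : ℝ} (hs : μ.real s ≤ δ) (h : ∀ ω, ω ∉ s → ω ∈ t) :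
    1 - δ ≤ μ.real t := by
  have h1 : (Set.univ : Set Ω) ⊆ s ∪ t := fun ω _ => by
    by_cases hω : ω ∈ s
    · exact Or.inl hω
    · exact Or.inr (h ω hω)
  have h2 := (measureReal_mono (μ := μ) h1).trans (measureReal_union_le s t)
  rw [probReal_univ] at h2
  linarith

/-- An estimate that is `ε`-close to the witness of the exact mode fidelities outside an event of
probability `δ` satisfies the guarantee. -/
theorem guarantee_of_close (T : Target m) {ρ : Fock m →L[ℂ] Fock m} (hρ : IsDensity ρ)
    {F : Fin m → ℝ} (hF1 : ∀ i, F i ≤ 1) (hF : ∀ i, (⟪T.state, ρ T.state⟫_ℂ).re ≤ F i)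
    (hf : 0 ≤ (⟪T.state, ρ T.state⟫_ℂ).re)
    (hfF : 1 - (⟪T.state, ρ T.state⟫_ℂ).re ≤ ∑ i, (1 - F i)) {M N : ℕ} (hM : 1 ≤ M) {ε δ : ℝ}
    {W : (Fin N → Fin m → ℂ) → ℝ} {bad : Set (Fin N → Fin m → ℂ)}
    (hbad : (sampleLaw N ρ T.ξ).real bad ≤ δ)
    (hW : ∀ γ, γ ∉ bad → |W γ - (1 - ∑ i, (1 - F i ^ M))| ≤ ε) : Guarantee T M N ρ ε δ W := by
  have := isProbabilityMeasure_sampleLaw hρ N T.ξ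
  have key : ∀ γ, γ ∉ bad → 1 - (m : ℝ) * (1 - fidelity M T.state ρ) - ε ≤ W γ ∧
      W γ ≤ fidelity M T.state ρ + ε := by
    intro γ hγ
    have h1 := abs_le.1 (hW γ hγ)
    have h2 := one_sub_sum_pow_le_pow Finset.univ (fun i => hf.trans (hF i)) hF1 hf hfF hM
    have h3 : ∑ i, (1 - F i ^ M) ≤ ∑ _i : Fin m, (1 - (⟪T.state, ρ T.state⟫_ℂ).re ^ M) :=
      Finset.sum_le_sum fun i _ => by
        have := pow_le_pow_left₀ hf (hF i) M
        linarith
    rw [Finset.sum_const, Finset.card_univ, Fintype.card_fin, nsmul_eq_mul] at h3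
    rw [fidelity_eq_pow hρ]
    constructor <;> linarith
  refine ⟨one_sub_le_real_of_compl _ hbad key, fun h => ?_⟩
  refine one_sub_le_real_of_compl _ hbad fun γ hγ => ?_
  have h1 := (key γ hγ).1
  rw [fidelity_state_of_eq T hρ M h, sub_self, mul_zero, sub_zero] at h1
  exact h1

theorem guarantee_of_one_le (T : Target m) (M N : ℕ) (ρ : Fock m →L[ℂ] Fock m) (ε : ℝ) {δ : ℝ}
    (hδ : 1 ≤ δ) (W : (Fin N → Fin m → ℂ) → ℝ) : Guarantee T M N ρ ε δ W :=
  ⟨(sub_nonpos.2 hδ).trans measureReal_nonneg, fun _ => (sub_nonpos.2 hδ).trans measureReal_nonneg⟩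

theorem abs_witness_sub_le {X F : Fin m → ℝ} {M : ℕ} {ε : ℝ}
    (h : ∀ i, m * |X i ^ M - F i ^ M| ≤ ε) (hm : 1 ≤ m) :
    |(1 - ∑ i, (1 - X i ^ M)) - (1 - ∑ i, (1 - F i ^ M))| ≤ ε := by
  have e : (1 - ∑ i, (1 - X i ^ M)) - (1 - ∑ i, (1 - F i ^ M)) = ∑ i, (X i ^ M - F i ^ M) := by
    simp only [Finset.sum_sub_distrib]; ring
  have hm0 : (0 : ℝ) < m := by exact_mod_cast hm
  rw [e]
  refine (Finset.abs_sum_le_sum_abs _ _).trans ?_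
  calc ∑ i, |X i ^ M - F i ^ M| ≤ ∑ _i : Fin m, ε / m := Finset.sum_le_sum fun i _ => by
        rw [le_div_iff₀ hm0, mul_comm]; exact h i
    _ = ε := by
        rw [Finset.sum_const, Finset.card_univ, Fintype.card_fin, nsmul_eq_mul]
        field_simp

theorem abs_trunc_pow_sub_le {x F : ℝ} (h0 : 0 ≤ F) (h1 : F ≤ 1) (M : ℕ) :
    |(max 0 (min 1 x)) ^ M - F ^ M| ≤ M * min 1 |x - F| := by
  have hy0 : 0 ≤ max 0 (min 1 x) := le_max_left _ _
  have hy1 : max 0 (min 1 x) ≤ 1 := max_le zero_le_one (min_le_left _ _)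
  have h2 : |max 0 (min 1 x) - F| ≤ min 1 |x - F| := by
    refine le_min (abs_le.2 ⟨by linarith, by linarith⟩) ?_
    have h3 : F = max 0 (min 1 F) := by rw [min_eq_right h1, max_eq_right h0]
    calc |max 0 (min 1 x) - F| = |max (min 1 x) 0 - max (min 1 F) 0| := by
          conv_lhs => rw [h3]
          rw [max_comm, max_comm 0]
      _ ≤ |min 1 x - min 1 F| := abs_max_sub_max_le_abs _ _ _
      _ ≤ |x - F| := by
          simpa using abs_min_sub_min_le_max 1 x 1 F
  refine (abs_pow_sub_pow_le ..).trans ?_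
  have h4 : max |max 0 (min 1 x)| |F| ^ (M - 1) ≤ 1 :=
    pow_le_one₀ (le_max_of_le_left (abs_nonneg _)) (by
      rw [abs_of_nonneg hy0, abs_of_nonneg h0]; exact max_le hy1 h1)
  calc _ ≤ |max 0 (min 1 x) - F| * M * 1 := mul_le_mul_of_nonneg_left h4 (by positivity)
    _ ≤ _ := by rw [mul_one, mul_comm]; exact mul_le_mul_of_nonneg_left h2 (by positivity)

/-- Raising an untruncated estimate to the power `M` multiplies its error by at most `3 M`: the
estimate exceeds one by at most `t ≤ 1/M`, and `(1 + t)^M ≤ e ≤ 3`. -/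
theorem abs_pow_sub_pow_le_three {x F t : ℝ} (h0 : 0 ≤ F) (h1 : F ≤ 1) {M : ℕ}
    (hx : |x - F| ≤ t) (ht : M * t ≤ 1) : |x ^ M - F ^ M| ≤ 3 * (M * t) := by
  have ht0 : 0 ≤ t := (abs_nonneg _).trans hx
  refine (abs_pow_sub_pow_le ..).trans ?_
  have h2 : max |x| |F| ≤ 1 + t := by
    rw [abs_of_nonneg h0]
    refine max_le ?_ (by linarith)
    rw [abs_le] at hx ⊢
    constructor <;> linarith
  have h3 : max |x| |F| ^ (M - 1) ≤ 3 := by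
    calc _ ≤ (1 + t) ^ (M - 1) := pow_le_pow_left₀ (le_max_of_le_left (abs_nonneg _)) h2 _
      _ ≤ (1 + t) ^ M := pow_le_pow_right₀ (by linarith) (Nat.sub_le _ _)
      _ ≤ Real.exp t ^ M := pow_le_pow_left₀ (by linarith) (by
          rw [add_comm]; exact Real.add_one_le_exp t) _
      _ = Real.exp (M * t) := (Real.exp_nat_mul t M).symm
      _ ≤ Real.exp 1 := Real.exp_le_exp.2 ht
      _ ≤ 3 := by linarith [Real.exp_one_lt_d9]
  calc _ ≤ t * M * 3 := by gcongr
    _ = _ := by ring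

/-! ### Explicit failure probability -/

theorem one_le_of_normalized {c : ℕ} {coef : ℕ → ℂ}
    (h : ∑ n ∈ Finset.range c, ‖coef n‖ ^ 2 = 1) : 1 ≤ c := by
  rcases Nat.eq_zero_or_pos c with rfl | hc
  · simp at h
  · exact hc

theorem one_le_constA {c : ℕ} {coef : ℕ → ℂ} (h : ∑ n ∈ Finset.range c, ‖coef n‖ ^ 2 = 1)
    (p : ℕ) : 1 ≤ constA p c coef := by
  have h1 : ∀ n ∈ Finset.range c, ‖coef n‖ ≤ ‖coef n‖ * Real.sqrt ((n + p).choose n : ℝ) :=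
    fun n _ => le_mul_of_one_le_right (norm_nonneg _) (Real.one_le_sqrt.2 (by
      exact_mod_cast Nat.choose_pos (Nat.le_add_right n p)))
  calc (1 : ℝ) = ∑ n ∈ Finset.range c, ‖coef n‖ ^ 2 := h.symm
    _ ≤ (∑ n ∈ Finset.range c, ‖coef n‖) ^ 2 :=
        Finset.sum_sq_le_sq_sum_of_nonneg fun _ _ => norm_nonneg _
    _ ≤ constA p c coef :=
        pow_le_pow_left₀ (Finset.sum_nonneg fun _ _ => norm_nonneg _) (Finset.sum_le_sum h1) 2

theorem constB_nonneg (p c : ℕ) (coef : ℕ → ℂ) {η : ℝ} (hη : 0 ≤ η) : 0 ≤ constB p c coef η :=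
  Finset.sum_nonneg fun _ _ => Finset.sum_nonneg fun _ _ => by positivity

theorem etaOpt_pos {p c : ℕ} (hp : 1 ≤ p) (hc : 1 ≤ c) {coef : ℕ → ℂ} (hA : 0 < constA p c coef)
    {ε : ℝ} (hε : 0 < ε) : 0 < etaOpt p c coef ε := by
  have : (0 : ℝ) < p := by exact_mod_cast hp
  have : (0 : ℝ) < c := by exact_mod_cast hc
  exact lt_min (by positivity) (by positivity)

theorem constA_mul_etaOpt_pow_le {p c : ℕ} (hp : 1 ≤ p) (hc : 1 ≤ c) {coef : ℕ → ℂ}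
    (hA : 0 < constA p c coef) {ε : ℝ} (hε : 0 < ε) :
    constA p c coef * etaOpt p c coef ε ^ p ≤ c * ε / (c + p) := by
  have hp0 : (0 : ℝ) < p := by exact_mod_cast hp
  have hc0 : (0 : ℝ) < c := by exact_mod_cast hc
  have h1 : etaOpt p c coef ε ^ p ≤ (c : ℝ) * ε / (((c : ℝ) + p) * constA p c coef) := by
    refine (pow_le_pow_left₀ (etaOpt_pos hp hc hA hε).le (min_le_left _ _) p).trans (le_of_eq ?_)
    rw [one_div, Real.rpow_inv_natCast_pow (by positivity) (by omega)]
  calc _ ≤ constA p c coef * ((c : ℝ) * ε / (((c : ℝ) + p) * constA p c coef)) :=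
        mul_le_mul_of_nonneg_left h1 hA.le
    _ = _ := by field_simp

/-- The two terms of the maximum `K` correspond to the two terms of the minimum that defines `η`. -/
theorem div_constK_le {p c : ℕ} (hp : 1 ≤ p) (hc : 1 ≤ c) {coef : ℕ → ℂ}
    (hA : 0 < constA p c coef) {ε : ℝ} (hε : 0 < ε) (hε1 : ε ≤ 1) {η : ℝ}
    (hη : η = etaOpt p c coef ε) :
    ε ^ (2 + 2 * (c : ℝ) / p) / constK p c coef η
      ≤ (p * ε / (c + p)) ^ 2 / (2 * (constB p c coef η / η ^ c) ^ 2) := by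
  have hp0 : (0 : ℝ) < p := by exact_mod_cast hp
  have hc0 : (0 : ℝ) < c := by exact_mod_cast hc
  have hη0 : 0 < η := hη ▸ etaOpt_pos hp hc hA hε
  rcases (constB_nonneg p c coef hη0.le).eq_or_lt with hB | hB
  · -- for `B = 0` both sides are zero, as quotients by zero
    have hK : constK p c coef η = 0 := by
      rw [constK, ← hB]; simp
    rw [hK, div_zero]
    positivity
  have hr : ∀ x : ℝ, 0 < x → x ^ (2 + 2 * (c : ℝ) / p) = x ^ 2 * x ^ (2 * (c : ℝ) / p) :=
    fun x hx => by rw [Real.rpow_add hx]; norm_num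
  rcases min_choice (((c : ℝ) * ε / (((c : ℝ) + p) * constA p c coef)) ^ (1 / (p : ℝ)))
    (((p : ℝ) + 1) / ((p : ℝ) * ((p : ℝ) + c))) with h | h
  · have h1 : η ^ (2 * c) = (c : ℝ) ^ (2 * (c : ℝ) / p) * ε ^ (2 * (c : ℝ) / p)
        / (((c : ℝ) + p) ^ (2 * (c : ℝ) / p) * constA p c coef ^ (2 * (c : ℝ) / p)) := by
      rw [hη, etaOpt, h, ← Real.rpow_natCast, ← Real.rpow_mul (by positivity),
        Real.div_rpow (by positivity) (by positivity), Real.mul_rpow hc0.le hε.le,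
        Real.mul_rpow (by positivity) hA.le]
      have e : 1 / (p : ℝ) * ((2 * c : ℕ) : ℝ) = 2 * (c : ℝ) / p := by push_cast; ring
      rw [e]
    have hK : 0 < 2 * constA p c coef ^ (2 * (c : ℝ) / p) * constB p c coef η ^ 2
        * ((c : ℝ) + p) ^ (2 + 2 * (c : ℝ) / p)
        / ((c : ℝ) ^ (2 * (c : ℝ) / p) * (p : ℝ) ^ 2) := by positivity
    refine (div_le_div_of_nonneg_left (by positivity) hK (le_max_left _ _)).trans (le_of_eq ?_)
    rw [hr ε hε, hr _ (by positivity : (0 : ℝ) < (c : ℝ) + p), div_pow (constB p c coef η),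
      ← pow_mul, mul_comm c 2, h1]
    have hx1 : (0 : ℝ) < (c : ℝ) ^ (2 * (c : ℝ) / p) := by positivity
    have hx2 : (0 : ℝ) < ε ^ (2 * (c : ℝ) / p) := by positivity
    have hx3 : (0 : ℝ) < ((c : ℝ) + p) ^ (2 * (c : ℝ) / p) := by positivity
    have hx4 : (0 : ℝ) < constA p c coef ^ (2 * (c : ℝ) / p) := by positivity
    generalize (c : ℝ) ^ (2 * (c : ℝ) / p) = x1 at *
    generalize ε ^ (2 * (c : ℝ) / p) = x2 at *
    generalize ((c : ℝ) + p) ^ (2 * (c : ℝ) / p) = x3 at *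
    generalize constA p c coef ^ (2 * (c : ℝ) / p) = x4 at *
    field_simp
  · have h1 : η ^ (2 * c)
        = ((p : ℝ) + 1) ^ (2 * c) / ((p : ℝ) ^ (2 * c) * ((c : ℝ) + p) ^ (2 * c)) := by
      rw [hη, etaOpt, h, div_pow, mul_pow, add_comm (c : ℝ)]
    have hK : 0 < 2 * (p : ℝ) ^ (2 * c - 2) * constB p c coef η ^ 2 * ((c : ℝ) + p) ^ (2 * c + 2)
        / ((p : ℝ) + 1) ^ (2 * c) := by positivity
    have h2 : ε ^ (2 + 2 * (c : ℝ) / p) ≤ ε ^ 2 := by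
      rw [hr ε hε]
      exact mul_le_of_le_one_right (by positivity) (Real.rpow_le_one hε.le hε1 (by positivity))
    refine (div_le_div_of_nonneg_left (by positivity) hK (le_max_right _ _)).trans
      ((div_le_div_of_nonneg_right h2 hK.le).trans (le_of_eq ?_))
    have h3 : (p : ℝ) ^ (2 * c) = (p : ℝ) ^ (2 * c - 2) * (p : ℝ) ^ 2 := by
      rw [← pow_add]; congr 1; omega
    rw [div_pow (constB p c coef η), ← pow_mul, mul_comm c 2, h1, h3, pow_add _ (2 * c) 2]
    field_simp

/-- For `ε ≥ M m` truncation alone gives the precision. -/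
theorem guarantee_truncWitness_of_le (T : Target m) (hm : 1 ≤ m) {ρ : Fock m →L[ℂ] Fock m}
    (hρ : IsDensity ρ) (p : Fin m → ℕ) (η : Fin m → ℝ) {M : ℕ} (hM : 1 ≤ M) (N : ℕ) {ε δ : ℝ}
    (hε : (M : ℝ) * m ≤ ε) (hδ : 0 ≤ δ) : Guarantee T M N ρ ε δ (truncWitness T p η M) := by
  obtain ⟨F, hF1, hF, hf, -, hfF, -⟩ := exists_mode_fidelity T hρ
  refine guarantee_of_close T hρ hF1 hF hf hfF hM (bad := ∅) (by simpa using hδ) fun γ _ => ?_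
  refine abs_witness_sub_le (fun i => ?_) hm
  calc (m : ℝ) * _ ≤ m * (M * min 1 |meanEstimate T p η γ i - F i|) :=
        mul_le_mul_of_nonneg_left (abs_trunc_pow_sub_le (hf.trans (hF i)) (hF1 i) M)
          (by positivity)
    _ ≤ m * (M * 1) := by gcongr; exact min_le_left _ _
    _ ≤ ε := by rw [mul_one, mul_comm]; exact hε

theorem guarantee_truncWitness_etaOpt (T : Target m) (hm : 1 ≤ m) {p : Fin m → ℕ}
    (hp : ∀ i, 1 ≤ p i) {M N : ℕ} (hM : 1 ≤ M) (hN : 1 ≤ N) {ε : ℝ} (hε : 0 < ε) {η : Fin m → ℝ}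
    (hη : ∀ i, η i = etaOpt (p i) (T.c i) (T.coef i) (ε / ((M : ℝ) * m)))
    {ρ : Fock m →L[ℂ] Fock m} (hρ : IsDensity ρ) :
    Guarantee T M N ρ ε (failureProb T p η M N ε) (truncWitness T p η M) := by
  have hm0 : (0 : ℝ) < m := by exact_mod_cast hm
  have hM0 : (0 : ℝ) < M := by exact_mod_cast hM
  have hMm : (0 : ℝ) < M * m := by positivity
  rcases le_total ((M : ℝ) * m) ε with hε1 | hε1
  · exact guarantee_truncWitness_of_le T hm hρ p η hM N hε1 (by rw [failureProb]; positivity)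
  obtain ⟨F, hF1, hF, hf, -, hfF, hE⟩ := exists_mode_fidelity T hρ
  set e := ε / ((M : ℝ) * m) with he
  have he0 : 0 < e := by positivity
  have he1 : e ≤ 1 := (div_le_one hMm).2 hε1
  have hc : ∀ i, 1 ≤ T.c i := fun i => one_le_of_normalized (T.normalized i)
  have hA : ∀ i, 0 < constA (p i) (T.c i) (T.coef i) := fun i =>
    zero_lt_one.trans_le (one_le_constA (T.normalized i) (p i))
  have hη0 : ∀ i, 0 < η i := fun i => hη i ▸ etaOpt_pos (hp i) (hc i) (hA i) he0
  have hη1 : ∀ i, η i ≤ ((p i : ℝ) + 1) / ((p i : ℝ) * ((p i : ℝ) + T.c i)) := fun i =>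
    (hη i).le.trans (min_le_right _ _)
  -- the precision `e` is divided into the bias `c e / (c + p)` and the deviation `p e / (c + p)`
  have hdev := real_sampleLaw_deviation_le T hρ hp hη0 hη1
    (fun i => hE i (p i) (η i) (hp i) (hη0 i) (hη1 i)) (fun i => le_rfl)
    (lam := fun i => p i * e / (T.c i + p i)) (fun i => by positivity) (t := e) (fun i => by
      have h1 := constA_mul_etaOpt_pow_le (hp i) (hc i) (hA i) he0
      have hc0 : (0 : ℝ) < T.c i := by exact_mod_cast hc i
      have h2 : p i * e / (T.c i + p i) + T.c i * e / (T.c i + p i) = e := by field_simp; ring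
      rw [hη i]
      linarith) hN
  refine guarantee_of_close T hρ hF1 hF hf hfF hM (hdev.trans ?_) fun γ hγ => ?_
  · rw [failureProb, Finset.mul_sum]
    refine Finset.sum_le_sum fun i _ =>
      mul_le_mul_of_nonneg_left (Real.exp_le_exp.2 ?_) (by norm_num)
    have h1 := div_constK_le (hp i) (hc i) (hA i) he0 he1 (hη i)
    rw [he, Real.div_rpow hε.le hMm.le, ← he, div_div] at h1
    have h2 := mul_le_mul_of_nonneg_left h1 (Nat.cast_nonneg' N : (0 : ℝ) ≤ N)
    rw [← mul_div_assoc, ← mul_div_assoc] at h2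
    exact neg_le_neg h2
  · simp only [Set.mem_ofPred_eq, not_exists, not_lt] at hγ
    refine abs_witness_sub_le (fun i => ?_) hm
    calc (m : ℝ) * _ ≤ m * (M * min 1 |meanEstimate T p η γ i - F i|) :=
          mul_le_mul_of_nonneg_left (abs_trunc_pow_sub_le (hf.trans (hF i)) (hF1 i) M) hm0.le
      _ ≤ m * (M * e) := by gcongr; exact (min_le_right _ _).trans (hγ i)
      _ = ε := by rw [he]; field_simp

/-! ### Number of samples -/

theorem norm_coef_le_one {c : ℕ} {coef : ℕ → ℂ} (h : ∑ n ∈ Finset.range c, ‖coef n‖ ^ 2 = 1)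
    {n : ℕ} (hn : n ∈ Finset.range c) : ‖coef n‖ ≤ 1 := by
  have h1 := Finset.single_le_sum (f := fun n => ‖coef n‖ ^ 2) (fun _ _ => by positivity) hn
  rw [h] at h1
  exact (sq_le_one_iff₀ (norm_nonneg _)).1 h1

theorem choose_le_two_pow_cast {a b k : ℕ} (h : a ≤ b) : (a.choose k : ℝ) ≤ 2 ^ b := by
  calc (a.choose k : ℝ) ≤ 2 ^ a := by exact_mod_cast Nat.choose_le_two_pow a k
    _ ≤ 2 ^ b := pow_le_pow_right₀ (by norm_num) h

theorem constA_le {c p cmax pmax : ℕ} {coef : ℕ → ℂ}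
    (h : ∑ n ∈ Finset.range c, ‖coef n‖ ^ 2 = 1) (hc : c ≤ cmax) (hp : p ≤ pmax) :
    constA p c coef ≤ (cmax * 2 ^ (cmax + pmax)) ^ 2 := by
  refine pow_le_pow_left₀ (Finset.sum_nonneg fun _ _ => by positivity) ?_ 2
  calc _ ≤ ∑ _n ∈ Finset.range c, (2 : ℝ) ^ (cmax + pmax) := Finset.sum_le_sum fun n hn => by
        have hn' := Finset.mem_range.1 hn
        have h1 : Real.sqrt ((n + p).choose n : ℝ) ≤ 2 ^ (cmax + pmax) :=
          (Real.sqrt_le_left (by positivity)).2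
            ((choose_le_two_pow_cast (by omega : n + p ≤ cmax + pmax)).trans
              (le_self_pow₀ (one_le_pow₀ (by norm_num)) (by norm_num)))
        calc _ ≤ 1 * (2 : ℝ) ^ (cmax + pmax) :=
              mul_le_mul (norm_coef_le_one h hn) h1 (Real.sqrt_nonneg _) zero_le_one
          _ = _ := one_mul _
    _ = c * 2 ^ (cmax + pmax) := by rw [Finset.sum_const, Finset.card_range, nsmul_eq_mul]
    _ ≤ _ := by gcongr

theorem constB_le {c p cmax pmax : ℕ} {coef : ℕ → ℂ}
    (h : ∑ n ∈ Finset.range c, ‖coef n‖ ^ 2 = 1) (hc : c ≤ cmax) (hp : p ≤ pmax) {η : ℝ}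
    (hη : 0 < η) (hη1 : η ≤ 1) :
    constB p c coef η ≤ cmax ^ 2 * (2 ^ (cmax + pmax) * 2 ^ (cmax + cmax)) := by
  have h2 : ∀ k ∈ Finset.range c, ∀ l ∈ Finset.range c,
      ‖coef k * coef l‖ * η ^ ((c : ℝ) - 1 - ((k : ℝ) + (l : ℝ)) / 2)
      * ((max k l + p).choose (p - 1) : ℝ)
      * Real.sqrt (2 ^ (max k l - min k l) * ((max k l).choose (min k l) : ℝ))
      ≤ 2 ^ (cmax + pmax) * 2 ^ (cmax + cmax) := by
    intro k hk l hl
    have hk' := Finset.mem_range.1 hk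
    have hl' := Finset.mem_range.1 hl
    have h3 : ‖coef k * coef l‖ ≤ 1 := by
      rw [norm_mul]
      exact mul_le_one₀ (norm_coef_le_one h hk) (norm_nonneg _) (norm_coef_le_one h hl)
    have h4 : η ^ ((c : ℝ) - 1 - ((k : ℝ) + (l : ℝ)) / 2) ≤ 1 := by
      refine Real.rpow_le_one hη.le hη1 ?_
      have h5 : (k : ℝ) + 1 ≤ c := by exact_mod_cast hk'
      have h6 : (l : ℝ) + 1 ≤ c := by exact_mod_cast hl'
      linarith
    have h5 : ((max k l + p).choose (p - 1) : ℝ) ≤ 2 ^ (cmax + pmax) :=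
      choose_le_two_pow_cast (by omega)
    have h6 : Real.sqrt (2 ^ (max k l - min k l) * ((max k l).choose (min k l) : ℝ))
        ≤ 2 ^ (cmax + cmax) := by
      refine (Real.sqrt_le_left (by positivity)).2 (le_trans ?_
        (le_self_pow₀ (one_le_pow₀ (by norm_num)) (by norm_num)))
      rw [pow_add]
      exact mul_le_mul (pow_le_pow_right₀ (by norm_num) (by omega))
        (choose_le_two_pow_cast (by omega)) (by positivity) (by positivity)
    calc _ ≤ (1 : ℝ) * 1 * 2 ^ (cmax + pmax) * 2 ^ (cmax + cmax) := by gcongr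
      _ = _ := by ring
  calc constB p c coef η
      ≤ ∑ _k ∈ Finset.range c, ∑ _l ∈ Finset.range c,
        (2 : ℝ) ^ (cmax + pmax) * 2 ^ (cmax + cmax) :=
        Finset.sum_le_sum fun k hk => Finset.sum_le_sum fun l hl => h2 k hk l hl
    _ = (c : ℝ) ^ 2 * (2 ^ (cmax + pmax) * 2 ^ (cmax + cmax)) := by
        simp only [Finset.sum_const, Finset.card_range, nsmul_eq_mul]; ring
    _ ≤ _ := by gcongr

/-- The sum over the modes of `1 / nᵢ` is the number of distinct ratios `cᵢ / pᵢ`, which is bounded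
in terms of the bounds on `cᵢ` and `pᵢ`. -/
theorem sum_inv_ratioCount_le {c p : Fin m → ℕ} {cmax pmax : ℕ} (hc : ∀ i, c i ≤ cmax)
    (hp : ∀ i, p i ≤ pmax) :
    ∑ i, ((ratioCount c p i : ℝ))⁻¹ ≤ ((cmax : ℝ) + 1) * (pmax + 1) := by
  classical
  set r : Fin m → ℚ := fun i => (c i : ℚ) / (p i : ℚ) with hr
  have h1 := Finset.sum_comp (s := Finset.univ)
    (fun v : ℚ => (((Finset.univ.filter fun j => r j = v).card : ℝ))⁻¹) r
  have h2 : ∀ v ∈ Finset.univ.image r, (Finset.univ.filter fun j => r j = v).card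
      • (((Finset.univ.filter fun j => r j = v).card : ℝ))⁻¹ = 1 := by
    intro v hv
    obtain ⟨i, -, rfl⟩ := Finset.mem_image.1 hv
    rw [nsmul_eq_mul, mul_inv_cancel₀]
    exact_mod_cast (Finset.card_pos.2 ⟨i, by simp⟩).ne'
  rw [Finset.sum_congr rfl h2, Finset.sum_const, nsmul_eq_mul, mul_one] at h1
  have h3 : Finset.univ.image r ⊆ (Finset.range (cmax + 1) ×ˢ Finset.range (pmax + 1)).image
      fun q => (q.1 : ℚ) / (q.2 : ℚ) := by
    intro v hv
    obtain ⟨i, -, rfl⟩ := Finset.mem_image.1 hv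
    exact Finset.mem_image.2 ⟨(c i, p i), by simp [hc i, hp i], rfl⟩
  have h4 := (Finset.card_le_card h3).trans Finset.card_image_le
  rw [Finset.card_product, Finset.card_range, Finset.card_range] at h4
  calc ∑ i, ((ratioCount c p i : ℝ))⁻¹ = ((Finset.univ.image r).card : ℝ) := h1
    _ ≤ ((cmax + 1) * (pmax + 1) : ℕ) := by exact_mod_cast h4
    _ = _ := by push_cast; ring

theorem one_le_ratioCount (c p : Fin m → ℕ) (i : Fin m) : 1 ≤ ratioCount c p i :=
  Finset.card_pos.2 ⟨i, by simp⟩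

/-- The exponent `(4 + 4 log Q) log(2n) log(2/δ)` makes a failure probability at most
`δ / (n Q)`. -/
theorem two_mul_exp_neg_le {n Q δ x : ℝ} (hn : 1 ≤ n) (hQ : 1 ≤ Q) (hδ : 0 < δ) (hδ1 : δ ≤ 1)
    (hx : (4 + 4 * Real.log Q) * (Real.log (2 * n) * Real.log (2 / δ)) ≤ x) :
    2 * Real.exp (-x) ≤ δ * Q⁻¹ * n⁻¹ := by
  have hn0 : 0 < n := by linarith
  have hQ0 : 0 < Q := by linarith
  have hq : 0 ≤ Real.log Q := Real.log_nonneg hQ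
  have h2 : (1 / 2 : ℝ) ≤ Real.log 2 := by linarith [Real.log_two_gt_d9]
  have hL : (1 / 2 : ℝ) ≤ Real.log (2 / δ) :=
    h2.trans (Real.log_le_log (by norm_num) ((le_div_iff₀ hδ).2 (by linarith)))
  have hy : (1 / 2 : ℝ) ≤ Real.log (2 * n) :=
    h2.trans (Real.log_le_log (by norm_num) (by linarith))
  have hny : Real.log n ≤ Real.log (2 * n) := Real.log_le_log hn0 (by linarith)
  set L := Real.log (2 / δ) with hLdef
  set y := Real.log (2 * n) with hydef
  have h3 : L + Real.log n + Real.log Q ≤ x := by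
    refine le_trans ?_ hx
    have h4 : (1 / 2) * L ≤ y * L := mul_le_mul_of_nonneg_right hy (by linarith)
    have h5 : y * (1 / 2) ≤ y * L := mul_le_mul_of_nonneg_left hL (by linarith)
    have h6 : Real.log Q * (1 / 4) ≤ Real.log Q * (y * L) :=
      mul_le_mul_of_nonneg_left (by linarith) hq
    linarith
  calc 2 * Real.exp (-x) ≤ 2 * Real.exp (-(L + Real.log n + Real.log Q)) := by
        gcongr
    _ = δ * Q⁻¹ * n⁻¹ := by
        rw [Real.exp_neg, Real.exp_add, Real.exp_add, Real.exp_log hn0, Real.exp_log hQ0, hLdef,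
          Real.exp_log (by positivity)]
        field_simp

theorem rpow_inv_le_of_le_pow {x τ : ℝ} (hx : 0 ≤ x) (hτ : 0 ≤ τ) {p : ℕ} (hp : 1 ≤ p)
    (h : x ≤ τ ^ p) : x ^ ((p : ℝ)⁻¹) ≤ τ :=
  (Real.rpow_le_rpow hx h (by positivity)).trans
    (le_of_eq (Real.pow_rpow_inv_natCast hτ (by omega)))

/-- The Hoeffding exponent of one sample, for deviation `e/6` and `η = (κ e)^{1/p}`, is at
least `e^{2+2c/p}` times a factor that depends on `c` only through the bound `cmax`. -/
theorem le_exponent_of_eta {c p cmax : ℕ} (hp : 1 ≤ p) (hc : c ≤ cmax) {κ e B : ℝ} (hκ : 0 < κ)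
    (hκ1 : κ ≤ 1) (he : 0 < e) (hB : 0 < B) {η : ℝ} (hη : η = (κ * e) ^ ((p : ℝ)⁻¹)) :
    e ^ (2 + 2 * (c : ℝ) / p) * (κ ^ (2 * cmax) / (72 * B ^ 2))
      ≤ (e / 6) ^ 2 / (2 * (B / η ^ c) ^ 2) := by
  have hp0 : (1 : ℝ) ≤ p := by exact_mod_cast hp
  have hη0 : 0 < η := by rw [hη]; positivity
  have h1 : η ^ (2 * c) = κ ^ (2 * (c : ℝ) / p) * e ^ (2 * (c : ℝ) / p) := by
    rw [hη, ← Real.rpow_natCast, ← Real.rpow_mul (by positivity), Real.mul_rpow hκ.le he.le]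
    have h2 : ((p : ℝ))⁻¹ * ((2 * c : ℕ) : ℝ) = 2 * (c : ℝ) / p := by push_cast; ring
    rw [h2]
  have h3 : κ ^ (2 * cmax) ≤ κ ^ (2 * (c : ℝ) / p) := by
    rw [← Real.rpow_natCast]
    refine Real.rpow_le_rpow_of_exponent_ge hκ hκ1 ?_
    have h4 : (c : ℝ) ≤ cmax := by exact_mod_cast hc
    push_cast
    exact (div_le_self (by positivity) hp0).trans (by linarith)
  have h5 : e ^ (2 + 2 * (c : ℝ) / p) = e ^ 2 * e ^ (2 * (c : ℝ) / p) := by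
    rw [Real.rpow_add he]; norm_num
  have h6 : (e / 6) ^ 2 / (2 * (B / η ^ c) ^ 2)
      = e ^ 2 * e ^ (2 * (c : ℝ) / p) * (κ ^ (2 * (c : ℝ) / p) / (72 * B ^ 2)) := by
    rw [div_pow B, ← pow_mul, mul_comm c 2, h1]
    have hx1 : (0 : ℝ) < κ ^ (2 * (c : ℝ) / p) := by positivity
    have hx2 : (0 : ℝ) < e ^ (2 * (c : ℝ) / p) := by positivity
    generalize κ ^ (2 * (c : ℝ) / p) = x1 at *
    generalize e ^ (2 * (c : ℝ) / p) = x2 at *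
    field_simp
    norm_num
  rw [h5, h6]
  gcongr

/-- The number of samples. The precision `e/3` of the mode estimates, with `e = ε/(Mm)`, is divided
equally into bias and deviation; the factor `1/3` makes up for the loss in `M`-th powers of
untruncated estimates. -/
theorem exists_sample_constant (cmax pmax : ℕ) : ∃ K : ℝ, 0 < K ∧
    ∀ (m : ℕ), 1 ≤ m → ∀ (T : Target m) (p : Fin m → ℕ),
    (∀ i, T.c i ≤ cmax) → (∀ i, 1 ≤ p i ∧ p i ≤ pmax) →
    ∀ (M : ℕ), 1 ≤ M → ∀ (ε : ℝ), 0 < ε →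
    ∃ η : Fin m → ℝ, (∀ i, 0 < η i ∧ η i < 1) ∧
    ∀ (δ : ℝ), 0 < δ → ∀ (N : ℕ), 1 ≤ N →
    (∀ i, K * (((M : ℝ) * m / ε) ^ (2 + 2 * (T.c i : ℝ) / p i)
        * Real.log (2 * ratioCount T.c p i) * Real.log (2 / δ)) ≤ N) →
    ∀ (ρ : Fock m →L[ℂ] Fock m), IsDensity ρ →
    Guarantee T M N ρ ε δ (truncWitness T p η M) ∧
    (ε ≤ m → Guarantee T M N ρ ε δ (witness T p η M)) := by
  -- `Ab` and `Bb` bound `A` and `B`, `τ` bounds all the `ηᵢ`, `Q` the number of ratios `cᵢ / pᵢ`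
  set Ab : ℝ := (cmax * 2 ^ (cmax + pmax)) ^ 2 + 1 with hAb
  set Bb : ℝ := cmax ^ 2 * (2 ^ (cmax + pmax) * 2 ^ (cmax + cmax)) + 1 with hBb
  set τ : ℝ := 1 / ((cmax : ℝ) + pmax + 2) with hτ
  set κ : ℝ := τ ^ (pmax + 1) / (6 * Ab) with hκ
  set Q : ℝ := ((cmax : ℝ) + 1) * (pmax + 1) with hQ
  have hA1 : 1 ≤ Ab := by rw [hAb]; linarith [sq_nonneg ((cmax : ℝ) * 2 ^ (cmax + pmax))]
  have hB0 : 0 < Bb := by positivity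
  have hτ0 : 0 < τ := by positivity
  have hτ1 : τ ≤ 1 / 2 := by
    rw [hτ]
    exact one_div_le_one_div_of_le (by norm_num) (by
      have h1 := Nat.cast_nonneg (α := ℝ) cmax
      have h2 := Nat.cast_nonneg (α := ℝ) pmax
      linarith)
  have hκ0 : 0 < κ := by positivity
  have hκτ : κ ≤ τ ^ (pmax + 1) := div_le_self (by positivity) (by linarith)
  have hκA : Ab * κ ≤ 1 / 6 := by
    have h1 : τ ^ (pmax + 1) ≤ 1 := pow_le_one₀ hτ0.le (by linarith)
    rw [hκ]
    calc Ab * (τ ^ (pmax + 1) / (6 * Ab)) = τ ^ (pmax + 1) / 6 := by field_simp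
      _ ≤ 1 / 6 := by linarith
  have hκ1 : κ ≤ 1 := hκτ.trans (pow_le_one₀ hτ0.le (by linarith))
  have hQ1 : 1 ≤ Q := by
    rw [hQ]
    exact one_le_mul_of_one_le_of_one_le (by simp) (by simp)
  have hq : 0 ≤ Real.log Q := Real.log_nonneg hQ1
  refine ⟨72 * Bb ^ 2 / κ ^ (2 * cmax) * (4 + 4 * Real.log Q), by positivity, ?_⟩
  intro m hm T p hc hp M hM ε hε
  have hm0 : (0 : ℝ) < m := by exact_mod_cast hm
  have hM0 : (0 : ℝ) < M := by exact_mod_cast hM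
  have hMm : (0 : ℝ) < M * m := by positivity
  set e := ε / ((M : ℝ) * m) with he
  have he0 : 0 < e := by positivity
  -- the minimum keeps `η` small when `ε > M m`, where the truncated estimate is trivially good
  set η : Fin m → ℝ := fun i => (κ * min e 1) ^ ((p i : ℝ)⁻¹) with hη
  have hmin : 0 < min e 1 := lt_min he0 one_pos
  have hητ : ∀ i, η i ≤ τ := fun i => by
    refine rpow_inv_le_of_le_pow (by positivity) hτ0.le (hp i).1 ?_
    calc κ * min e 1 ≤ κ * 1 := by gcongr; exact min_le_right _ _
      _ ≤ τ ^ (pmax + 1) := by rw [mul_one]; exact hκτ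
      _ ≤ τ ^ p i := pow_le_pow_of_le_one hτ0.le (by linarith) ((hp i).2.trans (Nat.le_succ _))
  have hη0 : ∀ i, 0 < η i := fun i => by positivity
  refine ⟨η, fun i => ⟨hη0 i, (hητ i).trans_lt (by linarith)⟩, ?_⟩
  intro δ hδ N hN hNK ρ hρ
  rcases le_total 1 δ with hδ1 | hδ1
  · exact ⟨guarantee_of_one_le T M N ρ ε hδ1 _, fun _ => guarantee_of_one_le T M N ρ ε hδ1 _⟩
  rcases lt_or_ge 1 e with he1 | he1
  · have h1 : (M : ℝ) * m < ε := (one_lt_div hMm).1 he1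
    refine ⟨guarantee_truncWitness_of_le T hm hρ p η hM N h1.le hδ.le, fun hεm => absurd h1 ?_⟩
    have h2 : (1 : ℝ) ≤ M := by exact_mod_cast hM
    nlinarith
  have hηe : ∀ i, η i = (κ * e) ^ ((p i : ℝ)⁻¹) := fun i => by rw [hη, min_eq_left he1]
  obtain ⟨F, hF1, hF, hf, -, hfF, hE⟩ := exists_mode_fidelity T hρ
  have hη1 : ∀ i, η i ≤ ((p i : ℝ) + 1) / ((p i : ℝ) * ((p i : ℝ) + T.c i)) := fun i => by
    have hp0 : (0 : ℝ) < p i := by exact_mod_cast (hp i).1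
    refine (hητ i).trans ?_
    rw [hτ, div_le_div_iff₀ (by positivity) (by positivity), one_mul]
    have h1 : (p i : ℝ) ≤ pmax := by exact_mod_cast (hp i).2
    have h2 : (T.c i : ℝ) ≤ cmax := by exact_mod_cast hc i
    exact mul_le_mul (by linarith) (by linarith) (by positivity) (by linarith)
  have hdev := real_sampleLaw_deviation_le T hρ (fun i => (hp i).1) hη0 hη1
    (fun i => hE i (p i) (η i) (hp i).1 (hη0 i) (hη1 i)) (Bd := fun _ => Bb)
    (fun i => (constB_le (T.normalized i) (hc i) (hp i).2 (hη0 i)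
      ((hητ i).trans (by linarith))).trans (by rw [hBb]; linarith))
    (lam := fun _ => e / 6) (fun i => by positivity) (t := e / 3) (fun i => by
      have h1 : η i ^ p i = κ * e := by
        rw [hηe i, Real.rpow_inv_natCast_pow (by positivity) (by have := (hp i).1; omega)]
      have h2 : constA (p i) (T.c i) (T.coef i) ≤ Ab :=
        (constA_le (T.normalized i) (hc i) (hp i).2).trans (by rw [hAb]; linarith)
      have h3 : constA (p i) (T.c i) (T.coef i) * (κ * e) ≤ 1 / 6 * e := by
        calc _ ≤ Ab * (κ * e) := by gcongr
          _ = Ab * κ * e := by ring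
          _ ≤ _ := by gcongr
      rw [h1]
      linarith) hN
  have htail : ∑ i, 2 * Real.exp (-(N * (e / 6) ^ 2 / (2 * (Bb / η i ^ T.c i) ^ 2))) ≤ δ := by
    have h1 : ∀ i ∈ (Finset.univ : Finset (Fin m)),
        2 * Real.exp (-(N * (e / 6) ^ 2 / (2 * (Bb / η i ^ T.c i) ^ 2)))
        ≤ δ * Q⁻¹ * ((ratioCount T.c p i : ℝ))⁻¹ := fun i _ => by
      refine two_mul_exp_neg_le (by exact_mod_cast one_le_ratioCount T.c p i) hQ1 hδ hδ1 ?_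
      have h2 := le_exponent_of_eta (hp i).1 (hc i) hκ0 hκ1 he0 hB0 (hηe i)
      have h3 := hNK i
      have h4 : ((M : ℝ) * m / ε) ^ (2 + 2 * (T.c i : ℝ) / p i)
          = (e ^ (2 + 2 * (T.c i : ℝ) / p i))⁻¹ := by
        rw [← Real.inv_rpow he0.le, he, inv_div]
      rw [h4] at h3
      have h5 := mul_le_mul h3 h2 (by positivity) (Nat.cast_nonneg N)
      have hx : 0 < e ^ (2 + 2 * (T.c i : ℝ) / p i) := by positivity
      have hk : 0 < κ ^ (2 * cmax) := by positivity
      rw [mul_div_assoc]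
      refine le_trans (le_of_eq ?_) h5
      generalize e ^ (2 + 2 * (T.c i : ℝ) / p i) = x at *
      generalize κ ^ (2 * cmax) = k at *
      field_simp
    refine (Finset.sum_le_sum h1).trans ?_
    rw [← Finset.mul_sum]
    calc _ ≤ δ * Q⁻¹ * Q := mul_le_mul_of_nonneg_left
          (sum_inv_ratioCount_le hc fun i => (hp i).2) (by positivity)
      _ = δ := by field_simp
  have hbad := hdev.trans htail
  refine ⟨guarantee_of_close T hρ hF1 hF hf hfF hM hbad fun γ hγ => ?_, fun hεm =>
    guarantee_of_close T hρ hF1 hF hf hfF hM hbad fun γ hγ => ?_⟩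
  · simp only [Set.mem_ofPred_eq, not_exists, not_lt] at hγ
    refine abs_witness_sub_le (fun i => ?_) hm
    calc (m : ℝ) * _ ≤ m * (M * min 1 |meanEstimate T p η γ i - F i|) :=
          mul_le_mul_of_nonneg_left (abs_trunc_pow_sub_le (hf.trans (hF i)) (hF1 i) M) hm0.le
      _ ≤ m * (M * e) := by
          gcongr
          exact ((min_le_right _ _).trans (hγ i)).trans (by linarith)
      _ = ε := by rw [he]; field_simp
  · simp only [Set.mem_ofPred_eq, not_exists, not_lt] at hγ
    have hMe : (M : ℝ) * e ≤ 1 := by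
      rw [he]
      calc (M : ℝ) * (ε / (M * m)) = ε / m := by field_simp
        _ ≤ 1 := (div_le_one hm0).2 hεm
    refine abs_witness_sub_le (fun i => ?_) hm
    calc (m : ℝ) * _ ≤ m * (3 * (M * (e / 3))) :=
          mul_le_mul_of_nonneg_left (abs_pow_sub_pow_le_three (hf.trans (hF i)) (hF1 i) (hγ i)
            (by linarith)) hm0.le
      _ = ε := by rw [he]; field_simp

end

end CVWitness

theorem mainTheorem2 :
    -- the samples have a probability law
    (∀ (m N : ℕ) (ρ : CVWitness.Fock m →L[ℂ] CVWitness.Fock m) (ξ : Fin m → ℂ),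
      CVWitness.IsDensity ρ → IsProbabilityMeasure (CVWitness.sampleLaw N ρ ξ)) ∧
    -- explicit failure probability
    (∀ (m : ℕ), 1 ≤ m → ∀ (T : CVWitness.Target m) (p : Fin m → ℕ), (∀ i, 1 ≤ p i) →
      ∀ (M N : ℕ), 1 ≤ M → 1 ≤ N → ∀ (ε : ℝ), 0 < ε → ∀ (η : Fin m → ℝ),
      (∀ i, η i = CVWitness.etaOpt (p i) (T.c i) (T.coef i) (ε / ((M : ℝ) * m))) →
      ∀ (ρ : CVWitness.Fock m →L[ℂ] CVWitness.Fock m), CVWitness.IsDensity ρ →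
      CVWitness.Guarantee T M N ρ ε (CVWitness.failureProb T p η M N ε)
        (CVWitness.truncWitness T p η M)) ∧
    -- number of samples
    (∀ cmax pmax : ℕ, ∃ K : ℝ, 0 < K ∧
      ∀ (m : ℕ), 1 ≤ m → ∀ (T : CVWitness.Target m) (p : Fin m → ℕ),
      (∀ i, T.c i ≤ cmax) → (∀ i, 1 ≤ p i ∧ p i ≤ pmax) →
      ∀ (M : ℕ), 1 ≤ M → ∀ (ε : ℝ), 0 < ε →
      ∃ η : Fin m → ℝ, (∀ i, 0 < η i ∧ η i < 1) ∧
      ∀ (δ : ℝ), 0 < δ → ∀ (N : ℕ), 1 ≤ N →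
      (∀ i, K * (((M : ℝ) * m / ε) ^ (2 + 2 * (T.c i : ℝ) / p i)
          * Real.log (2 * CVWitness.ratioCount T.c p i) * Real.log (2 / δ)) ≤ N) →
      ∀ (ρ : CVWitness.Fock m →L[ℂ] CVWitness.Fock m), CVWitness.IsDensity ρ →
      CVWitness.Guarantee T M N ρ ε δ (CVWitness.truncWitness T p η M) ∧
      (ε ≤ m → CVWitness.Guarantee T M N ρ ε δ (CVWitness.witness T p η M))) :=
  ⟨fun _ N _ ξ hρ => CVWitness.isProbabilityMeasure_sampleLaw hρ N ξ,
    fun _ hm T _ hp _ _ hM hN _ hε _ hη _ hρ =>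
      CVWitness.guarantee_truncWitness_etaOpt T hm hp hM hN hε hη hρ,
    CVWitness.exists_sample_constant⟩
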